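/- Let $k$ be a field, let $N\cong\mathbb Z^d$ be a lattice, and let $\Delta$ be a fan in $N_{\mathbb R}=N\otimes_{\mathbb Z}\mathbb R$, that is, a finite nonempty collection of strongly convex rational polyhedral cones that is closed under taking faces and in which the intersection of any two cones is a face of each. Let $X=X_\Delta$ be the (normal) toric variety over $k$ obtained by gluing the affine schemes $\operatorname{Spec}k[\sigma^\vee\cap M]$ for $\sigma\in\Delta$, where $M=\operatorname{Hom}(N,\mathbb Z)$. Let $\{D_i\}$ be the prime divisors of $X$ that are stable under the torus $T=\operatorname{Spec}k[M]$, let $\mathrm{Div}_TX$ be the group of $T$-invariant Cartier divisors on $X$, and let $G$ be the cokernel of the homomorphism $\mathrm{Div}_TX\to\bigoplus_i\mathbb Z\cdot D_i$ that sends a Cartier divisor to its Weil divisor. Call $X$ simplicial if every cone of $\Delta$ is generated by linearly independent vectors, and call it smooth if $X\to\operatorname{Spec}k$ is smooth. Then: 1. $G$ is finite if and only if $X$ is simplicial. 2. $X$ is simplicial if and only if every Weil divisor on $X$ is $\mathbb Q$-Cartier, i.e. has a positive multiple that is Cartier. 3. $G$ is trivial if and only if $X$ is smooth. 4. $X$ is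 smooth if and only if every Weil divisor on $X$ is Cartier. -/

import Mathlib

open CategoryTheory Limits AlgebraicGeometry
open scoped TensorProduct

universe u

/-! ### Lattices, cones and fans -/

namespace ToricFan

/-- The real vector space `N_ℝ = ℝ ⊗ N` spanned by a lattice `N`. -/
abbrev RealSpace (N : Type u) [AddCommGroup N] : Type u := ℝ ⊗[ℤ] N

/-- `τ = σ ∩ H` where `H = u^⊥` for a real linear form `u` that is nonnegative on `σ`
(`u = 0` gives `σ` itself). -/
def IsFace {N : Type u} [AddCommGroup N] (τ σ : PointedCone ℝ (RealSpace N)) : Prop :=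
  ∃ w : Module.Dual ℝ (RealSpace N), (∀ v ∈ σ, 0 ≤ w v) ∧ ∀ v, v ∈ τ ↔ v ∈ σ ∧ w v = 0

/-- Strongly convex rational polyhedral cones: generated by finitely many lattice vectors, and
containing no line. -/
structure IsStronglyConvexRational {N : Type u} [AddCommGroup N]
    (σ : PointedCone ℝ (RealSpace N)) : Prop where
  rational : ∃ s : Finset N, σ = PointedCone.hull ℝ ((fun n : N => (1 : ℝ) ⊗ₜ[ℤ] n) '' (s : Set N))
  noLine : ∀ v, v ∈ σ → -v ∈ σ → v = 0

end ToricFan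

/-- A fan in the lattice `N`: a finite nonempty collection of strongly convex rational polyhedral
cones, closed under taking faces, in which any two cones intersect in a face of each. -/
structure ToricFan (N : Type u) [AddCommGroup N] where
  cones : Set (PointedCone ℝ (ToricFan.RealSpace N))
  finite : cones.Finite
  nonempty : cones.Nonempty
  isCone : ∀ σ ∈ cones, ToricFan.IsStronglyConvexRational σ
  face_mem : ∀ σ ∈ cones, ∀ τ, ToricFan.IsFace τ σ → τ ∈ cones
  inter_isFace : ∀ σ ∈ cones, ∀ τ ∈ cones, ToricFan.IsFace (σ ⊓ τ) σ

namespace ToricFan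

variable {N : Type u} [AddCommGroup N]

/-- `S_σ = σ^∨ ∩ M`, where `M = Hom(N, ℤ)`. -/
def dualMonoid (σ : PointedCone ℝ (RealSpace N)) : AddSubmonoid (Module.Dual ℤ N) where
  carrier := {m | ∀ v ∈ σ, 0 ≤ Module.Dual.baseChange ℝ m v}
  zero_mem' v _ := by simp [Module.Dual.baseChange]
  add_mem' {a b} ha hb v hv := by
    have h : Module.Dual.baseChange ℝ (a + b) v
        = Module.Dual.baseChange ℝ a v + Module.Dual.baseChange ℝ b v := by
      simp [Module.Dual.baseChange]
    rw [h]
    exact add_nonneg (ha v hv) (hb v hv)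

lemma mem_dualMonoid {σ : PointedCone ℝ (RealSpace N)} {m : Module.Dual ℤ N} :
    m ∈ dualMonoid σ ↔ ∀ v ∈ σ, 0 ≤ Module.Dual.baseChange ℝ m v := Iff.rfl

lemma dualMonoid_anti {τ σ : PointedCone ℝ (RealSpace N)} (h : τ ≤ σ) :
    dualMonoid σ ≤ dualMonoid τ := fun _ hm v hv => hm v (h hv)

lemma mem_dualMonoid_hull {s : Set N} {m : Module.Dual ℤ N} :
    m ∈ dualMonoid (PointedCone.hull ℝ ((fun n : N => (1 : ℝ) ⊗ₜ[ℤ] n) '' s)) ↔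
      ∀ n ∈ s, 0 ≤ m n := by
  rw [mem_dualMonoid]
  constructor
  · intro h n hn
    have := h _ (Submodule.subset_span ⟨n, hn, rfl⟩)
    simpa [Module.Dual.baseChange] using this
  · intro h v hv
    induction hv using Submodule.span_induction with
    | mem v hv =>
      obtain ⟨n, hn, rfl⟩ := hv
      simpa [Module.Dual.baseChange] using h n hn
    | zero => simp
    | add x y _ _ hx hy => rw [map_add]; exact add_nonneg hx hy
    | smul c x _ hx =>
      rw [Nonneg.mk_smul c.1 c.2 x] 
      rw [map_smul]; exact mul_nonneg c.2 hx

/-- A real linear form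
that is nonnegative on finitely many lattice vectors can be replaced by an integral one that vanishes
at, and is positive at, the same vectors. -/
lemma exists_int_form [Module.Finite ℤ N] (f : N →ₗ[ℤ] ℝ) (s : Finset N) (hf : ∀ n ∈ s, 0 ≤ f n) :
    ∃ w : Module.Dual ℤ N, ∀ n ∈ s, 0 ≤ w n ∧ (f n = 0 ↔ w n = 0) := by
  classical
  let P := LinearMap.range f
  let b := Module.Free.chooseBasis ℤ P
  let c : N →ₗ[ℤ] (Module.Free.ChooseBasisIndex ℤ P →₀ ℤ) := b.repr.toLinearMap ∘ₗ f.rangeRestrict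
  have hc0 : ∀ n, f n = 0 → c n = 0 := fun n hn => by
    have : f.rangeRestrict n = 0 := Subtype.ext hn
    simp [c, this]
  have hfc : ∀ n, f n = ∑ j, (b j : ℝ) * (c n j : ℝ) := fun n => by
    have h1 := congrArg (Subtype.val) (b.sum_repr (f.rangeRestrict n))
    simp only [AddSubmonoidClass.coe_finsetSum, Submodule.coe_smul] at h1
    rw [show f n = ((f.rangeRestrict n : P) : ℝ) from rfl, ← h1]
    exact Finset.sum_congr rfl fun j _ => by simp [c, zsmul_eq_mul, mul_comm]
  let U : Set (Module.Free.ChooseBasisIndex ℤ P → ℝ) :=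
    ⋂ n ∈ s.filter (fun n => 0 < f n), {x | 0 < ∑ j, x j * (c n j : ℝ)}
  have hU : IsOpen U := by
    refine isOpen_biInter_finset fun n _ => isOpen_lt continuous_const ?_
    fun_prop
  have hrU : (fun j => (b j : ℝ)) ∈ U := by
    simp only [U, Set.mem_iInter, Finset.mem_filter]
    intro n hn
    change 0 < ∑ j, (b j : ℝ) * (c n j : ℝ)
    rw [← hfc]; exact hn.2
  have hd : DenseRange (Pi.map fun (_ : Module.Free.ChooseBasisIndex ℤ P) (q : ℚ) => (q : ℝ)) :=
    DenseRange.piMap fun _ => Rat.denseRange_cast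
  obtain ⟨q, hq⟩ := hd.exists_mem_open hU ⟨_, hrU⟩
  obtain ⟨d, hd⟩ := IsLocalization.exist_integer_multiples_of_finset (nonZeroDivisors ℤ)
    (Finset.univ.image q)
  have hd0 : (d : ℤ) ≠ 0 := nonZeroDivisors.coe_ne_zero d
  have hd' : ∀ j, ∃ z : ℤ, (z : ℚ) = ((d : ℤ) : ℚ) * q j := fun j => by
    obtain ⟨z, hz⟩ := hd (q j) (by simp)
    exact ⟨z, by simpa [zsmul_eq_mul] using hz⟩
  choose z hz using hd'
  let w : Module.Dual ℤ N := ∑ j, ((d : ℤ) * z j) • (Finsupp.lapply j ∘ₗ c)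
  have hw : ∀ n, (w n : ℝ) = ((d : ℤ) : ℝ) ^ 2 * ∑ j, (q j : ℝ) * (c n j : ℝ) := fun n => by
    have hzR : ∀ j, (z j : ℝ) = ((d : ℤ) : ℝ) * (q j : ℝ) := fun j => by exact_mod_cast hz j
    simp only [w, LinearMap.sum_apply, LinearMap.smul_apply, LinearMap.comp_apply,
      Finsupp.lapply_apply, smul_eq_mul, Int.cast_sum, Int.cast_mul, hzR, Finset.mul_sum]
    exact Finset.sum_congr rfl fun j _ => by ring
  refine ⟨w, fun n hn => ?_⟩
  rcases (hf n hn).eq_or_lt with h0 | hpos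
  · have : w n = 0 := by
      have : (w n : ℝ) = 0 := by rw [hw, hc0 n h0.symm]; simp
      exact_mod_cast this
    simp [this, ← h0]
  · have h1 : 0 < (w n : ℝ) := by
      rw [hw]
      have h2 : 0 < ∑ j, (q j : ℝ) * (c n j : ℝ) := by
        have h3 := Set.mem_iInter₂.mp hq n (Finset.mem_filter.mpr ⟨hn, hpos⟩)
        simpa using h3
      have : ((d : ℤ) : ℝ) ≠ 0 := by exact_mod_cast hd0
      positivity
    have h2 : 0 < w n := by exact_mod_cast h1
    exact ⟨h2.le, by simp [hpos.ne', h2.ne']⟩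

/-- A face of a rational cone is cut out by an integral linear form. -/
lemma IsFace.exists_int [Module.Finite ℤ N] {τ σ : PointedCone ℝ (RealSpace N)} (h : IsFace τ σ)
    (hσ : IsStronglyConvexRational σ) :
    ∃ w ∈ dualMonoid σ, (∀ v, v ∈ τ ↔ v ∈ σ ∧ Module.Dual.baseChange ℝ w v = 0) := by
  obtain ⟨s, hs⟩ := hσ.rational
  obtain ⟨f, hf, hτ⟩ := h
  let g : N →ₗ[ℤ] ℝ := f.restrictScalars ℤ ∘ₗ TensorProduct.mk ℤ ℝ N 1
  have hmem : ∀ n ∈ s, (1 : ℝ) ⊗ₜ[ℤ] n ∈ σ := fun n hn => by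
    rw [hs]; exact Submodule.subset_span ⟨n, hn, rfl⟩
  obtain ⟨w, hw⟩ := exists_int_form g s fun n hn => hf _ (hmem n hn)
  have hwσ : w ∈ dualMonoid σ := by
    rw [hs, mem_dualMonoid_hull]; exact fun n hn => (hw n hn).1
  refine ⟨w, hwσ, fun v => ?_⟩
  rw [hτ]
  refine and_congr_right fun hv => ?_
  have hle : PointedCone.hull ℝ ((fun n : N => (1 : ℝ) ⊗ₜ[ℤ] n) '' (s : Set N)) ≤ σ := hs.ge
  rw [hs] at hv
  induction hv using Submodule.span_induction with
  | mem v hv =>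
    obtain ⟨n, hn, rfl⟩ := hv
    have h1 : f ((1 : ℝ) ⊗ₜ[ℤ] n) = 0 ↔ w n = 0 := (hw n hn).2
    simpa [Module.Dual.baseChange] using h1
  | zero => simp
  | add x y hx hy ihx ihy =>
    rw [map_add, map_add, add_eq_zero_iff_of_nonneg (hf x (hle hx)) (hf y (hle hy)),
      add_eq_zero_iff_of_nonneg (hwσ x (hle hx)) (hwσ y (hle hy))]
    exact and_congr ihx ihy
  | smul c x _ ih =>
    rw [Nonneg.mk_smul c.1 c.2 x, map_smul, map_smul, smul_eq_zero, smul_eq_zero]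
    exact or_congr_right ih

/-- If `τ = σ ∩ w^⊥` is a face then every element of `S_τ` becomes an element of `S_σ` after adding
a multiple of `w`. -/
lemma exists_add_nsmul_mem {τ σ : PointedCone ℝ (RealSpace N)}
    (hσ : IsStronglyConvexRational σ) {w : Module.Dual ℤ N} (hw : w ∈ dualMonoid σ)
    (hτ : ∀ v, v ∈ τ ↔ v ∈ σ ∧ Module.Dual.baseChange ℝ w v = 0)
    {m : Module.Dual ℤ N} (hm : m ∈ dualMonoid τ) : ∃ k : ℕ, m + k • w ∈ dualMonoid σ := by
  obtain ⟨s, hs⟩ := hσ.rational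
  have hw' := hw
  rw [hs, mem_dualMonoid_hull] at hw'
  refine ⟨∑ n ∈ s, (m n).natAbs, ?_⟩
  rw [hs, mem_dualMonoid_hull]
  intro n hn
  have h1 : (m n).natAbs ≤ ∑ n ∈ s, (m n).natAbs :=
    Finset.single_le_sum (f := fun n => (m n).natAbs) (fun _ _ => Nat.zero_le _) hn
  rw [LinearMap.add_apply, LinearMap.smul_apply, nsmul_eq_mul]
  have h2 : -(m n) ≤ ((∑ n ∈ s, (m n).natAbs : ℕ) : ℤ) := by omega
  rcases (hw' n hn).eq_or_lt with h0 | h0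
  · have : (1 : ℝ) ⊗ₜ[ℤ] n ∈ τ := by
      rw [hτ]
      refine ⟨by rw [hs]; exact Submodule.subset_span ⟨n, hn, rfl⟩, ?_⟩
      simp [Module.Dual.baseChange, ← h0]
    have := hm _ this
    have h3 : 0 ≤ m n := by simpa [Module.Dual.baseChange] using this
    rw [← h0]; simpa using h3
  · nlinarith

/-- Gordan's lemma. -/
lemma dualMonoid_fg [Module.Free ℤ N] [Module.Finite ℤ N] {σ : PointedCone ℝ (RealSpace N)}
    (hσ : IsStronglyConvexRational σ) : AddMonoid.FG (dualMonoid σ) := by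
  classical
  obtain ⟨s, hs⟩ := hσ.rational
  let b := Module.Free.chooseBasis ℤ (Module.Dual ℤ N)
  let ι := Module.Free.ChooseBasisIndex ℤ (Module.Dual ℤ N)
  -- triples `(x, y, t)` of natural vectors with `⟨x - y, n⟩ = t n` for the generators `n`
  let e : (ι → ℕ) →+ Module.Dual ℤ N :=
    { toFun := fun x => ∑ i, (x i) • b i
      map_zero' := by simp
      map_add' := fun x y => by simp [add_smul, Finset.sum_add_distrib] }
  let ev : Module.Dual ℤ N →+ (s → ℤ) :=
    { toFun := fun m n => m n
      map_zero' := by ext; simp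
      map_add' := fun x y => by ext; simp }
  let cst : (s → ℕ) →+ (s → ℤ) :=
    { toFun := fun t n => t n
      map_zero' := by ext; simp
      map_add' := fun x y => by ext; simp }
  let V := (ι → ℕ) × (ι → ℕ) × (s → ℕ)
  let F : V →+ (s → ℤ) := (ev.comp e).comp (AddMonoidHom.fst _ _)
  let G : V →+ (s → ℤ) := (ev.comp e).comp ((AddMonoidHom.fst _ _).comp (AddMonoidHom.snd _ _))
    + cst.comp ((AddMonoidHom.snd _ _).comp (AddMonoidHom.snd _ _))
  let p : V →+ Module.Dual ℤ N :=
    e.comp (AddMonoidHom.fst _ _) - e.comp ((AddMonoidHom.fst _ _).comp (AddMonoidHom.snd _ _))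
  have hfg : (F.eqLocusM G).FG := AddSubmonoid.fg_eqLocusM F G
  have hmap : (F.eqLocusM G).map p = dualMonoid σ := by
    ext m
    rw [hs, mem_dualMonoid_hull]
    constructor
    · rintro ⟨⟨x, y, t⟩, hxy, rfl⟩ n hn
      have h1 := congrFun (show F (x, y, t) = G (x, y, t) from hxy) ⟨n, hn⟩
      have h2 : e x n = e y n + t ⟨n, hn⟩ := h1
      have h3 : p (x, y, t) n = e x n - e y n := rfl
      rw [h3, h2]; simp
    · intro h
      refine ⟨(fun i => (b.repr m i).toNat, fun i => (-(b.repr m i)).toNat,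
        fun n => (m n).toNat), ?_, ?_⟩
      all_goals
        have key : e (fun i => (b.repr m i).toNat) - e (fun i => (-(b.repr m i)).toNat) = m := by
          change (∑ i, _) - (∑ i, _) = m
          rw [← Finset.sum_sub_distrib]
          conv_rhs => rw [← b.sum_repr m]
          refine Finset.sum_congr rfl fun i _ => ?_
          rw [← natCast_zsmul, ← natCast_zsmul, ← sub_smul]
          congr 1
          dsimp only
          omega
      · funext n
        have h1 := congrArg (fun l : Module.Dual ℤ N => l n) key
        have h2 := h n n.2
        simp only [LinearMap.sub_apply] at h1
        change e (fun i => (b.repr m i).toNat) n = e (fun i => (-(b.repr m i)).toNat) n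
          + ((m n).toNat : ℤ)
        omega
      · exact key
  rw [AddMonoid.fg_iff_addSubmonoid_fg, ← hmap]
  exact hfg.map p

/-! ### The toric variety of a fan -/

/-- The coordinate ring `k[S_σ]`. -/
abbrev coordRing (k : Type u) [Field k] (σ : PointedCone ℝ (RealSpace N)) : Type u :=
  AddMonoidAlgebra k (dualMonoid σ)

/-- The inclusion `k[S_σ] → k[S_τ]` for `τ ⊆ σ`. -/
noncomputable def coordRingMap (k : Type u) [Field k] {τ σ : PointedCone ℝ (RealSpace N)}
    (h : τ ≤ σ) : coordRing k σ →ₐ[k] coordRing k τ :=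
  AddMonoidAlgebra.mapDomainAlgHom k k (AddSubmonoid.inclusion (dualMonoid_anti h))

lemma coordRingMap_single (k : Type u) [Field k] {τ σ : PointedCone ℝ (RealSpace N)}
    (h : τ ≤ σ) (m : dualMonoid σ) (a : k) :
    coordRingMap k h (AddMonoidAlgebra.single m a) =
      AddMonoidAlgebra.single (AddSubmonoid.inclusion (dualMonoid_anti h) m) a := by
  simp [coordRingMap]

lemma coordRingMap_refl (k : Type u) [Field k] (σ : PointedCone ℝ (RealSpace N)) :
    coordRingMap k (le_refl σ) = AlgHom.id k _ :=
  AddMonoidAlgebra.mapDomainAlgHom_id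

lemma coordRingMap_trans (k : Type u) [Field k] {ρ τ σ : PointedCone ℝ (RealSpace N)}
    (h : ρ ≤ τ) (h' : τ ≤ σ) :
    coordRingMap k (h.trans h') = (coordRingMap k h).comp (coordRingMap k h') :=
  AddMonoidAlgebra.mapDomainAlgHom_comp (R := k) (A := k)
    (AddSubmonoid.inclusion (dualMonoid_anti h')) (AddSubmonoid.inclusion (dualMonoid_anti h))

lemma coordRingMap_injective (k : Type u) [Field k] {τ σ : PointedCone ℝ (RealSpace N)}
    (h : τ ≤ σ) : Function.Injective (coordRingMap k h) :=
  AddMonoidAlgebra.mapDomain_injective (AddSubmonoid.inclusion_injective (dualMonoid_anti h))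

/-- `k[S_τ]` is the localization of `k[S_σ]` at a monomial if `τ` is a face of `σ`. -/
lemma isLocalization_coordRingMap (k : Type u) [Field k] {τ σ : PointedCone ℝ (RealSpace N)}
    (hσ : IsStronglyConvexRational σ) (h : τ ≤ σ) (w : dualMonoid σ)
    (hτ : ∀ v, v ∈ τ ↔ v ∈ σ ∧ Module.Dual.baseChange ℝ w.1 v = 0) :
    letI := (coordRingMap k h).toRingHom.toAlgebra
    IsLocalization.Away (AddMonoidAlgebra.single w 1 : coordRing k σ) (coordRing k τ) := by
  let := (coordRingMap k h).toRingHom.toAlgebra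
  have halg : ∀ x, algebraMap (coordRing k σ) (coordRing k τ) x = coordRingMap k h x := fun _ => rfl
  have hneg : -w.1 ∈ dualMonoid τ := fun v hv => by
    rw [map_neg, LinearMap.neg_apply, ((hτ v).1 hv).2, neg_zero]
  have hpow : ∀ n : ℕ, algebraMap (coordRing k σ) (coordRing k τ)
      ((AddMonoidAlgebra.single w 1 : coordRing k σ) ^ n) =
      AddMonoidAlgebra.single (AddSubmonoid.inclusion (dualMonoid_anti h) (n • w)) 1 := fun n => by
    rw [AddMonoidAlgebra.single_pow, one_pow, halg, coordRingMap_single]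
  refine ⟨⟨?_, ?_, ?_⟩⟩
  · rintro ⟨_, n, rfl⟩
    refine (IsUnit.of_mul_eq_one
      (AddMonoidAlgebra.single (n • ⟨-w.1, hneg⟩ : dualMonoid τ) (1 : k)) ?_)
    change algebraMap (coordRing k σ) (coordRing k τ)
      ((AddMonoidAlgebra.single w 1 : coordRing k σ) ^ n) * _ = 1
    rw [hpow, AddMonoidAlgebra.single_mul_single, mul_one, AddMonoidAlgebra.one_def]
    congr 1
    ext1
    simp
  · intro z
    suffices H : ∃ (n : ℕ) (x : coordRing k σ), z * algebraMap (coordRing k σ) (coordRing k τ)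
        ((AddMonoidAlgebra.single w 1 : coordRing k σ) ^ n) = algebraMap _ _ x by
      obtain ⟨n, x, hx⟩ := H
      exact ⟨(x, ⟨_, n, rfl⟩), hx⟩
    induction z using AddMonoidAlgebra.induction_linear with
    | zero => exact ⟨0, 0, by simp⟩
    | add f g hf hg =>
      obtain ⟨n, x, hx⟩ := hf
      obtain ⟨n', x', hx'⟩ := hg
      refine ⟨n + n', x * (AddMonoidAlgebra.single w 1 : coordRing k σ) ^ n' +
        x' * (AddMonoidAlgebra.single w 1 : coordRing k σ) ^ n, ?_⟩
      rw [map_add, map_mul _ x, map_mul _ x', ← hx, ← hx', pow_add, map_mul]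
      ring
    | single m a =>
      obtain ⟨n, hn⟩ := exists_add_nsmul_mem hσ w.2 hτ m.2
      refine ⟨n, AddMonoidAlgebra.single ⟨m.1 + n • w.1, hn⟩ a, ?_⟩
      rw [hpow, AddMonoidAlgebra.single_mul_single, mul_one, halg, coordRingMap_single]
      rfl
  · intro x y hxy
    exact ⟨1, by rw [coordRingMap_injective k h hxy]⟩

variable (k : Type u) [Field k] (Δ : ToricFan N)

/-- The cones of a fan, ordered by inclusion. -/
abbrev Index : Type u := {σ : PointedCone ℝ (RealSpace N) // σ ∈ Δ.cones}

/-- The diagram of the affine toric varieties `U_σ = Spec k[S_σ]` and of their inclusions. -/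
noncomputable def diagram : Δ.Index ⥤ Scheme.{u} where
  obj σ := Spec (CommRingCat.of (coordRing k σ.1))
  map f := Spec.map (CommRingCat.ofHom (coordRingMap k (leOfHom f)).toRingHom)
  map_id σ := by
    rw [← Spec.map_id]
    congr 1
    exact congrArg (fun g : coordRing k σ.1 →ₐ[k] coordRing k σ.1 => CommRingCat.ofHom g.toRingHom)
      (coordRingMap_refl k σ.1)
  map_comp {ρ τ σ} f g := by
    rw [← Spec.map_comp]
    congr 1
    exact congrArg (fun g : coordRing k σ.1 →ₐ[k] coordRing k ρ.1 => CommRingCat.ofHom g.toRingHom)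
      (coordRingMap_trans k (leOfHom f) (leOfHom g))

variable {Δ} in
lemma isFace_of_le {τ σ : Δ.Index} (h : τ ≤ σ) : IsFace τ.1 σ.1 := by
  have := Δ.inter_isFace σ.1 σ.2 τ.1 τ.2
  rwa [inf_eq_right.mpr (show τ.1 ≤ σ.1 from h)] at this

lemma inter_mem (σ τ : Δ.Index) : σ.1 ⊓ τ.1 ∈ Δ.cones :=
  Δ.face_mem σ.1 σ.2 _ (Δ.inter_isFace σ.1 σ.2 τ.1 τ.2)

/-- A fan has a smallest cone. -/
lemma exists_least : ∃ ρ : Δ.Index, ∀ σ, ρ ≤ σ := by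
  have : Finite Δ.Index := Δ.finite
  have : Nonempty Δ.Index := Δ.nonempty.to_subtype
  have : IsCodirectedOrder Δ.Index := ⟨fun σ τ => ⟨⟨σ.1 ⊓ τ.1, inter_mem Δ σ τ⟩,
    show σ.1 ⊓ τ.1 ≤ σ.1 from inf_le_left, show σ.1 ⊓ τ.1 ≤ τ.1 from inf_le_right⟩⟩
  obtain ⟨ρ, hρ⟩ := (Set.finite_univ (α := Δ.Index)).bddBelow
  exact ⟨ρ, fun σ => hρ (Set.mem_univ σ)⟩

variable [Module.Finite ℤ N]

variable {Δ} in
lemma exists_monomial {τ σ : Δ.Index} (f : τ ⟶ σ) : ∃ w : dualMonoid σ.1,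
    (∀ v, v ∈ τ.1 ↔ v ∈ σ.1 ∧ Module.Dual.baseChange ℝ w.1 v = 0) ∧
    IsOpenImmersion ((diagram k Δ).map f) ∧ Set.range ((diagram k Δ).map f) =
      (PrimeSpectrum.basicOpen (AddMonoidAlgebra.single w 1 : coordRing k σ.1) :
        Set (PrimeSpectrum (coordRing k σ.1))) := by
  obtain ⟨w, hw, hτ⟩ := (isFace_of_le (leOfHom f)).exists_int (Δ.isCone σ.1 σ.2)
  have h := isLocalization_coordRingMap k (Δ.isCone σ.1 σ.2) (leOfHom f) ⟨w, hw⟩ hτ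
  let := (coordRingMap k (leOfHom f)).toRingHom.toAlgebra
  refine ⟨⟨w, hw⟩, hτ, ?_, ?_⟩
  · exact IsOpenImmersion.of_isLocalization (S := coordRing k τ.1)
      (AddMonoidAlgebra.single (⟨w, hw⟩ : dualMonoid σ.1) 1 : coordRing k σ.1)
  · exact PrimeSpectrum.localization_away_comap_range (coordRing k τ.1)
      (AddMonoidAlgebra.single (⟨w, hw⟩ : dualMonoid σ.1) 1 : coordRing k σ.1)

instance {τ σ : Δ.Index} (f : τ ⟶ σ) : IsOpenImmersion ((diagram k Δ).map f) :=
  (exists_monomial k f).choose_spec.2.1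

instance : (diagram k Δ ⋙ Scheme.forget).IsLocallyDirected where
  cond {i j l} fi fj xi xj hx := by
    let ρ : Δ.Index := ⟨i.1 ⊓ j.1, inter_mem Δ i j⟩
    let gi : ρ ⟶ i := homOfLE (show i.1 ⊓ j.1 ≤ i.1 from inf_le_left)
    let gj : ρ ⟶ j := homOfLE (show i.1 ⊓ j.1 ≤ j.1 from inf_le_right)
    have hx' : (diagram k Δ).map fi xi = (diagram k Δ).map fj xj := hx
    obtain ⟨wi, hwi, -, hri⟩ := exists_monomial k fi
    obtain ⟨wj, hwj, -, hrj⟩ := exists_monomial k fj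
    let y : (diagram k Δ).obj l := (diagram k Δ).map fi xi
    have hyi : y ∈ Set.range ((diagram k Δ).map fi) := ⟨xi, rfl⟩
    have hyj : y ∈ Set.range ((diagram k Δ).map fj) := ⟨xj, hx'.symm⟩
    have hρ : ∀ v, v ∈ ρ.1 ↔ v ∈ l.1 ∧ Module.Dual.baseChange ℝ (wi + wj).1 v = 0 := fun v => by
      change v ∈ i.1 ∧ v ∈ j.1 ↔ _
      rw [hwi, hwj, AddSubmonoid.coe_add, map_add, LinearMap.add_apply]
      constructor
      · rintro ⟨⟨h1, h2⟩, -, h3⟩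
        exact ⟨h1, by rw [h2, h3, add_zero]⟩
      · rintro ⟨h1, h2⟩
        have := (add_eq_zero_iff_of_nonneg (wi.2 v h1) (wj.2 v h1)).1 h2
        exact ⟨⟨h1, this.1⟩, h1, this.2⟩
    have hrρ : Set.range ((diagram k Δ).map (gi ≫ fi)) =
        (PrimeSpectrum.basicOpen (AddMonoidAlgebra.single (wi + wj) 1 : coordRing k l.1) :
          Set (PrimeSpectrum (coordRing k l.1))) := by
      have h := isLocalization_coordRingMap k (Δ.isCone l.1 l.2) (leOfHom (gi ≫ fi)) (wi + wj) hρ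
      let := (coordRingMap k (leOfHom (gi ≫ fi))).toRingHom.toAlgebra
      exact PrimeSpectrum.localization_away_comap_range (coordRing k ρ.1)
        (AddMonoidAlgebra.single (wi + wj) 1 : coordRing k l.1)
    have hyρ : y ∈ Set.range ((diagram k Δ).map (gi ≫ fi)) := by
      have h1 : (AddMonoidAlgebra.single (wi + wj) 1 : coordRing k l.1) =
          AddMonoidAlgebra.single wi 1 * AddMonoidAlgebra.single wj 1 := by
        rw [AddMonoidAlgebra.single_mul_single, mul_one]
      rw [hrρ, h1, PrimeSpectrum.basicOpen_mul]
      rw [hri] at hyi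
      rw [hrj] at hyj
      exact ⟨hyi, hyj⟩
    obtain ⟨z, hz⟩ := hyρ
    refine ⟨ρ, gi, gj, z, ?_, ?_⟩
    · apply ((diagram k Δ).map fi).isOpenEmbedding.injective
      change ((diagram k Δ).map fi) ((diagram k Δ).map gi z) = _
      rw [← Scheme.Hom.comp_apply, ← Functor.map_comp]
      exact hz
    · apply ((diagram k Δ).map fj).isOpenEmbedding.injective
      change ((diagram k Δ).map fj) ((diagram k Δ).map gj z) = _
      rw [← Scheme.Hom.comp_apply, ← Functor.map_comp, ← hx',
        show gj ≫ fj = gi ≫ fi from Subsingleton.elim _ _]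
      exact hz

/-- The toric variety `X_Δ`, glued from the affine toric varieties `U_σ`. -/
noncomputable def toricVariety : Scheme.{u} := colimit (diagram k Δ)

/-- The inclusion of the open affine subset `U_σ` in `X_Δ`. -/
noncomputable def chart (σ : Δ.Index) :
    Spec (CommRingCat.of (coordRing k σ.1)) ⟶ toricVariety k Δ :=
  colimit.ι (diagram k Δ) σ

/-- The structure morphism of `X_Δ` over the base field. -/
noncomputable def structureMap : toricVariety k Δ ⟶ Spec (CommRingCat.of k) :=
  colimit.desc (diagram k Δ)
    { pt := Spec (CommRingCat.of k)
      ι :=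
        { app σ := Spec.map (CommRingCat.ofHom (algebraMap k (coordRing k σ.1)))
          naturality τ σ f := by
            dsimp [diagram]
            rw [← Spec.map_comp, Category.comp_id]
            congr 1
            exact CommRingCat.hom_ext (coordRingMap k (leOfHom f)).comp_algebraMap } }

instance (σ : Δ.Index) : IsOpenImmersion (chart k Δ σ) :=
  inferInstanceAs (IsOpenImmersion (colimit.ι (diagram k Δ) σ))

lemma chart_jointly_surjective (x : toricVariety k Δ) : ∃ (σ : Δ.Index) (y : _), chart k Δ σ y = x :=
  Scheme.IsLocallyDirected.ι_jointly_surjective (diagram k Δ) x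

variable [Module.Free ℤ N]

instance (σ : Δ.Index) : AddMonoid.FG (dualMonoid σ.1) := dualMonoid_fg (Δ.isCone σ.1 σ.2)

instance (σ : Δ.Index) : IsDomain (coordRing k σ.1) := by
  let b := Module.Free.chooseBasis ℤ (Module.Dual ℤ N)
  have : TwoUniqueSums (dualMonoid σ.1) :=
    .of_injective_addHom
      ((b.repr.toLinearMap.toAddMonoidHom.comp (dualMonoid σ.1).subtype).toAddHom)
      (b.repr.injective.comp Subtype.val_injective) inferInstance
  infer_instance

instance (σ : Δ.Index) : IsNoetherianRing (coordRing k σ.1) :=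
  Algebra.FiniteType.isNoetherianRing k _

instance : IsLocallyNoetherian (toricVariety k Δ) := by
  have h (σ : Δ.Index) : IsLocallyNoetherian (Spec (CommRingCat.of (coordRing k σ.1))) := by
    have : IsNoetherianRing (CommRingCat.of (coordRing k σ.1)) :=
      inferInstanceAs (IsNoetherianRing (coordRing k σ.1))
    infer_instance
  change IsLocallyNoetherian (colimit (diagram k Δ))
  rw [isLocallyNoetherian_iff_openCover (Scheme.IsLocallyDirected.openCover (diagram k Δ))]
  exact h

instance : IsIntegral (toricVariety k Δ) := by
  obtain ⟨ρ, hρ⟩ := exists_least Δ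
  have hdom : ∀ σ : Δ.Index, IsIntegral ((diagram k Δ).obj σ) := fun σ => by
    change IsIntegral (Spec (CommRingCat.of (coordRing k σ.1)))
    infer_instance
  let η : toricVariety k Δ := chart k Δ ρ (genericPoint ((diagram k Δ).obj ρ))
  have hη : ∀ x, η ⤳ x := fun x => by
    obtain ⟨σ, y, rfl⟩ := chart_jointly_surjective k Δ x
    have h1 : η = chart k Δ σ (genericPoint ((diagram k Δ).obj σ)) := by
      rw [← genericPoint_eq_of_isOpenImmersion ((diagram k Δ).map (homOfLE (hρ σ)))]
      change colimit.ι (diagram k Δ) ρ _ = colimit.ι (diagram k Δ) σ _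
      rw [← Scheme.Hom.comp_apply, colimit.w]
    rw [h1]
    exact (genericPoint_specializes (α := (diagram k Δ).obj σ) y).map (chart k Δ σ).continuous
  have : IrreducibleSpace (toricVariety k Δ) := by
    have h2 : closure {η} = (Set.univ : Set (toricVariety k Δ)) :=
      Set.eq_univ_of_forall fun x => (hη x).mem_closure
    have h3 : IsIrreducible (Set.univ : Set (toricVariety k Δ)) :=
      h2 ▸ isIrreducible_singleton.closure
    have : PreirreducibleSpace (toricVariety k Δ) := ⟨h3.2⟩
    exact { toNonempty := ⟨η⟩ }
  have : IsReduced (toricVariety k Δ) := by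
    change IsReduced (colimit (diagram k Δ))
    rw [IsReduced.iff_of_openCover _ (Scheme.IsLocallyDirected.openCover (diagram k Δ))]
    intro σ
    have := hdom σ
    change IsReduced ((diagram k Δ).obj σ)
    infer_instance
  exact isIntegral_of_irreducibleSpace_of_isReduced _
end ToricFan

/-! ### Weil and Cartier divisors -/

namespace SchemeDivisor

/-- The codimension one points of `X`, i.e. the generic points of its prime divisors. -/
abbrev PrimeDivisor (X : Scheme.{u}) : Type u := {x : X // Order.coheight x = 1}

/-- The group of Weil divisors of a (quasi-compact) scheme. -/
abbrev WeilDivisor (X : Scheme.{u}) : Type u := PrimeDivisor X →₀ ℤ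

variable (X : Scheme.{u}) [IsIntegral X]

/-- `K^× / 𝒪_x^×`, the stalk at `x` of the sheaf `𝒦^× / 𝒪^×`. -/
abbrev LocalEquation (x : X) : Type u :=
  X.functionFieldˣ ⧸
    (Units.map (algebraMap (X.presheaf.stalk x) X.functionField).toMonoidHom).range

/-- The class of a nonzero rational function in `K^× / 𝒪_x^×`. -/
noncomputable def LocalEquation.mk {X : Scheme.{u}} [IsIntegral X] (x : X) (f : X.functionFieldˣ) :
    LocalEquation X x := QuotientGroup.mk f

/-- Cartier divisors: the global sections of `𝒦^× / 𝒪^×`, i.e. the families of elements of the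
stalks that are locally given by one nonzero rational function. -/
noncomputable def CartierDivisor : AddSubgroup (∀ x : X, Additive (LocalEquation X x)) where
  carrier := {c | ∀ x : X, ∃ U : X.Opens, x ∈ U ∧ ∃ f : X.functionFieldˣ,
    ∀ y ∈ U, c y = Additive.ofMul (LocalEquation.mk y f)}
  zero_mem' x := ⟨⊤, trivial, 1, fun _ _ => rfl⟩
  add_mem' {c d} hc hd x := by
    obtain ⟨U, hU, f, hf⟩ := hc x
    obtain ⟨V, hV, g, hg⟩ := hd x
    exact ⟨U ⊓ V, ⟨hU, hV⟩, f * g, fun y hy => by rw [Pi.add_apply, hf y hy.1, hg y hy.2]; rfl⟩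
  neg_mem' {c} hc x := by
    obtain ⟨U, hU, f, hf⟩ := hc x
    exact ⟨U, hU, f⁻¹, fun y hy => by rw [Pi.neg_apply, hf y hy]; rfl⟩

/-- The order of vanishing along a prime divisor, on `K^× / 𝒪_x^×`. -/
noncomputable def localOrd [IsLocallyNoetherian X] (P : PrimeDivisor X) :
    LocalEquation X P.1 →* Multiplicative ℤ :=
  QuotientGroup.lift _
    (WithZero.unitsWithZeroEquiv.toMonoidHom.comp (Units.map (X.ordHom P.1 P.2).toMonoidHom)) <| by
    rintro _ ⟨a, rfl⟩
    have : Ring.KrullDimLE 1 (X.presheaf.stalk P.1) := krullDimLE_of_coheight_le P.2.le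
    have h : Units.map (X.ordHom P.1 P.2).toMonoidHom
        (Units.map (algebraMap (X.presheaf.stalk P.1) X.functionField).toMonoidHom a) = 1 :=
      Units.ext (Ring.ordFrac_of_isUnit a.isUnit)
    exact (congrArg WithZero.unitsWithZeroEquiv h).trans (map_one _)

/-- The homomorphism that sends a Cartier divisor to (the multiplicities of) its Weil divisor. -/
noncomputable def toWeil [IsLocallyNoetherian X] :
    CartierDivisor X →+ (PrimeDivisor X → ℤ) where
  toFun c P := (localOrd X P (c.1 P.1).toMul).toAdd
  map_zero' := by
    ext P
    exact congrArg Multiplicative.toAdd (map_one (localOrd X P))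
  map_add' c d := by
    ext P
    exact congrArg Multiplicative.toAdd
      (map_mul (localOrd X P) (c.1 P.1).toMul (d.1 P.1).toMul)

variable {X}

/-- A Weil divisor is Cartier if it is the Weil divisor of a Cartier divisor. -/
def IsCartier [IsLocallyNoetherian X] (D : WeilDivisor X) : Prop :=
  ∃ c : CartierDivisor X, toWeil X c = D

/-- A Weil divisor is `ℚ`-Cartier if some positive multiple of it is Cartier. -/
def IsQCartier [IsLocallyNoetherian X] (D : WeilDivisor X) : Prop :=
  ∃ n : ℕ, 0 < n ∧ IsCartier (n • D)

/-- The local equation of a Cartier divisor at `x` is `p / q`, where `p` and `q` are nonzero elements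
of the local ring at `x`. -/
def IsLocalFraction (c : CartierDivisor X) (x : X) (p q : X.presheaf.stalk x) : Prop :=
  ∃ f : X.functionFieldˣ, c.1 x = Additive.ofMul (LocalEquation.mk x f) ∧ q ≠ 0 ∧
    (f : X.functionField) * algebraMap _ X.functionField q = algebraMap _ X.functionField p

/-- `f^* c = g^* c`, for dominant morphisms `f g : Y ⟶ X` of integral schemes: at each point of `Y`
the pullbacks `f^*(p / q)` and `g^*(r / s)` of local equations of `c` differ by a unit of the local
ring. -/
def SamePullback {Y : Scheme.{u}} (f g : Y ⟶ X) (c : CartierDivisor X) : Prop :=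
  ∀ z : Y, ∃ p q r s, IsLocalFraction c (f z) p q ∧ IsLocalFraction c (g z) r s ∧
    Associated ((f.stalkMap z).hom p * (g.stalkMap z).hom s)
      ((f.stalkMap z).hom q * (g.stalkMap z).hom r)

lemma IsLocalFraction.add {c d : CartierDivisor X} {x : X} {p q p' q' : X.presheaf.stalk x}
    (h : IsLocalFraction c x p q) (h' : IsLocalFraction d x p' q') :
    IsLocalFraction (c + d) x (p * p') (q * q') := by
  obtain ⟨f, hf, hq, hfq⟩ := h
  obtain ⟨f', hf', hq', hfq'⟩ := h'
  refine ⟨f * f', ?_, mul_ne_zero hq hq', ?_⟩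
  · change c.1 x + d.1 x = _
    rw [hf, hf']
    rfl
  · rw [map_mul, map_mul, ← hfq, ← hfq', Units.val_mul]
    ring

lemma IsLocalFraction.neg {c : CartierDivisor X} {x : X} {p q : X.presheaf.stalk x}
    (h : IsLocalFraction c x p q) : IsLocalFraction (-c) x q p := by
  obtain ⟨f, hf, hq, hfq⟩ := h
  have hinj := IsFractionRing.injective (X.presheaf.stalk x) X.functionField
  refine ⟨f⁻¹, ?_, ?_, ?_⟩
  · change -(c.1 x) = _
    rw [hf]
    rfl
  · rintro rfl
    rw [map_zero] at hfq
    rcases mul_eq_zero.1 hfq with h | h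
    · exact f.ne_zero h
    · exact hq (hinj (h.trans (map_zero _).symm))
  · rw [← hfq, ← mul_assoc, Units.inv_mul, one_mul]

lemma SamePullback.zero {Y : Scheme.{u}} (f g : Y ⟶ X) : SamePullback f g (0 : CartierDivisor X) :=
  fun z => ⟨1, 1, 1, 1, ⟨1, rfl, one_ne_zero, by simp⟩, ⟨1, rfl, one_ne_zero, by simp⟩, by simp⟩

lemma SamePullback.add {Y : Scheme.{u}} {f g : Y ⟶ X} {c d : CartierDivisor X}
    (hc : SamePullback f g c) (hd : SamePullback f g d) : SamePullback f g (c + d) := fun z => by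
  obtain ⟨p, q, r, s, h1, h2, h3⟩ := hc z
  obtain ⟨p', q', r', s', h1', h2', h3'⟩ := hd z
  refine ⟨p * p', q * q', r * r', s * s', h1.add h1', h2.add h2', ?_⟩
  rw [map_mul, map_mul, map_mul, map_mul, mul_mul_mul_comm, mul_mul_mul_comm _ _ ((g.stalkMap z).hom r)]
  exact h3.mul_mul h3'

lemma SamePullback.neg {Y : Scheme.{u}} {f g : Y ⟶ X} {c : CartierDivisor X}
    (hc : SamePullback f g c) : SamePullback f g (-c) := fun z => by
  obtain ⟨p, q, r, s, h1, h2, h3⟩ := hc z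
  exact ⟨q, p, s, r, h1.neg, h2.neg, h3.symm⟩

end SchemeDivisor

/-! ### The torus action and torus-invariant divisors -/

namespace ToricFan

open SchemeDivisor

variable (k : Type u) [Field k] {N : Type u} [AddCommGroup N]

/-- The coordinate ring `k[M]` of the torus `T`. -/
abbrev torusRing (k : Type u) [Field k] (N : Type u) [AddCommGroup N] : Type u :=
  AddMonoidAlgebra k (Module.Dual ℤ N)

/-- The coaction `k[S_σ] → k[M] ⊗ k[S_σ]`, `t^s ↦ t^s ⊗ t^s`, of the torus on `U_σ`. -/
noncomputable def coaction (σ : PointedCone ℝ (RealSpace N)) :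
    coordRing k σ →ₐ[k] torusRing k N ⊗[k] coordRing k σ :=
  AddMonoidAlgebra.lift k (torusRing k N ⊗[k] coordRing k σ) (dualMonoid σ)
    { toFun := fun s => AddMonoidAlgebra.single (s.toAdd : Module.Dual ℤ N) 1 ⊗ₜ
        AddMonoidAlgebra.single s.toAdd 1
      map_one' := rfl
      map_mul' := fun a b => by
        rw [Algebra.TensorProduct.tmul_mul_tmul, AddMonoidAlgebra.single_mul_single,
          AddMonoidAlgebra.single_mul_single, mul_one]
        rfl }

variable [Module.Finite ℤ N] (Δ : ToricFan N)

/-- `T × U_σ`. -/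
noncomputable abbrev torusProd (σ : Δ.Index) : Scheme.{u} :=
  Spec (CommRingCat.of (torusRing k N ⊗[k] coordRing k σ.1))

/-- The action of the torus, `T × U_σ → U_σ ⊆ X_Δ`. -/
noncomputable def act (σ : Δ.Index) : torusProd k Δ σ ⟶ toricVariety k Δ :=
  Spec.map (CommRingCat.ofHom (coaction k σ.1).toRingHom) ≫ chart k Δ σ

/-- The projection `T × U_σ → U_σ ⊆ X_Δ`. -/
noncomputable def proj (σ : Δ.Index) : torusProd k Δ σ ⟶ toricVariety k Δ :=
  Spec.map (CommRingCat.ofHom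
    (Algebra.TensorProduct.includeRight : coordRing k σ.1 →ₐ[k] _).toRingHom) ≫ chart k Δ σ

/-- The prime divisors `D_i` of `X_Δ` that are stable under the action of the torus. -/
def InvariantPrimeDivisor : Type u :=
  {P : PrimeDivisor (toricVariety k Δ) //
    ∀ σ, act k Δ σ ⁻¹' closure {P.1} = proj k Δ σ ⁻¹' closure {P.1}}

variable [Module.Free ℤ N]

/-- The group `Div_T X` of torus-invariant Cartier divisors of `X_Δ`: those whose pullbacks under
the action `T × X → X` and under the projection `T × X → X` agree. -/
def invariantCartier : AddSubgroup (CartierDivisor (toricVariety k Δ)) where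
  carrier := {c | ∀ σ, SamePullback (act k Δ σ) (proj k Δ σ) c}
  zero_mem' _ := .zero _ _
  add_mem' hc hd σ := (hc σ).add (hd σ)
  neg_mem' hc σ := (hc σ).neg

/-- The inclusion of `⨁ ℤ D_i` in the Weil divisors, regarded as functions (the multiplicities) on
all prime divisors. -/
noncomputable def invariantWeil :
    (InvariantPrimeDivisor k Δ →₀ ℤ) →+ (PrimeDivisor (toricVariety k Δ) → ℤ) :=
  Finsupp.coeFnAddHom.comp
    (Finsupp.mapDomain.addMonoidHom (fun P : InvariantPrimeDivisor k Δ => P.1))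

/-- The cokernel `G` of `Div_T X → ⨁ ℤ D_i`: the quotient of `⨁ ℤ D_i` by the subgroup of the Weil
divisors of torus-invariant Cartier divisors. -/
abbrev divisorCokernel : Type u :=
  (InvariantPrimeDivisor k Δ →₀ ℤ) ⧸
    ((invariantCartier k Δ).map (toWeil (toricVariety k Δ))).comap (invariantWeil k Δ)

/-- `X_Δ` is simplicial if every cone of `Δ` is generated by linearly independent vectors. -/
def IsSimplicial {N : Type u} [AddCommGroup N] (Δ : ToricFan N) : Prop :=
  ∀ σ ∈ Δ.cones, PointedCone.IsSimplicial σ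

end ToricFan

/-! All the conditions reduce to one statement about characters. Call a prime divisor of X that
misses the open torus a boundary divisor; these are exactly the torus-stable prime divisors, and
there are finitely many. `IsLocallyCharacter Δ P n` says that on each chart U_σ some character χ^m
has order n along P and order 0 along the other boundary divisors meeting U_σ. Then G is finite, Δ
is simplicial, and every Weil divisor is ℚ-Cartier, each if and only if some n > 0 works for all P;
and G is trivial, X is smooth, and every Weil divisor is Cartier, each if and only if n = 1 works
for all P.

Divisors. The central fact is `exists_charOrd_eq_toWeil`: a Cartier divisor that is trivial on the
torus, invariant or not, agrees on U_σ with the divisor of a character. Take a local equation at the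
generic point of the closed orbit and write it as a reduced fraction a/b of Laurent polynomials. No
irreducible factor of a or b can vanish on the closed orbit, so a and b divide functions that are
nonzero there, and such divisors have the boundary orders of a monomial. Conversely, characters with
matching boundary orders glue to an invariant Cartier divisor (`exists_cartier_of_characters`). This
handles G. It also handles all Weil divisors, because k[M] is factorial, so every Weil divisor
becomes a boundary divisor after subtracting a principal one.

Cones. Orders of characters replace primitive ray generators: `mem_dualMonoid_iff` describes S_σ as
the m with nonnegative order along all boundary divisors of U_σ. The characters of
`IsLocallyCharacter` form a system dual, up to the factor n, to the lattice vectors representing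
these orders, so σ is generated by independent vectors (`isSimplicial_of_dual`). For a simplicial
cone, conversely, each boundary divisor belongs to one generator, and the form that vanishes on the
other generators is the required character.

Smoothness. It means that every k[S_σ] is smooth, and this holds if and only if S_σ is given by the
nonnegativity of some coordinates in a basis of M. In one direction k[S_σ] is then a localized
polynomial ring. In the other, the rank of the Kähler differentials is compared at two k-points
(`isUnimodular_of_smooth`): at the identity of the torus it is at most rank M, and on the closed
orbit it is at least the rank of the unit group plus the number of minimal generators modulo units.
Bases of this kind correspond to the case n = 1. -/

/-! ### Local rings and the function field seen from an affine chart -/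

namespace AffineChart

/-- The localization map from `R` to the local ring of `Spec R` at `y`. -/
noncomputable def specGerm (R : CommRingCat.{u}) (y : Spec R) : R ⟶ (Spec R).presheaf.stalk y :=
  StructureSheaf.toStalk R y

lemma specGerm_isLocalization (R : CommRingCat.{u}) (y : PrimeSpectrum R) :
    letI := (specGerm R y).hom.toAlgebra
    IsLocalization.AtPrime ((Spec R).presheaf.stalk y) y.asIdeal :=
  StructureSheaf.IsLocalization.to_stalk R y

variable {X : Scheme.{u}} {R : CommRingCat.{u}} (j : Spec R ⟶ X) [IsOpenImmersion j]

/-- A ring element as a section over the image of an affine chart. -/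
noncomputable def sec : R ⟶ Γ(X, j ''ᵁ ⊤) :=
  (Scheme.ΓSpecIso R).inv ≫ (j.appIso ⊤).inv

lemma mem_image (y : Spec R) : j y ∈ j ''ᵁ ⊤ := ⟨y, trivial, rfl⟩

lemma mem_image_iff {x : X} : x ∈ j ''ᵁ ⊤ ↔ ∃ y, j y = x :=
  ⟨fun ⟨y, _, h⟩ => ⟨y, h⟩, fun ⟨y, h⟩ => ⟨y, trivial, h⟩⟩

/-- The germ of a ring element at a point of an affine chart. -/
noncomputable def germ (x : X) (hx : x ∈ j ''ᵁ ⊤) : R ⟶ X.presheaf.stalk x :=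
  sec j ≫ X.presheaf.germ _ x hx

lemma toStalk_eq (R : CommRingCat.{u}) (y : Spec R) (U : (Spec R).Opens) (i : U ⟶ ⊤) (hy : y ∈ U) :
    (Scheme.ΓSpecIso R).inv ≫ (Spec R).presheaf.map i.op ≫ (Spec R).presheaf.germ U y hy =
      specGerm R y := by
  rw [(Spec R).presheaf.germ_res i]
  rfl

lemma germ_stalkMap (y : Spec R) :
    germ j (j y) (mem_image j y) ≫ j.stalkMap y = specGerm R y := by
  rw [germ, sec, Category.assoc, Category.assoc, Scheme.Hom.germ_stalkMap,
    Scheme.Hom.appIso_inv_app_assoc]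
  exact toStalk_eq R y _ _ _

/-- The torus action, the projection and the inclusion of a smaller chart all have the form
`Spec.map θ ≫ j`; this computes their stalk maps on functions of the chart. -/
lemma germ_stalkMap_comp {B : CommRingCat.{u}} (θ : R ⟶ B) (f : Spec B ⟶ X)
    (hf : f = Spec.map θ ≫ j) (z : Spec B) (hz : f z ∈ j ''ᵁ ⊤) :
    germ j (f z) hz ≫ f.stalkMap z = θ ≫ specGerm B z := by
  subst hf
  have h1 := congrArg (· ≫ (Spec.map θ).stalkMap z) (germ_stalkMap j (Spec.map θ z))
  dsimp only at h1
  rw [Category.assoc] at h1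
  refine (congrArg (germ j ((Spec.map θ ≫ j) z) hz ≫ ·)
    (Scheme.Hom.stalkMap_comp (Spec.map θ) j z)).trans (h1.trans ?_)
  exact stalkMap_toStalk θ z

variable {j}

lemma isUnit_specGerm_iff (y : Spec R) (r : R) : IsUnit (specGerm R y r) ↔ r ∉ y.asIdeal :=
  let := (specGerm R y).hom.toAlgebra
  have := specGerm_isLocalization R y
  have : PrimeSpectrum.asIdeal y |>.IsPrime := PrimeSpectrum.isPrime y
  IsLocalization.AtPrime.isUnit_to_map_iff ((Spec R).presheaf.stalk y) (PrimeSpectrum.asIdeal y) r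

lemma exists_specGerm_mul_eq (y : Spec R) (z : (Spec R).presheaf.stalk y) :
    ∃ a s : R, s ∉ y.asIdeal ∧ z * specGerm R y s = specGerm R y a := by
  let := (specGerm R y).hom.toAlgebra
  have : PrimeSpectrum.asIdeal y |>.IsPrime := PrimeSpectrum.isPrime y
  have := specGerm_isLocalization R y
  obtain ⟨⟨a, s⟩, h⟩ := IsLocalization.surj (S := (Spec R).presheaf.stalk y)
    (Ideal.primeCompl (PrimeSpectrum.asIdeal y)) z
  exact ⟨a, s, s.2, h⟩

lemma specGerm_injective [IsDomain R] (y : Spec R) : Function.Injective (specGerm R y) := by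
  let := (specGerm R y).hom.toAlgebra
  have : PrimeSpectrum.asIdeal y |>.IsPrime := PrimeSpectrum.isPrime y
  have := specGerm_isLocalization R y
  exact IsLocalization.injective ((Spec R).presheaf.stalk y)
    (Ideal.primeCompl_le_nonZeroDivisors (PrimeSpectrum.asIdeal y))

variable (j) in
lemma stalkMap_germ (y : Spec R) (r : R) :
    (j.stalkMap y).hom (germ j (j y) (mem_image j y) r) = specGerm R y r :=
  congr($(germ_stalkMap j y) r)

lemma isUnit_germ_iff {x : X} {y : Spec R} (h : j y = x) (hx : x ∈ j ''ᵁ ⊤) (r : R) :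
    IsUnit (germ j x hx r) ↔ r ∉ y.asIdeal := by
  subst h
  rw [← isUnit_specGerm_iff, ← stalkMap_germ j y]
  exact (isUnit_map_iff (j.stalkMap y).hom _).symm

lemma stalkMap_bijective (y : Spec R) : Function.Bijective (j.stalkMap y).hom :=
  ConcreteCategory.bijective_of_isIso (j.stalkMap y)

lemma exists_germ_mul_eq {x : X} {y : Spec R} (h : j y = x) (hx : x ∈ j ''ᵁ ⊤)
    (z : X.presheaf.stalk x) :
    ∃ a s : R, s ∉ y.asIdeal ∧ z * germ j x hx s = germ j x hx a := by
  subst h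
  obtain ⟨a, s, hs, h⟩ := exists_specGerm_mul_eq y ((j.stalkMap y).hom z)
  refine ⟨a, s, hs, (stalkMap_bijective y).1 ?_⟩
  rw [map_mul]
  exact (congrArg (_ * ·) (stalkMap_germ j y s)).trans (h.trans (stalkMap_germ j y a).symm)

lemma genericPoint_mem [IrreducibleSpace X] [Nonempty (Spec R)] : genericPoint X ∈ j ''ᵁ ⊤ := by
  obtain ⟨y⟩ := ‹Nonempty (Spec R)›
  exact ((genericPoint_spec X).specializes trivial).mem_open (j ''ᵁ ⊤).isOpen (mem_image j y)

variable [IsIntegral X] [Nonempty (Spec R)]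

variable (j) in
/-- The homomorphism from the coordinate ring of an affine chart to the function field. -/
noncomputable def toK : R →+* X.functionField := (germ j (genericPoint X) genericPoint_mem).hom

lemma toK_eq (x : X) (hx : x ∈ j ''ᵁ ⊤) (r : R) :
    toK j r = algebraMap (X.presheaf.stalk x) X.functionField (germ j x hx r) := by
  have : germ j x hx ≫ X.presheaf.stalkSpecializes ((genericPoint_spec X).specializes trivial) =
      germ j (genericPoint X) genericPoint_mem := by
    rw [germ, germ, Category.assoc, TopCat.Presheaf.germ_stalkSpecializes]
  exact congr($(this.symm) r)

lemma toK_injective [IsDomain R] : Function.Injective (toK j) := by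
  obtain ⟨y⟩ := ‹Nonempty (Spec R)›
  have hy := mem_image j y
  rw [injective_iff_map_eq_zero]
  intro r hr
  rw [toK_eq _ hy] at hr
  have h1 := IsFractionRing.injective (X.presheaf.stalk (j y)) X.functionField
    (hr.trans (map_zero _).symm)
  refine specGerm_injective y (((stalkMap_germ j y r).symm.trans (congrArg _ h1)).trans ?_)
  rw [map_zero, map_zero]

/-- The function field is the stalk at the generic point, which lies in every nonempty chart, so its
elements are fractions of functions on the chart. -/
lemma exists_toK_mul_eq (f : X.functionField) : ∃ a s : R, s ≠ 0 ∧ f * toK j s = toK j a := by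
  obtain ⟨y, hy⟩ := (mem_image_iff j).1 (genericPoint_mem (j := j))
  obtain ⟨a, s, hs, h⟩ := exists_germ_mul_eq hy genericPoint_mem f
  exact ⟨a, s, fun h0 => hs (h0 ▸ y.asIdeal.zero_mem), h⟩

lemma toK_comp {B : CommRingCat.{u}} [Nonempty (Spec B)] (θ : R ⟶ B) (j' : Spec B ⟶ X)
    [IsOpenImmersion j'] (h : j' = Spec.map θ ≫ j) (r : R) : toK j' (θ r) = toK j r := by
  obtain ⟨z⟩ := ‹Nonempty (Spec B)›
  have hz : j' z ∈ j ''ᵁ ⊤ := by rw [h]; exact mem_image j (Spec.map θ z)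
  rw [toK_eq (j' z) (mem_image j' z), toK_eq (j' z) hz]
  congr 1
  apply (stalkMap_bijective (j := j') z).1
  exact (congr($(germ_stalkMap j' z) (θ r))).trans
    (congr($(germ_stalkMap_comp j θ j' h z hz) r)).symm

end AffineChart

/-! ### Orders of vanishing along prime divisors -/

namespace SchemeDivisor

open AffineChart

section order

variable {X : Scheme.{u}} [IsIntegral X] [IsLocallyNoetherian X]

/-- The order of vanishing of a nonzero rational function along a prime divisor. -/
noncomputable def ordZ (P : PrimeDivisor X) (f : X.functionFieldˣ) : ℤ :=
  (localOrd X P (LocalEquation.mk P.1 f)).toAdd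

lemma ordZ_mul (P : PrimeDivisor X) (f g : X.functionFieldˣ) :
    ordZ P (f * g) = ordZ P f + ordZ P g :=
  congrArg Multiplicative.toAdd
    (map_mul (localOrd X P) (LocalEquation.mk P.1 f) (LocalEquation.mk P.1 g))

lemma ordZ_one (P : PrimeDivisor X) : ordZ P (1 : X.functionFieldˣ) = 0 :=
  congrArg Multiplicative.toAdd (map_one (localOrd X P))

lemma toWeil_eq_ordZ {c : CartierDivisor X} {P : PrimeDivisor X} {f : X.functionFieldˣ}
    (h : c.1 P.1 = Additive.ofMul (LocalEquation.mk P.1 f)) : toWeil X c P = ordZ P f := by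
  change (localOrd X P (c.1 P.1).toMul).toAdd = _
  rw [h]
  rfl

lemma ofAdd_ordZ (P : PrimeDivisor X) (f : X.functionFieldˣ) :
    ((Multiplicative.ofAdd (ordZ P f) : Multiplicative ℤ) : WithZero (Multiplicative ℤ)) =
      X.ordHom P.1 P.2 (f : X.functionField) := by
  change ((WithZero.unitsWithZeroEquiv (Units.map (X.ordHom P.1 P.2).toMonoidHom f) :
    Multiplicative ℤ) : WithZero (Multiplicative ℤ)) = _
  simp

/-- The order is the length of the quotient by the equation, so the local ring need not be known to
be a discrete valuation ring. Only orders 0, positive and 1 are computed directly below. -/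
lemma ordZ_eq_length (P : PrimeDivisor X) (f : X.functionFieldˣ) (s : X.presheaf.stalk P.1)
    (h : (f : X.functionField) = algebraMap _ _ s) (n : ℕ)
    (hn : Ring.ord (X.presheaf.stalk P.1) s = n) : ordZ P f = n := by
  have : Ring.KrullDimLE 1 (X.presheaf.stalk P.1) := krullDimLE_of_coheight_le P.2.le
  have hs : s ≠ 0 := by
    rintro rfl
    exact f.ne_zero (h.trans (map_zero _))
  have h1 := ofAdd_ordZ P f
  rw [h, Scheme.ordHom, Ring.ordFrac_eq_ord _ hs, Ring.ordMonoidWithZeroHom_eq_coe _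
    (mem_nonZeroDivisors_iff_ne_zero.2 hs) hn] at h1
  exact Multiplicative.ofAdd.injective (WithZero.coe_injective h1)

lemma exists_ord_eq (P : PrimeDivisor X) {s : X.presheaf.stalk P.1} (hs : s ≠ 0) :
    ∃ n : ℕ, Ring.ord (X.presheaf.stalk P.1) s = n := by
  have : Ring.KrullDimLE 1 (X.presheaf.stalk P.1) := krullDimLE_of_coheight_le P.2.le
  obtain ⟨n, hn⟩ := ENat.ne_top_iff_exists.mp
    (Ring.ord_ne_top (mem_nonZeroDivisors_iff_ne_zero.2 hs))
  exact ⟨n, hn.symm⟩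

lemma ordZ_eq_zero_of_isUnit (P : PrimeDivisor X) (f : X.functionFieldˣ) {s : X.presheaf.stalk P.1}
    (h : (f : X.functionField) = algebraMap _ _ s) (hs : IsUnit s) : ordZ P f = 0 :=
  ordZ_eq_length P f s h 0 (Ring.ord_of_isUnit hs)

lemma ordZ_pos_of_not_isUnit (P : PrimeDivisor X) (f : X.functionFieldˣ)
    {s : X.presheaf.stalk P.1} (h : (f : X.functionField) = algebraMap _ _ s) (hs : ¬ IsUnit s) :
    0 < ordZ P f := by
  have hs0 : s ≠ 0 := by
    rintro rfl
    exact f.ne_zero (h.trans (map_zero _))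
  obtain ⟨n, hn⟩ := exists_ord_eq P hs0
  rw [ordZ_eq_length P f s h n hn, Nat.cast_pos, Nat.pos_iff_ne_zero]
  rintro rfl
  rw [Nat.cast_zero, Ring.ord, Module.length_eq_zero_iff, Ideal.Quotient.subsingleton_iff,
    Ideal.span_singleton_eq_top] at hn
  exact hs hn

/-- Such an `s` generates the maximal ideal, so the quotient is the residue field, of length one. -/
lemma ordZ_eq_one (P : PrimeDivisor X) (f : X.functionFieldˣ) {s : X.presheaf.stalk P.1}
    (h : (f : X.functionField) = algebraMap _ _ s) (hs : ¬ IsUnit s)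
    (hspan : ∀ t : X.presheaf.stalk P.1, ¬ IsUnit t → s ∣ t) : ordZ P f = 1 := by
  refine ordZ_eq_length P f s h 1 ?_
  have hmax : (Ideal.span {s}).IsMaximal := by
    convert! IsLocalRing.maximalIdeal.isMaximal (X.presheaf.stalk P.1)
    ext t
    rw [Ideal.mem_span_singleton, IsLocalRing.mem_maximalIdeal, mem_nonunits_iff]
    exact ⟨fun hst ht => hs (isUnit_of_dvd_unit hst ht), hspan t⟩
  rw [Nat.cast_one, Ring.ord, Module.length_eq_one_iff, isSimpleModule_iff_isCoatom]
  exact hmax.out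

end order

section chart

variable {X : Scheme.{u}} [IsIntegral X]
variable {R : CommRingCat.{u}} (j : Spec R ⟶ X) [IsOpenImmersion j] [Nonempty (Spec R)] [IsDomain R]

/-- A nonzero function on an affine chart as a nonzero rational function. -/
noncomputable def unitK (a : R) (ha : a ≠ 0) : X.functionFieldˣ :=
  Units.mk0 (toK j a) fun h => ha (toK_injective (h.trans (map_zero _).symm))

variable {j}

lemma unitK_mul {a b : R} (ha : a ≠ 0) (hb : b ≠ 0) :
    unitK j (a * b) (mul_ne_zero ha hb) = unitK j a ha * unitK j b hb :=
  Units.ext (map_mul _ _ _)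

lemma exists_unitK_eq (f : X.functionFieldˣ) : ∃ a b : R, ∃ (ha : a ≠ 0) (hb : b ≠ 0),
    f * unitK j b hb = unitK j a ha := by
  obtain ⟨a, b, hb, h⟩ := exists_toK_mul_eq (j := j) f.1
  have ha : a ≠ 0 := by
    rintro rfl
    rw [map_zero] at h
    rcases mul_eq_zero.1 h with h | h
    · exact f.ne_zero h
    · exact hb (toK_injective (h.trans (map_zero _).symm))
  exact ⟨a, b, ha, hb, Units.ext h⟩

variable [IsLocallyNoetherian X] {P : PrimeDivisor X} {y : Spec R}

lemma ordZ_unitK_eq_zero (hy : j y = P.1) {a : R} (ha : a ≠ 0) (h : a ∉ y.asIdeal) :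
    ordZ P (unitK j a ha) = 0 := by
  have hx : P.1 ∈ j ''ᵁ ⊤ := hy ▸ mem_image j y
  exact ordZ_eq_zero_of_isUnit P _ (toK_eq P.1 hx a) ((isUnit_germ_iff hy hx a).2 h)

lemma ordZ_unitK_pos (hy : j y = P.1) {a : R} (ha : a ≠ 0) (h : a ∈ y.asIdeal) :
    0 < ordZ P (unitK j a ha) := by
  have hx : P.1 ∈ j ''ᵁ ⊤ := hy ▸ mem_image j y
  exact ordZ_pos_of_not_isUnit P _ (toK_eq P.1 hx a) fun hu => (isUnit_germ_iff hy hx a).1 hu h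

lemma ordZ_unitK_eq_one (hy : j y = P.1) {a : R} (ha : a ≠ 0) (h : y.asIdeal = Ideal.span {a}) :
    ordZ P (unitK j a ha) = 1 := by
  have hx : P.1 ∈ j ''ᵁ ⊤ := hy ▸ mem_image j y
  have hay : a ∈ y.asIdeal := h ▸ Ideal.mem_span_singleton_self a
  refine ordZ_eq_one P _ (toK_eq P.1 hx a) (fun hu => (isUnit_germ_iff hy hx a).1 hu hay)
    fun t ht => ?_
  obtain ⟨b, s, hs, hbs⟩ := exists_germ_mul_eq hy hx t
  have hsu := (isUnit_germ_iff hy hx s).2 hs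
  have hb : b ∈ y.asIdeal := by
    by_contra hb
    exact ht (isUnit_of_mul_isUnit_left (hbs ▸ (isUnit_germ_iff hy hx b).2 hb))
  rw [h, Ideal.mem_span_singleton] at hb
  have h1 : germ j P.1 hx a ∣ germ j P.1 hx b := map_dvd (germ j P.1 hx).hom hb
  rw [← hbs] at h1
  exact (hsu.dvd_mul_right).1 h1

end chart

lemma height_eq_one {X : Scheme.{u}} {R : CommRingCat.{u}} {j : Spec R ⟶ X} [IsOpenImmersion j]
    {P : PrimeDivisor X} {y : Spec R} (hy : j y = P.1) : y.asIdeal.height = 1 := by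
  rw [idealHeight_eq_coheight, ← coheight_eq_of_isOpenImmersion j]
  exact hy ▸ P.2

/-- The prime divisor given by a prime ideal of height one in an affine chart. -/
noncomputable def primeDivisorOfHeight {X : Scheme.{u}} {R : CommRingCat.{u}} (j : Spec R ⟶ X)
    [IsOpenImmersion j] (y : Spec R) (h : y.asIdeal.height = 1) : PrimeDivisor X :=
  ⟨j y, by
    rw [idealHeight_eq_coheight, ← coheight_eq_of_isOpenImmersion j] at h
    exact h⟩

end SchemeDivisor

/-! ### Faces of monoids and monomial primes of height one -/

namespace MonoidFace

open AddMonoidAlgebra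

section

variable (k : Type*) [Field k] {S : Type*} [AddCommMonoid S]

/-- The complement of a prime ideal of an additive commutative monoid. -/
structure IsFace (F : S → Prop) : Prop where
  zero : F 0
  add_iff : ∀ a b, F (a + b) ↔ F a ∧ F b

variable {F : S → Prop}

open Classical in
/-- The endomorphism of `k[S]` that kills the monomials outside of a face. -/
noncomputable def faceHom (hF : IsFace F) : AddMonoidAlgebra k S →ₐ[k] AddMonoidAlgebra k S :=
  AddMonoidAlgebra.lift k (AddMonoidAlgebra k S) S
    { toFun := fun s => if F s.toAdd then single s.toAdd 1 else 0
      map_one' := by simp [hF.zero, AddMonoidAlgebra.one_def]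
      map_mul' := fun a b => by
        have := hF.add_iff a.toAdd b.toAdd
        by_cases ha : F a.toAdd <;> by_cases hb : F b.toAdd <;>
          simp_all [AddMonoidAlgebra.single_mul_single] }

open Classical in
lemma faceHom_single (hF : IsFace F) (m : S) (a : k) :
    faceHom k hF (single m a) = if F m then single m a else 0 := by
  simp only [faceHom, AddMonoidAlgebra.lift_single, MonoidHom.coe_mk, OneHom.coe_mk, toAdd_ofAdd]
  split_ifs <;> simp

open Classical in
lemma coeff_faceHom (hF : IsFace F) (f : AddMonoidAlgebra k S) (m : S) :
    (faceHom k hF f).coeff m = if F m then f.coeff m else 0 := by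
  induction f using AddMonoidAlgebra.induction_linear with
  | zero => simp
  | add f g hf hg =>
    rw [map_add]
    simp only [coeff_add, Finsupp.add_apply, hf, hg]
    split_ifs <;> simp
  | single n a =>
    rw [faceHom_single]
    by_cases hnm : n = m
    · subst hnm; split_ifs <;> simp
    · split_ifs <;> simp [hnm]

/-- The ideal spanned by the monomials outside of a face. -/
noncomputable def faceIdeal (hF : IsFace F) : Ideal (AddMonoidAlgebra k S) :=
  RingHom.ker (faceHom k hF)

variable {k}

lemma mem_faceIdeal {hF : IsFace F} {f : AddMonoidAlgebra k S} :
    f ∈ faceIdeal k hF ↔ ∀ m, F m → f.coeff m = 0 := by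
  classical
  rw [faceIdeal, RingHom.mem_ker, ← coeff_inj, Finsupp.ext_iff]
  refine forall_congr' fun m => ?_
  rw [coeff_faceHom]
  by_cases h : F m <;> simp [h]

lemma single_mem_faceIdeal {hF : IsFace F} {m : S} :
    (single m 1 : AddMonoidAlgebra k S) ∈ faceIdeal k hF ↔ ¬ F m := by
  classical
  rw [faceIdeal, RingHom.mem_ker]
  rw [show faceHom k hF (single m 1) = _ from faceHom_single k hF m 1]
  split_ifs with h <;> simp [h]

/-- Being the kernel of an endomorphism of a domain makes the ideal prime at once, which is the
purpose of `faceHom`. -/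
instance faceIdeal_isPrime [IsDomain (AddMonoidAlgebra k S)] (hF : IsFace F) :
    (faceIdeal k hF).IsPrime := RingHom.ker_isPrime _

lemma mem_of_support {I : Ideal (AddMonoidAlgebra k S)} {f : AddMonoidAlgebra k S}
    (h : ∀ m, f.coeff m ≠ 0 → (single m 1 : AddMonoidAlgebra k S) ∈ I) : f ∈ I := by
  rw [← AddMonoidAlgebra.sum_coeff_single f]
  refine Ideal.sum_mem _ fun m hm => ?_
  have := I.mul_mem_left (single 0 (f.coeff m)) (h m (Finsupp.mem_support_iff.1 hm))
  rwa [single_mul_single, zero_add, mul_one] at this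

/-- The face of the monomials outside of a prime ideal. -/
lemma isFace_of_isPrime (p : Ideal (AddMonoidAlgebra k S)) [hp : p.IsPrime] :
    IsFace fun m : S => (single m 1 : AddMonoidAlgebra k S) ∉ p where
  zero := by
    rw [← AddMonoidAlgebra.one_def]
    exact fun h => hp.ne_top ((Ideal.eq_top_iff_one p).2 h)
  add_iff a b := by
    rw [show (single (a + b) 1 : AddMonoidAlgebra k S) = single a 1 * single b 1 by
      rw [single_mul_single, mul_one], hp.mul_mem_iff_mem_or_mem, not_or]

lemma eq_of_le_of_height_eq_one {R : Type*} [CommRing R] [IsDomain R] {p q : Ideal R}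
    [p.IsPrime] [q.IsPrime] (hp : p.height = 1) (hqp : q ≤ p) (hq : q ≠ ⊥) : q = p := by
  by_contra hne
  have h1 := Ideal.height_add_one_le_of_lt_of_isPrime (lt_of_le_of_ne hqp hne)
  rw [hp] at h1
  exact hq (Ideal.height_eq_zero_iff_eq_bot.1
    (nonpos_iff_eq_zero.1 ((ENat.add_le_add_iff_right (by simp)).1
      (h1.trans_eq (zero_add 1).symm))))

/-- A prime ideal of height one that contains a monomial is spanned by monomials. -/
lemma eq_faceIdeal_of_height_eq_one [IsDomain (AddMonoidAlgebra k S)]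
    {p : Ideal (AddMonoidAlgebra k S)} [p.IsPrime] (hp : p.height = 1) (hF : IsFace F)
    (hle : ∀ m, ¬ F m → (single m 1 : AddMonoidAlgebra k S) ∈ p) {m : S} (hm : ¬ F m) :
    faceIdeal k hF = p := by
  refine eq_of_le_of_height_eq_one hp (fun f hf => mem_of_support fun n hn => hle n fun h =>
    hn (mem_faceIdeal.1 hf n h)) fun h => ?_
  have := single_mem_faceIdeal (k := k) (hF := hF).2 hm
  rw [h, Ideal.mem_bot] at this
  simp at this

/-- The monomials in `p` span a nonzero prime contained in `p`; since `p` has height one, they span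
`p`. -/
lemma mem_iff_of_height_eq_one [IsDomain (AddMonoidAlgebra k S)]
    {p : Ideal (AddMonoidAlgebra k S)} [p.IsPrime] (hp : p.height = 1) {m : S}
    (hm : (single m 1 : AddMonoidAlgebra k S) ∈ p) (f : AddMonoidAlgebra k S) :
    f ∈ p ↔ ∀ n, f.coeff n ≠ 0 → (single n 1 : AddMonoidAlgebra k S) ∈ p := by
  refine ⟨fun hf n hn => ?_, mem_of_support⟩
  have h := eq_faceIdeal_of_height_eq_one hp (isFace_of_isPrime p) (fun m => not_not.1)
    (not_not.2 hm)
  rw [← h] at hf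
  by_contra h1
  exact hn (mem_faceIdeal.1 hf n h1)

/-- The hypothesis `h` says that after inverting the face every monomial outside of it is a multiple
of `q`. So the ideal is minimal over the principal ideal of `q`, and Krull's theorem applies. -/
lemma height_faceIdeal_eq_one [IsDomain (AddMonoidAlgebra k S)]
    [IsNoetherianRing (AddMonoidAlgebra k S)] (hF : IsFace F) {q : S} (hq : ¬ F q)
    (h : ∀ n, ¬ F n → ∃ f g, F f ∧ n + f = g + q) : (faceIdeal k hF).height = 1 := by
  have hq' := single_mem_faceIdeal (k := k) (hF := hF).2 hq
  refine le_antisymm ?_ ?_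
  · refine Ideal.height_le_one_of_isPrincipal_of_mem_minimalPrimes
      (Ideal.span {(single q 1 : AddMonoidAlgebra k S)}) _ ⟨⟨inferInstance, ?_⟩, ?_⟩
    · rwa [Ideal.span_singleton_le_iff_mem]
    · rintro p ⟨hp, hqp⟩ hpF f hf
      rw [Ideal.span_singleton_le_iff_mem] at hqp
      refine mem_of_support fun n hn => ?_
      obtain ⟨f, g, hf', hfg⟩ := h n fun hn' => hn (mem_faceIdeal.1 hf n hn')
      have h1 : (single n 1 * single f 1 : AddMonoidAlgebra k S) ∈ p := by
        rw [single_mul_single, hfg, ← single_mul_single]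
        exact p.mul_mem_left _ hqp
      refine (hp.mem_or_mem h1).resolve_right fun h2 => ?_
      exact single_mem_faceIdeal.1 (hpF h2) hf'
  · rw [Order.one_le_iff_ne_zero, Ne, Ideal.height_eq_zero_iff_eq_bot]
    intro h0
    rw [h0, Ideal.mem_bot] at hq'
    simp at hq'

end

variable {k : Type*} [Field k] {G : Type*} [AddCommGroup G]

/-- A lattice point outside of a saturated monoid is separated from it by a prime ideal of height
one. -/
lemma exists_face_of_notMem {S : AddSubmonoid G} [IsDomain (AddMonoidAlgebra k S)]
    [IsNoetherianRing (AddMonoidAlgebra k S)]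
    (hsat : ∀ e n : G, (∀ i : ℕ, n + i • e ∈ S) → e ∈ S)
    (hgen : ∀ m : G, ∃ b ∈ S, b + m ∈ S) {m : G} (hm : m ∉ S) :
    ∃ (F : S → Prop) (hF : IsFace F), (faceIdeal k hF).height = 1 ∧
      ∃ q f g : S, ¬ F q ∧ F f ∧ (q : G) + (m + g) = f := by
  classical
  -- This is the classical proof that an integrally closed Noetherian domain is the intersection of
  -- its localizations at height one primes, carried out for monomials: `D e` is the conductor of
  -- `e`.
  let D : G → Set S := fun e => {n | (n : G) + e ∈ S}
  let I : G → Ideal (AddMonoidAlgebra k S) := fun e => Ideal.span (of' k S '' D e)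
  have hI : ∀ e n, (single n 1 : AddMonoidAlgebra k S) ∈ I e ↔ n ∈ D e := fun e n => by
    refine ⟨fun h => ?_, fun h => Ideal.subset_span ⟨n, h, rfl⟩⟩
    rw [mem_ideal_span_of'_image] at h
    obtain ⟨m', hm', d, hd⟩ := h n (by simp)
    rw [hd]
    change ((d + m' : S) : G) + e ∈ S
    rw [AddSubmonoid.coe_add, add_assoc]
    exact S.add_mem d.2 hm'
  -- Among the translates `m + g` outside of `S`, one with maximal conductor is taken; maximality
  -- makes the conductor prime, as for associated primes.
  obtain ⟨J, ⟨e, ⟨⟨g, rfl⟩, he⟩, rfl⟩, hJ⟩ := set_has_maximal_iff_noetherian.2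
    (inferInstanceAs (IsNoetherian (AddMonoidAlgebra k S) (AddMonoidAlgebra k S)))
    (I '' {e | (∃ g : S, m + g = e) ∧ e ∉ S}) ⟨_, m, ⟨⟨0, by simp⟩, hm⟩, rfl⟩
  have hF : IsFace fun n : S => n ∉ D (m + g) := by
    refine ⟨by simpa [D] using he, fun a b => ⟨fun h => ⟨fun ha => h ?_, fun hb => h ?_⟩, ?_⟩⟩
    · change ((a + b : S) : G) + (m + g) ∈ S
      rw [AddSubmonoid.coe_add, add_comm (a : G), add_assoc]
      exact S.add_mem b.2 ha
    · change ((a + b : S) : G) + (m + g) ∈ S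
      rw [AddSubmonoid.coe_add, add_assoc]
      exact S.add_mem a.2 hb
    · rintro ⟨ha, hb⟩ hab
      have h1 : I (m + g) ≤ I (m + (g + a : S)) := by
        refine Ideal.span_mono (Set.image_mono fun n hn => ?_)
        change (n : G) + (m + (g + a : S)) ∈ S
        rw [AddSubmonoid.coe_add, ← add_assoc m, ← add_assoc (n : G)]
        exact S.add_mem hn a.2
      refine hJ (I (m + (g + a : S))) ⟨_, ⟨⟨_, rfl⟩, fun h => ha ?_⟩, rfl⟩ (lt_of_le_not_ge h1
        fun h => hb ?_)
      · change (a : G) + (m + g) ∈ S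
        rw [AddSubmonoid.coe_add] at h
        convert! h using 1
        abel
      · rw [← hI]
        refine h ((hI _ _).2 ?_)
        change (b : G) + (m + (g + a : S)) ∈ S
        have : ((a + b : S) : G) + (m + g) ∈ S := hab
        rw [AddSubmonoid.coe_add] at this ⊢
        convert! this using 1
        abel
  -- Otherwise the conductor would be stable under adding `m + g`, so all `b + i • (m + g)` would
  -- lie in `S`, and saturation would put `m + g` in `S`.
  have hq : ∃ q : S, q ∈ D (m + g) ∧ ∃ f : S, (q : G) + (m + g) = f ∧ f ∉ D (m + g) := by
    by_contra! hcon
    obtain ⟨b, hb, hbe⟩ := hgen (m + g)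
    refine he (hsat _ b fun i => ?_)
    suffices H : ∃ n : S, b + i • (m + g) = (n : G) ∧ n ∈ D (m + g) by
      obtain ⟨n, hn, -⟩ := H
      exact hn ▸ n.2
    induction i with
    | zero => exact ⟨⟨b, hb⟩, by simp, hbe⟩
    | succ i ih =>
      obtain ⟨n, hn, hnD⟩ := ih
      refine ⟨⟨_, hnD⟩, ?_, hcon n hnD ⟨_, hnD⟩ rfl⟩
      rw [succ_nsmul, ← add_assoc, hn]
  obtain ⟨q, hqD, f, hqf, hf⟩ := hq
  -- The monomial `q` generates the prime locally: for `n` in the conductor, `n + f = (n + (m + g))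
  -- + q`, with `f` in the face.
  refine ⟨_, hF, height_faceIdeal_eq_one hF (q := q) (not_not.2 hqD) fun n hn => ?_, q, f, g,
    not_not.2 hqD, hf, hqf⟩
  refine ⟨f, ⟨_, not_not.1 hn⟩, hf, Subtype.ext ?_⟩
  change (n : G) + f = n + (m + g) + q
  rw [← hqf]
  abel

/-- The units of a submonoid of a group are a face. -/
lemma isFace_units {G : Type*} [AddCommGroup G] (S : AddSubmonoid G) :
    IsFace fun m : S => -m.1 ∈ S where
  zero := by simp
  add_iff a b := by
    refine ⟨fun h => ⟨?_, ?_⟩, fun h => ?_⟩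
    · convert! S.add_mem h b.2 using 1
      rw [AddSubmonoid.coe_add]
      abel
    · convert! S.add_mem h a.2 using 1
      rw [AddSubmonoid.coe_add]
      abel
    · convert! S.add_mem h.1 h.2 using 1
      rw [AddSubmonoid.coe_add]
      abel

end MonoidFace

/-! ### Unimodular monoid algebras as localized polynomial rings -/

namespace MonoidFace

open AddMonoidAlgebra

/-- Inverting a monomial `w` turns `k[S]` into `k[S']` if `S'` is obtained from `S` by
inverting `w`. -/
lemma isLocalization_away_mapDomain (k : Type*) [Field k] {S S' : Type*} [AddCommMonoid S]
    [AddCommMonoid S'] (i : S →+ S') (hi : Function.Injective i) (w : S) (w' : S')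
    (hw : i w + w' = 0) (h : ∀ m : S', ∃ (n : ℕ) (s : S), m + i (n • w) = i s) :
    letI := (mapDomainAlgHom k k i).toRingHom.toAlgebra
    IsLocalization.Away (single w 1 : AddMonoidAlgebra k S) (AddMonoidAlgebra k S') := by
  let := (mapDomainAlgHom k k i).toRingHom.toAlgebra
  have halg : ∀ x, algebraMap (AddMonoidAlgebra k S) (AddMonoidAlgebra k S') x =
    mapDomainAlgHom k k i x := fun _ => rfl
  have hpow : ∀ n : ℕ, algebraMap (AddMonoidAlgebra k S) (AddMonoidAlgebra k S')
      ((single w 1 : AddMonoidAlgebra k S) ^ n) = single (i (n • w)) 1 := fun n => by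
    rw [single_pow, one_pow, halg]
    simp
  refine ⟨⟨?_, ?_, ?_⟩⟩
  · rintro ⟨_, n, rfl⟩
    refine IsUnit.of_mul_eq_one (single (n • w') (1 : k)) ?_
    change algebraMap (AddMonoidAlgebra k S) (AddMonoidAlgebra k S')
      ((single w 1 : AddMonoidAlgebra k S) ^ n) * _ = 1
    rw [hpow, single_mul_single, mul_one, map_nsmul, ← smul_add, hw, smul_zero,
      AddMonoidAlgebra.one_def]
  · intro z
    suffices H : ∃ (n : ℕ) (x : AddMonoidAlgebra k S),
        z * algebraMap (AddMonoidAlgebra k S) (AddMonoidAlgebra k S')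
        ((single w 1 : AddMonoidAlgebra k S) ^ n) = algebraMap _ _ x by
      obtain ⟨n, x, hx⟩ := H
      exact ⟨(x, ⟨_, n, rfl⟩), hx⟩
    induction z using AddMonoidAlgebra.induction_linear with
    | zero => exact ⟨0, 0, by simp⟩
    | add f g hf hg =>
      obtain ⟨n, x, hx⟩ := hf
      obtain ⟨n', x', hx'⟩ := hg
      refine ⟨n + n', x * (single w 1 : AddMonoidAlgebra k S) ^ n' +
        x' * (single w 1 : AddMonoidAlgebra k S) ^ n, ?_⟩
      rw [map_add, map_mul _ x, map_mul _ x', ← hx, ← hx', pow_add, map_mul]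
      ring
    | single m a =>
      obtain ⟨n, s, hn⟩ := h m
      refine ⟨n, single s a, ?_⟩
      rw [hpow, single_mul_single, mul_one, halg, hn]
      simp
  · intro x y hxy
    exact ⟨1, by rw [mapDomain_injective hi hxy]⟩

section basis

variable (k : Type u) [Field k] {G : Type u} [AddCommGroup G] {ι : Type} [Fintype ι]

/-- The monoid homomorphism `ℕ^ι → S` given by elements of `S`. -/
noncomputable def ofBasis (b : Module.Basis ι ℤ G) (J : Set ι) (S : AddSubmonoid G)
    (hS : ∀ m, m ∈ S ↔ ∀ i ∈ J, 0 ≤ b.repr m i) : (ι →₀ ℕ) →+ S where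
  toFun x := ⟨∑ i, x i • b i, (hS _).2 fun j _ => by
    classical
    simp [Finsupp.single_apply]⟩
  map_zero' := by ext; simp
  map_add' x y := by ext; simp [add_smul, Finset.sum_add_distrib]

lemma repr_ofBasis (b : Module.Basis ι ℤ G) (J : Set ι) (S : AddSubmonoid G)
    (hS : ∀ m, m ∈ S ↔ ∀ i ∈ J, 0 ≤ b.repr m i) (x : ι →₀ ℕ) (j : ι) :
    b.repr (ofBasis b J S hS x : G) j = x j := by
  classical
  simp [ofBasis, Finsupp.single_apply]

/-- In the given basis the monoid is ℕ^J times the free group on the other coordinates, so it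
suffices to invert the product of the variables outside of `J`. Smoothness and factoriality then
pass from the polynomial ring. -/
lemma exists_isLocalization_away_mvPolynomial (b : Module.Basis ι ℤ G) (J : Set ι)
    (S : AddSubmonoid G)
    (hS : ∀ m, m ∈ S ↔ ∀ i ∈ J, 0 ≤ b.repr m i) :
    ∃ (f : MvPolynomial ι k →ₐ[k] AddMonoidAlgebra k S) (w : MvPolynomial ι k), w ≠ 0 ∧
      letI := f.toRingHom.toAlgebra
      IsLocalization.Away w (AddMonoidAlgebra k S) := by
  classical
  let w : ι →₀ ℕ := ∑ i, if i ∈ J then 0 else Finsupp.single i 1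
  have hw : ∀ i, w i = if i ∈ J then 0 else 1 := fun i => by
    simp only [w, Finsupp.finsetSum_apply]
    rw [Finset.sum_eq_single i]
    · split_ifs <;> simp
    · intro j _ hj
      split_ifs <;> simp [hj]
    · simp
  refine ⟨mapDomainAlgHom k k (ofBasis b J S hS), MvPolynomial.monomial w 1, by simp, ?_⟩
  refine isLocalization_away_mapDomain k (ofBasis b J S hS) ?_ w ⟨-(ofBasis b J S hS w : G), ?_⟩
    ?_ ?_
  · intro x y hxy
    ext j
    have := repr_ofBasis b J S hS x j
    rw [hxy, repr_ofBasis] at this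
    exact_mod_cast this.symm
  · rw [hS]
    intro i hi
    rw [map_neg, Finsupp.neg_apply, repr_ofBasis, hw, if_pos hi]
    simp
  · ext; simp
  · intro m
    -- A multiple of `w` by the sum of the absolute values makes every coordinate outside of `J`
    -- nonnegative; those in `J` already are, so `toNat` loses nothing.
    refine ⟨∑ i, (b.repr (m : G) i).natAbs, Finsupp.equivFunOnFinite.symm fun j =>
      (b.repr (m : G) j + (∑ i, (b.repr (m : G) i).natAbs) * w j).toNat, ?_⟩
    ext1
    apply b.repr.injective
    ext j
    rw [repr_ofBasis, AddSubmonoid.coe_add, map_add, Finsupp.add_apply,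
      repr_ofBasis, Finsupp.smul_apply, hw]
    have h1 : (b.repr (m : G) j).natAbs ≤ ∑ i, (b.repr (m : G) i).natAbs :=
      Finset.single_le_sum (f := fun i => (b.repr (m : G) i).natAbs) (fun _ _ => Nat.zero_le _)
        (Finset.mem_univ j)
    have h2 := (hS m).1 m.2 j
    simp only [Finsupp.equivFunOnFinite_symm_apply_apply, hw]
    generalize (∑ i, (b.repr (m : G) i).natAbs) = n at h1 ⊢
    split_ifs with h
    · have := h2 h
      simp
      omega
    · simp only [smul_eq_mul, Nat.cast_one, mul_one]
      omega

lemma smooth_of_basis (b : Module.Basis ι ℤ G) (J : Set ι) (S : AddSubmonoid G)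
    (hS : ∀ m, m ∈ S ↔ ∀ i ∈ J, 0 ≤ b.repr m i) : Algebra.Smooth k (AddMonoidAlgebra k S) := by
  obtain ⟨f, w, -, h⟩ := exists_isLocalization_away_mvPolynomial k b J S hS
  let := f.toRingHom.toAlgebra
  have : IsScalarTower k (MvPolynomial ι k) (AddMonoidAlgebra k S) :=
    IsScalarTower.of_algebraMap_eq fun r => (f.commutes r).symm
  have : Algebra.Smooth (MvPolynomial ι k) (AddMonoidAlgebra k S) :=
    Algebra.Smooth.of_isLocalization_Away w
  have : Algebra.Smooth k (MvPolynomial ι k) := ⟨inferInstance, inferInstance⟩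
  exact Algebra.Smooth.comp k (MvPolynomial ι k) _

lemma uniqueFactorizationMonoid_of_basis (b : Module.Basis ι ℤ G) (J : Set ι) (S : AddSubmonoid G)
    (hS : ∀ m, m ∈ S ↔ ∀ i ∈ J, 0 ≤ b.repr m i)
    [IsDomain (AddMonoidAlgebra k S)] :
    UniqueFactorizationMonoid (AddMonoidAlgebra k S) := by
  obtain ⟨f, w, hw, h⟩ := exists_isLocalization_away_mvPolynomial k b J S hS
  let := f.toRingHom.toAlgebra
  exact UniqueFactorizationMonoid.of_isLocalization (Submonoid.powers w) _

end basis

end MonoidFace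

/-! ### Saturation of S_σ and the vertex of a strongly convex cone -/

namespace ToricFan

variable {N : Type u} [AddCommGroup N]

lemma baseChange_add (a b : Module.Dual ℤ N) (v : RealSpace N) :
    Module.Dual.baseChange ℝ (a + b) v =
      Module.Dual.baseChange ℝ a v + Module.Dual.baseChange ℝ b v := by
  simp [Module.Dual.baseChange]

lemma baseChange_nsmul (i : ℕ) (a : Module.Dual ℤ N) (v : RealSpace N) :
    Module.Dual.baseChange ℝ (i • a) v = i * Module.Dual.baseChange ℝ a v := by
  rw [map_nsmul, LinearMap.smul_apply, nsmul_eq_mul]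

/-- If `e` were negative at a vector of σ, a large multiple would outweigh `n` there. -/
lemma dualMonoid_saturated (σ : PointedCone ℝ (RealSpace N)) (e n : Module.Dual ℤ N)
    (h : ∀ i : ℕ, n + i • e ∈ dualMonoid σ) : e ∈ dualMonoid σ := by
  intro v hv
  by_contra! hneg
  obtain ⟨i, hi⟩ := exists_nat_gt
    (Module.Dual.baseChange ℝ n v / -Module.Dual.baseChange ℝ e v)
  rw [div_lt_iff₀ (by linarith)] at hi
  have := h i v hv
  rw [baseChange_add, baseChange_nsmul] at this
  linarith

lemma mem_dualMonoid_bot (m : Module.Dual ℤ N) :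
    m ∈ dualMonoid (⊥ : PointedCone ℝ (RealSpace N)) := by
  intro v hv
  rw [(Submodule.mem_bot _).1 hv, map_zero]

/-- The origin is a face of a strongly convex cone. -/
lemma IsStronglyConvexRational.isFace_bot [Module.Finite ℤ N] {σ : PointedCone ℝ (RealSpace N)}
    (hσ : IsStronglyConvexRational σ) : IsFace ⊥ σ := by
  obtain ⟨s, hs⟩ := hσ.rational
  let T : Set (RealSpace N) := ((fun n : N => (1 : ℝ) ⊗ₜ[ℤ] n) '' (s : Set N)) \ {0}
  have hTf : T.Finite := (s.finite_toSet.image _).subset Set.sdiff_subset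
  have hTσ : T ⊆ {v | v ∈ σ ∧ v ≠ 0} := fun v hv =>
    ⟨hs ▸ Submodule.subset_span hv.1, hv.2⟩
  -- This is where strong convexity enters: the convex hull of the nonzero generators avoids 0 and
  -- is compact, so a linear form separates it strictly from 0.
  have hconv : Convex ℝ {v | v ∈ σ ∧ v ≠ 0} := by
    rintro v ⟨hv, hv0⟩ v' ⟨hv', hv0'⟩ a b ha hb hab
    have h1 : a • v ∈ σ := PointedCone.smul_mem σ ha hv
    have h2 : b • v' ∈ σ := PointedCone.smul_mem σ hb hv'
    refine ⟨σ.add_mem h1 h2, fun h0 => ?_⟩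
    have h3 := hσ.noLine _ h1 (by rwa [neg_eq_of_add_eq_zero_right h0])
    have h4 : a = 0 := (smul_eq_zero.1 h3).resolve_right hv0
    rw [h4, zero_add] at hab
    rw [h3, zero_add, hab, one_smul] at h0
    exact hv0' h0
  have h0 : (0 : RealSpace N) ∉ convexHull ℝ T := fun h =>
    (convexHull_min hTσ hconv h).2 rfl
  let e : RealSpace N ≃ₗ[ℝ] (Module.Free.ChooseBasisIndex ℝ (RealSpace N) → ℝ) :=
    (Module.Free.chooseBasis ℝ (RealSpace N)).equivFun
  have hC : e '' convexHull ℝ T = convexHull ℝ (e '' T) :=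
    e.toLinearMap.image_convexHull T
  have h0' : (0 : Module.Free.ChooseBasisIndex ℝ (RealSpace N) → ℝ) ∉ e '' convexHull ℝ T := by
    rintro ⟨v, hv, hv0⟩
    rw [map_eq_zero_iff e e.injective] at hv0
    exact h0 (hv0 ▸ hv)
  obtain ⟨f, c, hf0, hf⟩ := geometric_hahn_banach_point_closed
    (hC ▸ convex_convexHull ℝ (e '' T))
    (hC ▸ ((hTf.image e).isCompact_convexHull (𝕜 := ℝ)).isClosed) h0'
  rw [map_zero] at hf0
  let F : Module.Dual ℝ (RealSpace N) := f.toLinearMap ∘ₗ e.toLinearMap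
  have hF : ∀ v ∈ T, 0 < F v := fun v hv =>
    hf0.trans (hf (e v) ⟨v, subset_convexHull ℝ T hv, rfl⟩)
  have key : ∀ v ∈ σ, 0 ≤ F v ∧ (F v = 0 → v = 0) := fun v hv => by
    rw [hs] at hv
    induction hv using Submodule.span_induction with
    | mem v hv =>
      by_cases hv0 : v = 0
      · simp [hv0]
      · have := hF v ⟨hv, hv0⟩
        exact ⟨this.le, fun h => absurd h this.ne'⟩
    | zero => simp
    | add x y _ _ hx hy =>
      rw [map_add]
      refine ⟨add_nonneg hx.1 hy.1, fun h => ?_⟩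
      rw [add_eq_zero_iff_of_nonneg hx.1 hy.1] at h
      rw [hx.2 h.1, hy.2 h.2, add_zero]
    | smul c x _ hx =>
      rw [Nonneg.mk_smul c.1 c.2 x, map_smul]
      refine ⟨mul_nonneg c.2 hx.1, fun h => ?_⟩
      rcases smul_eq_zero.1 h with h | h
      · rw [h, zero_smul]
      · rw [hx.2 h, smul_zero]
  refine ⟨F, fun v hv => (key v hv).1, fun v => ?_⟩
  rw [Submodule.mem_bot]
  exact ⟨fun h => by simp [h], fun h => (key v h.1).2 h.2⟩

/-- Equivalently, M = S_σ - S_σ: a form that cuts out the vertex, taken often enough, brings any `m`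
into S_σ. -/
lemma IsStronglyConvexRational.exists_add_mem_dualMonoid [Module.Finite ℤ N]
    {σ : PointedCone ℝ (RealSpace N)} (hσ : IsStronglyConvexRational σ) (m : Module.Dual ℤ N) :
    ∃ b ∈ dualMonoid σ, b + m ∈ dualMonoid σ := by
  obtain ⟨w, hw, h⟩ := hσ.isFace_bot.exists_int hσ
  obtain ⟨i, hi⟩ := exists_add_nsmul_mem hσ hw h (mem_dualMonoid_bot m)
  exact ⟨i • w, AddSubmonoid.nsmul_mem _ hw i, by rwa [add_comm]⟩

variable [Module.Finite ℤ N] (Δ : ToricFan N)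

/-- The origin, as a cone of a fan. -/
def botIndex : Δ.Index := ⟨⊥, by
  obtain ⟨σ, hσ⟩ := Δ.nonempty
  exact Δ.face_mem σ hσ ⊥ (Δ.isCone σ hσ).isFace_bot⟩

lemma botIndex_le (σ : Δ.Index) : botIndex Δ ≤ σ := show (⊥ : PointedCone ℝ _) ≤ σ.1 from bot_le

end ToricFan

/-! ### Charts, characters and boundary divisors -/

namespace ToricFan

open AffineChart SchemeDivisor AddMonoidAlgebra

variable (k : Type u) [Field k] {N : Type u} [AddCommGroup N] {Δ : ToricFan N}

/-- The face of a cone of a fan cut out by an integral form. -/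
lemma exists_face (σ : Δ.Index) {w : Module.Dual ℤ N} (hw : w ∈ dualMonoid σ.1) :
    ∃ τ : Δ.Index, τ ≤ σ ∧ ∀ v, v ∈ τ.1 ↔ v ∈ σ.1 ∧ Module.Dual.baseChange ℝ w v = 0 := by
  let τ : PointedCone ℝ (RealSpace N) :=
    { carrier := {v | v ∈ σ.1 ∧ Module.Dual.baseChange ℝ w v = 0}
      zero_mem' := ⟨σ.1.zero_mem, map_zero _⟩
      add_mem' := fun {a b} ha hb => ⟨σ.1.add_mem ha.1 hb.1, by rw [map_add, ha.2, hb.2, add_zero]⟩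
      smul_mem' := fun c x hx => ⟨Submodule.smul_mem σ.1 c hx.1, by
        rw [Nonneg.mk_smul c.1 c.2 x, map_smul, hx.2, smul_zero]⟩ }
  exact ⟨⟨τ, Δ.face_mem σ.1 σ.2 τ ⟨Module.Dual.baseChange ℝ w, hw, fun v => Iff.rfl⟩⟩,
    fun v hv => hv.1, fun v => Iff.rfl⟩

lemma range_map_eq {τ σ : Δ.Index} (f : τ ⟶ σ) (w : dualMonoid σ.1)
    (hτ : ∀ v, v ∈ τ.1 ↔ v ∈ σ.1 ∧ Module.Dual.baseChange ℝ w.1 v = 0) :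
    Set.range ((diagram k Δ).map f) =
      (PrimeSpectrum.basicOpen (single w 1 : coordRing k σ.1) :
        Set (PrimeSpectrum (coordRing k σ.1))) := by
  have h := isLocalization_coordRingMap k (Δ.isCone σ.1 σ.2) (leOfHom f) w hτ
  let := (coordRingMap k (leOfHom f)).toRingHom.toAlgebra
  exact PrimeSpectrum.localization_away_comap_range (coordRing k τ.1)
    (single w 1 : coordRing k σ.1)

variable [Module.Finite ℤ N]

variable (Δ) in

/-- The open subset `U_σ` of `X_Δ`. -/
noncomputable abbrev chartOpen (σ : Δ.Index) : (toricVariety k Δ).Opens := chart k Δ σ ''ᵁ ⊤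

lemma map_chart {τ σ : Δ.Index} (f : τ ⟶ σ) :
    (diagram k Δ).map f ≫ chart k Δ σ = chart k Δ τ := colimit.w (diagram k Δ) f

lemma chart_eq_comp {τ σ : Δ.Index} (h : τ ≤ σ) : chart k Δ τ =
    Spec.map (CommRingCat.ofHom (coordRingMap k h).toRingHom) ≫ chart k Δ σ :=
  (map_chart k (homOfLE h)).symm

lemma chart_map_apply {τ σ : Δ.Index} (f : τ ⟶ σ) (z : (diagram k Δ).obj τ) :
    chart k Δ σ ((diagram k Δ).map f z) = chart k Δ τ z := by
  rw [← map_chart k f]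
  rfl

lemma chartOpen_mono {τ σ : Δ.Index} (h : τ ≤ σ) : chartOpen k Δ τ ≤ chartOpen k Δ σ := by
  rintro _ ⟨z, -, rfl⟩
  exact ⟨(diagram k Δ).map (homOfLE h) z, trivial, chart_map_apply k _ z⟩

/-- The intersection of two cones of a fan. -/
def infIndex (σ τ : Δ.Index) : Δ.Index := ⟨σ.1 ⊓ τ.1, inter_mem Δ σ τ⟩

/-- The gluing identifies points of two charts only through the chart of a common smaller cone,
which lies in σ ∩ τ. -/
lemma chartOpen_inf {σ τ : Δ.Index} {x : toricVariety k Δ} (hσ : x ∈ chartOpen k Δ σ)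
    (hτ : x ∈ chartOpen k Δ τ) : x ∈ chartOpen k Δ (infIndex σ τ) := by
  obtain ⟨y, -, rfl⟩ := hσ
  obtain ⟨z, -, hz⟩ := hτ
  obtain ⟨ρ, f, g, t, rfl, rfl⟩ := (Scheme.IsLocallyDirected.ι_eq_ι_iff (diagram k Δ)).1 hz
  have h : ρ ≤ infIndex σ τ := show ρ.1 ≤ σ.1 ⊓ τ.1 from le_inf (leOfHom g) (leOfHom f)
  refine chartOpen_mono k h ⟨t, trivial, ?_⟩
  exact (chart_map_apply k g t).symm

lemma exists_mem_chartOpen (x : toricVariety k Δ) : ∃ σ : Δ.Index, x ∈ chartOpen k Δ σ := by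
  obtain ⟨σ, y, rfl⟩ := chart_jointly_surjective k Δ x
  exact ⟨σ, mem_image _ y⟩

/-- A point of `U_σ` where the monomial of `w` does not vanish lies in `U_τ` for the face
`τ = σ ∩ w^⊥`. -/
lemma mem_chartOpen_of_notMem {τ σ : Δ.Index} (hle : τ ≤ σ) (w : dualMonoid σ.1)
    (hτ : ∀ v, v ∈ τ.1 ↔ v ∈ σ.1 ∧ Module.Dual.baseChange ℝ w.1 v = 0)
    (y : Spec (CommRingCat.of (coordRing k σ.1)))
    (hw : (single w 1 : coordRing k σ.1) ∉ y.asIdeal) :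
    chart k Δ σ y ∈ chartOpen k Δ τ := by
  have : y ∈ Set.range ((diagram k Δ).map (homOfLE hle)) := by
    rw [range_map_eq k (homOfLE hle) w hτ]
    exact hw
  obtain ⟨z, rfl⟩ := this
  exact ⟨z, trivial, (chart_map_apply k _ z).symm⟩

variable [Module.Free ℤ N]

lemma toK_chart {τ σ : Δ.Index} (h : τ ≤ σ) (a : coordRing k σ.1) :
    toK (chart k Δ τ) (coordRingMap k h a) = toK (chart k Δ σ) a :=
  toK_comp (j := chart k Δ σ) (CommRingCat.ofHom (coordRingMap k h).toRingHom) (chart k Δ τ)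
    (chart_eq_comp k h) a

variable (Δ) in
/-- The character of `m` as a rational function. -/
noncomputable def character (m : Module.Dual ℤ N) : (toricVariety k Δ).functionFieldˣ :=
  unitK (chart k Δ (botIndex Δ))
    (single ⟨m, mem_dualMonoid_bot m⟩ 1 : coordRing k (botIndex Δ).1) (by simp)

lemma character_eq_unitK (σ : Δ.Index) (m : dualMonoid σ.1) :
    character k Δ m.1 = unitK (chart k Δ σ) (single m 1 : coordRing k σ.1) (by simp) := by
  refine Units.ext ?_
  refine Eq.trans ?_ (toK_chart k (botIndex_le Δ σ) (single m 1))
  rw [coordRingMap_single]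
  rfl

lemma character_add (a b : Module.Dual ℤ N) :
    character k Δ (a + b) = character k Δ a * character k Δ b := by
  rw [character, character, character, ← unitK_mul]
  congr 1
  rw [single_mul_single, mul_one]
  rfl

lemma character_zero : character k Δ (0 : Module.Dual ℤ N) = 1 := by
  have := character_add k (Δ := Δ) 0 0
  rw [add_zero] at this
  exact left_eq_mul.1 this

/-- The order of vanishing of characters along a prime divisor. -/
noncomputable def charOrd (P : PrimeDivisor (toricVariety k Δ)) : Module.Dual ℤ N →+ ℤ where
  toFun m := ordZ P (character k Δ m)
  map_zero' := by rw [character_zero, ordZ_one]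
  map_add' a b := by rw [character_add, ordZ_mul]

variable {k} {P : PrimeDivisor (toricVariety k Δ)} {σ : Δ.Index}
  {y : Spec (CommRingCat.of (coordRing k σ.1))}

lemma charOrd_eq_zero (hy : chart k Δ σ y = P.1) (m : dualMonoid σ.1)
    (h : (single m 1 : coordRing k σ.1) ∉ y.asIdeal) : charOrd k P m.1 = 0 := by
  change ordZ P _ = _
  rw [character_eq_unitK]
  exact ordZ_unitK_eq_zero hy _ h

lemma charOrd_pos (hy : chart k Δ σ y = P.1) (m : dualMonoid σ.1)
    (h : (single m 1 : coordRing k σ.1) ∈ y.asIdeal) : 0 < charOrd k P m.1 := by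
  change 0 < ordZ P _
  rw [character_eq_unitK]
  exact ordZ_unitK_pos hy _ h

lemma charOrd_pos_iff (hy : chart k Δ σ y = P.1) (m : dualMonoid σ.1) :
    0 < charOrd k P m.1 ↔ (single m 1 : coordRing k σ.1) ∈ y.asIdeal :=
  ⟨fun h => by_contra fun h' => h.ne' (charOrd_eq_zero hy m h'), charOrd_pos hy m⟩

lemma charOrd_eq_zero_iff (hy : chart k Δ σ y = P.1) (m : dualMonoid σ.1) :
    charOrd k P m.1 = 0 ↔ (single m 1 : coordRing k σ.1) ∉ y.asIdeal :=
  ⟨fun h h' => (charOrd_pos hy m h').ne' h, charOrd_eq_zero hy m⟩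

lemma charOrd_nonneg (hP : P.1 ∈ chartOpen k Δ σ) {m : Module.Dual ℤ N}
    (hm : m ∈ dualMonoid σ.1) : 0 ≤ charOrd k P m := by
  obtain ⟨y, -, hy⟩ := hP
  by_cases h : (single ⟨m, hm⟩ 1 : coordRing k σ.1) ∈ y.asIdeal
  · exact (charOrd_pos hy ⟨m, hm⟩ h).le
  · exact (charOrd_eq_zero hy ⟨m, hm⟩ h).ge

variable (k Δ) in
/-- The prime divisors that do not meet the torus. -/
def BoundaryDivisor : Type u :=
  {P : PrimeDivisor (toricVariety k Δ) // P.1 ∉ chartOpen k Δ (botIndex Δ)}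

/-- A prime divisor that meets the torus has order zero on all characters. -/
lemma charOrd_eq_zero_of_mem (hP : P.1 ∈ chartOpen k Δ (botIndex Δ)) (m : Module.Dual ℤ N) :
    charOrd k P m = 0 := by
  have h1 := charOrd_nonneg hP (mem_dualMonoid_bot m)
  have h2 := charOrd_nonneg hP (mem_dualMonoid_bot (-m))
  rw [map_neg] at h2
  omega

/-- Some monomial vanishes along a boundary divisor. -/
lemma exists_charOrd_pos (P : BoundaryDivisor k Δ) (hP : P.1.1 ∈ chartOpen k Δ σ) :
    ∃ m ∈ dualMonoid σ.1, 0 < charOrd k P.1 m := by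
  obtain ⟨y, -, hy⟩ := hP
  obtain ⟨w, hw, hbot⟩ := (Δ.isCone σ.1 σ.2).isFace_bot.exists_int (Δ.isCone σ.1 σ.2)
  refine ⟨w, hw, (charOrd_pos_iff hy ⟨w, hw⟩).2 ?_⟩
  by_contra h
  -- The locus of U_σ where the monomial of `w` does not vanish is the torus, because `w` cuts out
  -- the vertex.
  exact P.2 (hy ▸ mem_chartOpen_of_notMem k (botIndex_le Δ σ) ⟨w, hw⟩ hbot y h)

/-- The prime ideal of a boundary divisor is spanned by monomials. -/
lemma mem_asIdeal_iff (P : BoundaryDivisor k Δ) (hy : chart k Δ σ y = P.1.1)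
    (f : coordRing k σ.1) :
    f ∈ y.asIdeal ↔ ∀ m, f.coeff m ≠ 0 → (single m 1 : coordRing k σ.1) ∈ y.asIdeal := by
  obtain ⟨m, hm, hpos⟩ := exists_charOrd_pos P (hy ▸ mem_image _ y : P.1.1 ∈ chartOpen k Δ σ)
  have : (PrimeSpectrum.asIdeal y).IsPrime := PrimeSpectrum.isPrime y
  exact MonoidFace.mem_iff_of_height_eq_one (p := PrimeSpectrum.asIdeal y) (height_eq_one hy)
    ((charOrd_pos_iff hy ⟨m, hm⟩).1 hpos) f

end ToricFan

/-! ### Boundary divisors as rays, and the description of S_σ by orders -/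

namespace ToricFan

open AffineChart SchemeDivisor AddMonoidAlgebra

variable {k : Type u} [Field k] {N : Type u} [AddCommGroup N] [Module.Finite ℤ N] {Δ : ToricFan N}
  [Module.Free ℤ N] {σ : Δ.Index}

/-- The primes of both divisors are spanned by the monomials of positive order, so the hypothesis is
an inclusion of primes of height one. -/
lemma BoundaryDivisor.eq_of_charOrd {P Q : BoundaryDivisor k Δ} (hP : P.1.1 ∈ chartOpen k Δ σ)
    (hQ : Q.1.1 ∈ chartOpen k Δ σ)
    (h : ∀ m ∈ dualMonoid σ.1, 0 < charOrd k P.1 m → 0 < charOrd k Q.1 m) : P = Q := by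
  obtain ⟨m₀, hm₀, hpos⟩ := exists_charOrd_pos P hP
  obtain ⟨y, -, hy⟩ := hP
  obtain ⟨z, -, hz⟩ := hQ
  have : (PrimeSpectrum.asIdeal y).IsPrime := PrimeSpectrum.isPrime y
  have : (PrimeSpectrum.asIdeal z).IsPrime := PrimeSpectrum.isPrime z
  have hle : PrimeSpectrum.asIdeal y ≤ PrimeSpectrum.asIdeal z := fun f hf =>
    (mem_asIdeal_iff Q hz f).2 fun m hm => (charOrd_pos_iff hz m).1 <| h m.1 m.2 <|
      (charOrd_pos_iff hy m).2 ((mem_asIdeal_iff P hy f).1 hf m hm)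
  have heq : PrimeSpectrum.asIdeal y = PrimeSpectrum.asIdeal z := by
    refine MonoidFace.eq_of_le_of_height_eq_one (height_eq_one hz) hle fun h0 => ?_
    have h1 : (single ⟨m₀, hm₀⟩ 1 : coordRing k σ.1) ∈ PrimeSpectrum.asIdeal y :=
      (charOrd_pos_iff hy ⟨m₀, hm₀⟩).1 hpos
    rw [h0, Ideal.mem_bot] at h1
    simp at h1
  have hyz : y = z := PrimeSpectrum.ext heq
  refine Subtype.ext (Subtype.ext ?_)
  rw [← hy, ← hz, hyz]

/-- The monoid of a cone is cut out by the orders along the boundary divisors. -/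
lemma exists_charOrd_neg {m : Module.Dual ℤ N} (hm : m ∉ dualMonoid σ.1) :
    ∃ P : BoundaryDivisor k Δ, P.1.1 ∈ chartOpen k Δ σ ∧ charOrd k P.1 m < 0 := by
  obtain ⟨F, hF, hh, q, f, g, hq, hf, hqf⟩ := MonoidFace.exists_face_of_notMem (k := k)
    (S := dualMonoid σ.1) (dualMonoid_saturated σ.1)
    (Δ.isCone σ.1 σ.2).exists_add_mem_dualMonoid hm
  let y : Spec (CommRingCat.of (coordRing k σ.1)) :=
    (⟨MonoidFace.faceIdeal k hF, inferInstance⟩ : PrimeSpectrum (coordRing k σ.1))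
  let P := primeDivisorOfHeight (chart k Δ σ) y hh
  have hy : chart k Δ σ y = P.1 := rfl
  have h1 : 0 < charOrd k P q.1 := (charOrd_pos_iff hy q).2
    (MonoidFace.single_mem_faceIdeal.2 hq)
  have h2 : charOrd k P f.1 = 0 := (charOrd_eq_zero_iff hy f).2 fun h =>
    MonoidFace.single_mem_faceIdeal.1 h hf
  have h3 : 0 ≤ charOrd k P g.1 := charOrd_nonneg (mem_image _ y) g.2
  refine ⟨⟨P, fun hP => h1.ne' (charOrd_eq_zero_of_mem hP _)⟩, mem_image _ y, ?_⟩
  -- In `q + (m + g) = f` the right side has order 0, while `q` has positive and `g` nonnegative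
  -- order.
  have h4 := congrArg (charOrd k P) hqf
  rw [map_add, map_add] at h4
  change charOrd k P m < 0
  omega

/-- This plays the role of the facet description of the dual cone, with orders of vanishing instead
of primitive ray generators. -/
lemma mem_dualMonoid_iff {m : Module.Dual ℤ N} : m ∈ dualMonoid σ.1 ↔
    ∀ P : BoundaryDivisor k Δ, P.1.1 ∈ chartOpen k Δ σ → 0 ≤ charOrd k P.1 m := by
  refine ⟨fun hm P hP => charOrd_nonneg hP hm, fun h => ?_⟩
  by_contra hm
  obtain ⟨P, hP, hneg⟩ := exists_charOrd_neg (k := k) hm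
  exact hneg.not_ge (h P hP)

/-- The ray of a boundary divisor. -/
lemma BoundaryDivisor.exists_ray (P : BoundaryDivisor k Δ) : ∃ τ : Δ.Index,
    P.1.1 ∈ chartOpen k Δ τ ∧ ∀ m, m ∈ dualMonoid τ.1 ↔ 0 ≤ charOrd k P.1 m := by
  have : Finite Δ.Index := Δ.finite
  -- The ray is a minimal cone whose chart contains the divisor. A form of order 0 cuts out a face
  -- with the same property, so by minimality it vanishes on τ and its monomial is a unit.
  obtain ⟨τ, hPτ, hmin⟩ := (Set.toFinite {τ : Δ.Index | P.1.1 ∈ chartOpen k Δ τ}).exists_minimal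
    (exists_mem_chartOpen k P.1.1)
  have hunit : ∀ w ∈ dualMonoid τ.1, charOrd k P.1 w = 0 → -w ∈ dualMonoid τ.1 := by
    intro w hw h0
    obtain ⟨ρ, hρ, hρw⟩ := exists_face τ hw
    obtain ⟨y, -, hy⟩ := hPτ
    have hPρ : P.1.1 ∈ chartOpen k Δ ρ := hy ▸ mem_chartOpen_of_notMem k hρ ⟨w, hw⟩ hρw y
      ((charOrd_eq_zero_iff hy ⟨w, hw⟩).1 h0)
    intro v hv
    rw [map_neg, LinearMap.neg_apply, ((hρw v).1 (hmin hPρ hρ hv)).2, neg_zero]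
  refine ⟨τ, hPτ, fun m => ⟨charOrd_nonneg hPτ, fun hm => ?_⟩⟩
  by_contra hmem
  obtain ⟨Q, hQτ, hQ⟩ := exists_charOrd_neg (k := k) hmem
  -- Monomials of order 0 along `P` are units, hence of order 0 along `Q`, so there is only one
  -- boundary divisor on U_τ.
  have hQP : Q = P := BoundaryDivisor.eq_of_charOrd hQτ hPτ fun n hn hpos => by
    refine lt_of_le_of_ne (charOrd_nonneg hPτ hn) fun h0 => ?_
    have := charOrd_nonneg hQτ (hunit n hn h0.symm)
    rw [map_neg] at this
    omega
  rw [hQP] at hQ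
  exact hQ.not_ge hm

variable (k Δ) in
-- A boundary divisor is determined by its ray, since the dual monoid of the ray is the half-space
-- of nonnegative order, and a fan has finitely many cones.
lemma finite_boundaryDivisor : Finite (BoundaryDivisor k Δ) := by
  have : Finite Δ.Index := Δ.finite
  choose ray hmem hray using BoundaryDivisor.exists_ray (k := k) (Δ := Δ)
  refine Finite.of_injective ray fun P Q hPQ => ?_
  refine BoundaryDivisor.eq_of_charOrd (hmem P) (hPQ ▸ hmem Q) fun m hm hpos => ?_
  refine lt_of_le_of_ne ((hray Q m).1 (hPQ ▸ hm)) fun h0 => ?_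
  have h1 : -m ∈ dualMonoid (ray Q).1 := (hray Q _).2 (by rw [map_neg, ← h0, neg_zero])
  rw [← hPQ, hray, map_neg] at h1
  omega

variable (k Δ) in
/-- The coordinate ring of the torus, as the coordinate ring of the smallest cone. -/
abbrev torusCoordRing : Type u := coordRing k (botIndex Δ).1

/-- The order of a Laurent polynomial along a boundary divisor is the minimum of the orders of its
monomials. -/
lemma ordZ_unitK_le (P : BoundaryDivisor k Δ) {f : torusCoordRing k Δ} (hf : f ≠ 0)
    (m : dualMonoid (botIndex Δ).1) (hm : f.coeff m ≠ 0) :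
    ordZ P.1 (unitK (chart k Δ (botIndex Δ)) f hf) ≤ charOrd k P.1 m.1 := by
  obtain ⟨τ, hPτ, hτ⟩ := P.exists_ray
  -- Divided by a monomial `m'` of least order, `f` becomes regular on the chart of the ray with a
  -- nonzero constant term. So the quotient lies outside of the monomial prime of `P` and has order
  -- 0, and `f` has the order of `m'`.
  obtain ⟨m', hm', hmin⟩ := f.coeff.support.exists_min_image (fun m => charOrd k P.1 m.1)
    ⟨m, Finsupp.mem_support_iff.2 hm⟩
  let n : dualMonoid (botIndex Δ).1 := ⟨-m'.1, mem_dualMonoid_bot _⟩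
  have hn0 : n + m' = 0 := Subtype.ext (neg_add_cancel m'.1)
  let i := AddSubmonoid.inclusion (dualMonoid_anti (botIndex_le Δ τ))
  have hi : Function.Injective i := AddSubmonoid.inclusion_injective _
  let f' : torusCoordRing k Δ := single n 1 * f
  have hsub : (f'.coeff.support : Set (dualMonoid (botIndex Δ).1)) ⊆ Set.range i := by
    classical
    intro l hl
    have hl' := support_coeff_single_mul_subset f (1 : k) n hl
    obtain ⟨l', hlf, rfl⟩ := Finset.mem_image.1 hl'
    refine ⟨⟨n.1 + l'.1, (hτ _).2 ?_⟩, rfl⟩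
    rw [map_add, map_neg]
    linarith [hmin l' hlf]
  obtain ⟨g, hg⟩ : ∃ g : coordRing k τ.1, coordRingMap k (botIndex_le Δ τ) g = f' :=
    ⟨comapDomain i hi f', mapDomain_comapDomain hsub hi⟩
  have hf0 : f' ≠ 0 := mul_ne_zero (by simp) hf
  have hg0 : g ≠ 0 := fun h => hf0 (by rw [← hg, h, map_zero])
  have hgc : g.coeff 0 ≠ 0 := by
    have h1 : f'.coeff (i 0) = g.coeff 0 := by
      rw [← hg]
      exact Finsupp.mapDomain_apply hi g.coeff 0
    rw [← h1, map_zero, ← hn0]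
    change (single n 1 * f).coeff (n + m') ≠ 0
    rw [AddMonoidAlgebra.coeff_single_mul_add, one_mul]
    exact Finsupp.mem_support_iff.1 hm'
  have hgP : ordZ P.1 (unitK (chart k Δ τ) g hg0) = 0 := by
    obtain ⟨y, -, hy⟩ := hPτ
    refine ordZ_unitK_eq_zero hy hg0 fun h => ?_
    have h1 := (mem_asIdeal_iff P hy g).1 h 0 hgc
    rw [← AddMonoidAlgebra.one_def] at h1
    exact (PrimeSpectrum.isPrime y).ne_top ((Ideal.eq_top_iff_one _).2 h1)
  have h1 : unitK (chart k Δ τ) g hg0 = character k Δ n.1 *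
      unitK (chart k Δ (botIndex Δ)) f hf := by
    refine Units.ext ?_
    refine (toK_chart k (botIndex_le Δ τ) g).symm.trans ?_
    rw [hg]
    exact map_mul _ _ _
  rw [h1, ordZ_mul] at hgP
  have h2 : ordZ P.1 (character k Δ n.1) = - charOrd k P.1 m'.1 := map_neg (charOrd k P.1) m'.1
  have h3 := hmin m (Finsupp.mem_support_iff.2 hm)
  linarith

end ToricFan

/-! ### Cartier divisors trivial on the torus are locally characters -/

namespace ToricFan

open AffineChart SchemeDivisor AddMonoidAlgebra

variable {k : Type u} [Field k] {N : Type u} [AddCommGroup N] [Module.Finite ℤ N] {Δ : ToricFan N}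
  [Module.Free ℤ N] {σ : Δ.Index}

variable (k Δ) in
lemma torusCoordRing_ufm : UniqueFactorizationMonoid (torusCoordRing k Δ) :=
  MonoidFace.uniqueFactorizationMonoid_of_basis k (Module.finBasis ℤ (Module.Dual ℤ N)) ∅ _
    fun m => ⟨fun _ _ h => absurd h (Set.notMem_empty _), fun _ => mem_dualMonoid_bot m⟩

lemma height_span_prime {R : Type*} [CommRing R] [IsDomain R] [IsNoetherianRing R] {p : R}
    (hp : Prime p) : (Ideal.span {p}).height = 1 := by
  have : (Ideal.span {p}).IsPrime := (Ideal.span_singleton_prime hp.ne_zero).2 hp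
  refine le_antisymm (Ideal.height_le_one_of_isPrincipal_of_mem_minimalPrimes (Ideal.span {p}) _
    ⟨⟨this, le_rfl⟩, fun q hq _ => hq.2⟩) ?_
  rw [Order.one_le_iff_ne_zero, Ne, Ideal.height_eq_zero_iff_eq_bot, Ideal.span_singleton_eq_bot]
  exact hp.ne_zero

/-- The point of the torus given by a prime element. -/
noncomputable def primePoint {p : torusCoordRing k Δ} (hp : Prime p) :
    Spec (CommRingCat.of (torusCoordRing k Δ)) :=
  (⟨Ideal.span {p}, (Ideal.span_singleton_prime hp.ne_zero).2 hp⟩ :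
    PrimeSpectrum (torusCoordRing k Δ))

/-- The prime divisor given by an irreducible Laurent polynomial. -/
noncomputable def primeDivisor {p : torusCoordRing k Δ} (hp : Prime p) :
    PrimeDivisor (toricVariety k Δ) :=
  primeDivisorOfHeight (chart k Δ (botIndex Δ)) (primePoint hp) (height_span_prime hp)

lemma primeDivisor_mem {p : torusCoordRing k Δ} (hp : Prime p) :
    (primeDivisor hp).1 ∈ chartOpen k Δ (botIndex Δ) := mem_image _ (primePoint hp)

lemma ordZ_primeDivisor_pos_iff {p : torusCoordRing k Δ} (hp : Prime p) {a : torusCoordRing k Δ}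
    (ha : a ≠ 0) : 0 < ordZ (primeDivisor hp) (unitK (chart k Δ (botIndex Δ)) a ha) ↔ p ∣ a := by
  have hy : chart k Δ (botIndex Δ) (primePoint hp) = (primeDivisor hp).1 := rfl
  rw [← Ideal.mem_span_singleton]
  exact ⟨fun h => by_contra fun h' => h.ne' (ordZ_unitK_eq_zero hy ha h'), ordZ_unitK_pos hy ha⟩

variable (k σ) in
/-- The generic point of the closed orbit of `U_σ`. -/
noncomputable def orbitPoint : Spec (CommRingCat.of (coordRing k σ.1)) :=
  (⟨MonoidFace.faceIdeal k (MonoidFace.isFace_units (dualMonoid σ.1)), inferInstance⟩ :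
    PrimeSpectrum (coordRing k σ.1))

lemma notMem_orbitPoint {s : coordRing k σ.1} : s ∉ (orbitPoint k σ).asIdeal ↔
    ∃ m : dualMonoid σ.1, -m.1 ∈ dualMonoid σ.1 ∧ s.coeff m ≠ 0 := by
  refine (not_congr MonoidFace.mem_faceIdeal).trans ?_
  simp only [not_forall, exists_prop, Ne]

variable (σ) in
/-- The inclusion of the coordinate ring of `U_σ` in the Laurent polynomials. -/
noncomputable abbrev toTorus : coordRing k σ.1 →ₐ[k] torusCoordRing k Δ :=
  coordRingMap k (botIndex_le Δ σ)

/-- The functions not vanishing at the orbit point are closed under products, so this kind of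
divisibility can be tested on prime factors. -/
lemma exists_dvd_toTorus {p : torusCoordRing k Δ} (hp : p ≠ 0)
    (h : ∀ π, Prime π → π ∣ p → ∃ s ∉ (orbitPoint k σ).asIdeal, π ∣ toTorus σ s) :
    ∃ s ∉ (orbitPoint k σ).asIdeal, p ∣ toTorus σ s := by
  have := torusCoordRing_ufm k Δ
  have hprime : (PrimeSpectrum.asIdeal (orbitPoint k σ)).IsPrime :=
    PrimeSpectrum.isPrime (orbitPoint k σ)
  induction p using UniqueFactorizationMonoid.induction_on_prime with
  | h₁ => exact absurd rfl hp
  | h₂ p hu =>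
    exact ⟨1, fun h1 => hprime.ne_top ((Ideal.eq_top_iff_one _).2 h1), hu.dvd⟩
  | h₃ a π ha hπ ih =>
    obtain ⟨s, hs, hds⟩ := ih ha fun π' hπ' hd => h π' hπ' (hd.mul_left _)
    obtain ⟨t, ht, hdt⟩ := h π hπ (dvd_mul_right _ _)
    refine ⟨t * s, fun hts => (hprime.mem_or_mem hts).elim ht hs, ?_⟩
    rw [map_mul]
    exact mul_dvd_mul hdt hds

/-- A Laurent polynomial that divides a function not vanishing on the closed orbit of `U_σ` vanishes
along the boundary divisors of `U_σ` like a character. -/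
lemma exists_charOrd_eq_of_dvd {p : torusCoordRing k Δ} (hp : p ≠ 0) {s : coordRing k σ.1}
    (hs : s ∉ (orbitPoint k σ).asIdeal) (hd : p ∣ toTorus σ s) :
    ∃ m, ∀ P : BoundaryDivisor k Δ, P.1.1 ∈ chartOpen k Δ σ →
      ordZ P.1 (unitK (chart k Δ (botIndex Δ)) p hp) = charOrd k P.1 m := by
  classical
  obtain ⟨m₀, hm₀, hc⟩ := notMem_orbitPoint.1 hs
  obtain ⟨g, hg⟩ := hd
  have hs0 : s ≠ 0 := fun h => hc (by simp [h])
  have hts0 : toTorus σ s ≠ 0 := fun h =>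
    hs0 (coordRingMap_injective k (botIndex_le Δ σ) (h.trans (map_zero _).symm))
  have hg0 : g ≠ 0 := fun h => hts0 (by rw [hg, h, mul_zero])
  let i := AddSubmonoid.inclusion (dualMonoid_anti (botIndex_le Δ σ))
  have hmem : i m₀ ∈ (p * g).coeff.support := by
    rw [← hg, Finsupp.mem_support_iff]
    have : (toTorus σ s).coeff (i m₀) = s.coeff m₀ :=
      Finsupp.mapDomain_apply (AddSubmonoid.inclusion_injective _) s.coeff m₀
    rwa [this]
  -- The unit monomial `m₀` of `s` is a sum of monomials of `p` and `g`. The orders of `p` and `g`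
  -- are at most those of `m₁` and `m₂`, and both pairs add up to 0, so equality holds in each.
  obtain ⟨m₁, hm₁, m₂, hm₂, hm⟩ := Finset.mem_add.1 (support_coeff_mul_subset p g hmem)
  refine ⟨m₁.1, fun P hP => ?_⟩
  have h1 := ordZ_unitK_le P hp m₁ (Finsupp.mem_support_iff.1 hm₁)
  have h2 := ordZ_unitK_le P hg0 m₂ (Finsupp.mem_support_iff.1 hm₂)
  have h3 : charOrd k P.1 m₁.1 + charOrd k P.1 m₂.1 = charOrd k P.1 m₀.1 := by
    have hm' : m₁.1 + m₂.1 = m₀.1 := congrArg Subtype.val hm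
    rw [← map_add, hm']
  have h4 := charOrd_nonneg hP m₀.2
  have h5 := charOrd_nonneg hP hm₀
  rw [map_neg] at h5
  have h6 : ordZ P.1 (unitK (chart k Δ σ) s hs0) = 0 := by
    obtain ⟨y, -, hy⟩ := hP
    refine ordZ_unitK_eq_zero hy hs0 fun h => ?_
    have := (charOrd_pos_iff hy m₀).2 ((mem_asIdeal_iff P hy s).1 h m₀ hc)
    omega
  have h7 : unitK (chart k Δ σ) s hs0 =
      unitK (chart k Δ (botIndex Δ)) p hp * unitK (chart k Δ (botIndex Δ)) g hg0 := by
    rw [← unitK_mul]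
    refine Units.ext ((toK_chart k (botIndex_le Δ σ) s).symm.trans ?_)
    exact congrArg _ hg
  rw [h7, ordZ_mul] at h6
  omega

/-- A Cartier divisor that is trivial on the torus has on `U_σ` the Weil divisor of a
character. -/
theorem exists_charOrd_eq_toWeil (c : CartierDivisor (toricVariety k Δ))
    (hc : ∀ P : PrimeDivisor (toricVariety k Δ), P.1 ∈ chartOpen k Δ (botIndex Δ) →
      toWeil _ c P = 0) (σ : Δ.Index) :
    ∃ m, ∀ P : BoundaryDivisor k Δ, P.1.1 ∈ chartOpen k Δ σ →
      toWeil _ c P.1 = charOrd k P.1 m := by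
  have := torusCoordRing_ufm k Δ
  obtain ⟨U, hxU, f, hf⟩ := c.2 (chart k Δ σ (orbitPoint k σ))
  obtain ⟨a₀, b₀, ha₀, hb₀, h₀⟩ := exists_unitK_eq (j := chart k Δ (botIndex Δ)) f
  obtain ⟨a, b, d, hab, hda, hdb⟩ := UniqueFactorizationMonoid.exists_reduced_factors'
    (R := torusCoordRing k Δ) a₀ b₀ hb₀
  subst hda hdb
  have hd0 : d ≠ 0 := left_ne_zero_of_mul ha₀
  have ha0 : a ≠ 0 := right_ne_zero_of_mul ha₀
  have hb0 : b ≠ 0 := right_ne_zero_of_mul hb₀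
  have hfab : f * unitK (chart k Δ (botIndex Δ)) b hb0 =
      unitK (chart k Δ (botIndex Δ)) a ha0 := by
    rw [unitK_mul hd0 hb0, unitK_mul hd0 ha0, mul_left_comm] at h₀
    exact mul_left_cancel h₀
  -- prime divisors of the torus through the closed orbit of `U_σ`
  have key : ∀ π (hπ : Prime π), (¬ ∃ s ∉ (orbitPoint k σ).asIdeal, π ∣ toTorus σ s) →
      (π ∣ a ↔ π ∣ b) := by
    intro π hπ hno
    let y := (diagram k Δ).map (homOfLE (botIndex_le Δ σ)) (primePoint hπ)
    have hy : chart k Δ σ y = (primeDivisor hπ).1 := chart_map_apply k _ _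
    -- If π divides no function that is nonzero at the orbit point, its divisor passes through the
    -- closed orbit and hence meets `U`. There `f` has the order of `c`, which is 0 on the torus, so
    -- π divides both or neither of `a` and `b`.
    have hle : y ⤳ orbitPoint k σ := by
      refine (PrimeSpectrum.le_iff_specializes (R := coordRing k σ.1) y (orbitPoint k σ)).1
        fun s hs => ?_
      by_contra hs'
      exact hno ⟨s, hs', Ideal.mem_span_singleton.1 hs⟩
    have hPU : (primeDivisor hπ).1 ∈ U := by
      rw [← hy]
      exact (hle.map (chart k Δ σ).continuous).mem_open U.isOpen hxU
    have h1 : ordZ (primeDivisor hπ) f = 0 := by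
      rw [← toWeil_eq_ordZ (hf _ hPU)]
      exact hc _ (primeDivisor_mem hπ)
    have h2 := congrArg (ordZ (primeDivisor hπ)) hfab
    rw [ordZ_mul, h1, zero_add] at h2
    rw [← ordZ_primeDivisor_pos_iff hπ ha0, ← ordZ_primeDivisor_pos_iff hπ hb0, h2]
  -- Since `a` and `b` are coprime, no prime factor of either passes through the closed orbit.
  have hpa : ∃ s ∉ (orbitPoint k σ).asIdeal, a ∣ toTorus σ s := by
    refine exists_dvd_toTorus ha0 fun π hπ hπa => ?_
    by_contra hno
    exact hπ.not_isUnit (hab hπa ((key π hπ hno).1 hπa))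
  have hpb : ∃ s ∉ (orbitPoint k σ).asIdeal, b ∣ toTorus σ s := by
    refine exists_dvd_toTorus hb0 fun π hπ hπb => ?_
    by_contra hno
    exact hπ.not_isUnit (hab ((key π hπ hno).2 hπb) hπb)
  obtain ⟨s, hs, hds⟩ := hpa
  obtain ⟨t, ht, hdt⟩ := hpb
  obtain ⟨m, hm⟩ := exists_charOrd_eq_of_dvd ha0 hs hds
  obtain ⟨m', hm'⟩ := exists_charOrd_eq_of_dvd hb0 ht hdt
  refine ⟨m - m', fun P hP => ?_⟩
  -- Every boundary divisor of U_σ contains the closed orbit: its prime contains no unit monomial.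
  -- So the one equation `f` computes `c` along all of them.
  have hPU : P.1.1 ∈ U := by
    obtain ⟨y, -, hy⟩ := hP
    rw [← hy]
    refine Specializes.mem_open (Specializes.map ?_ (chart k Δ σ).continuous) U.isOpen hxU
    refine (PrimeSpectrum.le_iff_specializes (R := coordRing k σ.1) y (orbitPoint k σ)).1
      fun s hs => ?_
    by_contra hs'
    obtain ⟨m₀, hm₀, hc₀⟩ := notMem_orbitPoint.1 hs'
    have h1 := (charOrd_pos_iff hy m₀).2 ((mem_asIdeal_iff P hy s).1 hs m₀ hc₀)
    have h2 := charOrd_nonneg (hy ▸ mem_image _ y : P.1.1 ∈ chartOpen k Δ σ) hm₀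
    rw [map_neg] at h2
    omega
  have h2 := congrArg (ordZ P.1) hfab
  rw [ordZ_mul, hm P hP, hm' P hP] at h2
  rw [toWeil_eq_ordZ (hf _ hPU), map_sub]
  omega

end ToricFan

/-! ### Gluing characters to invariant Cartier divisors -/

namespace ToricFan

open AffineChart SchemeDivisor AddMonoidAlgebra

variable {k : Type u} [Field k] {N : Type u} [AddCommGroup N] {Δ : ToricFan N}

lemma infIndex_le_left (σ τ : Δ.Index) : infIndex σ τ ≤ σ :=
  show σ.1 ⊓ τ.1 ≤ σ.1 from inf_le_left

lemma infIndex_le_right (σ τ : Δ.Index) : infIndex σ τ ≤ τ :=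
  show σ.1 ⊓ τ.1 ≤ τ.1 from inf_le_right

lemma coaction_single (σ : PointedCone ℝ (RealSpace N)) (m : dualMonoid σ) (r : k) :
    coaction k σ (single m r) = single m.1 1 ⊗ₜ single m r := by
  rw [coaction, AddMonoidAlgebra.lift_single]
  change r • (single m.1 1 ⊗ₜ[k] single m 1) = _
  rw [← TensorProduct.tmul_smul, AddMonoidAlgebra.smul_single, smul_eq_mul, mul_one]

variable [Module.Finite ℤ N] [Module.Free ℤ N]

/-- It presents a character as a quotient of two monomials regular on U_σ, as `IsLocalFraction`
requires. -/
lemma character_mul_toK (σ : Δ.Index) {m : Module.Dual ℤ N} (b : dualMonoid σ.1)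
    (hb : b.1 + m ∈ dualMonoid σ.1) :
    (character k Δ m : (toricVariety k Δ).functionField) *
      toK (chart k Δ σ) (single b 1 : coordRing k σ.1) =
      toK (chart k Δ σ) (single ⟨b.1 + m, hb⟩ 1 : coordRing k σ.1) := by
  have h := congrArg Units.val (character_add k (Δ := Δ) b.1 m)
  rw [character_eq_unitK k σ b, character_eq_unitK k σ ⟨b.1 + m, hb⟩] at h
  exact (mul_comm _ _).trans h.symm

/-- Characters with the same orders along the boundary divisors of `U_τ` differ by a unit on
`U_τ`. -/
lemma mk_character_eq {τ : Δ.Index} {x : toricVariety k Δ} (hx : x ∈ chartOpen k Δ τ)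
    {m m' : Module.Dual ℤ N} (h : ∀ P : BoundaryDivisor k Δ, P.1.1 ∈ chartOpen k Δ τ →
      charOrd k P.1 m = charOrd k P.1 m') :
    LocalEquation.mk x (character k Δ m) = LocalEquation.mk x (character k Δ m') := by
  have h1 : m' - m ∈ dualMonoid τ.1 := (mem_dualMonoid_iff (k := k)).2 fun P hP => by
    rw [map_sub, h P hP, sub_self]
  have h2 : -(m' - m) ∈ dualMonoid τ.1 := (mem_dualMonoid_iff (k := k)).2 fun P hP => by
    rw [map_neg, map_sub, h P hP, sub_self, neg_zero]
  have hu : IsUnit (single ⟨m' - m, h1⟩ 1 : coordRing k τ.1) := by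
    refine IsUnit.of_mul_eq_one (single ⟨_, h2⟩ 1) ?_
    rw [single_mul_single, mul_one, AddMonoidAlgebra.one_def]
    congr 1
    exact Subtype.ext (add_neg_cancel _)
  refine (QuotientGroup.eq).2 ⟨(hu.map (germ (chart k Δ τ) x hx).hom).unit, Units.ext ?_⟩
  have h3 := character_add k (Δ := Δ) m (m' - m)
  rw [add_sub_cancel] at h3
  rw [h3, inv_mul_cancel_left, character_eq_unitK k τ ⟨m' - m, h1⟩]
  exact (toK_eq x hx _).symm

/-- The Cartier divisor given on `U_σ` by a character `m σ`. -/
theorem exists_cartier_of_characters (a : BoundaryDivisor k Δ → ℤ)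
    (h : ∀ σ : Δ.Index, ∃ m, ∀ P : BoundaryDivisor k Δ, P.1.1 ∈ chartOpen k Δ σ →
      charOrd k P.1 m = a P) :
    ∃ c ∈ invariantCartier k Δ, (∀ P : BoundaryDivisor k Δ, toWeil _ c P.1 = a P) ∧
      ∀ P : PrimeDivisor (toricVariety k Δ), P.1 ∈ chartOpen k Δ (botIndex Δ) →
        toWeil _ c P = 0 := by
  choose m hm using h
  choose s hs using exists_mem_chartOpen k (Δ := Δ)
  -- Each point uses an arbitrary chart containing it. The choice does not matter: two of the
  -- characters have the same boundary orders on the chart of the intersection of their cones, hence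
  -- differ there by a unit.
  let c₀ : ∀ x : toricVariety k Δ, Additive (LocalEquation (toricVariety k Δ) x) := fun x =>
    Additive.ofMul (LocalEquation.mk x (character k Δ (m (s x))))
  have hc : ∀ σ : Δ.Index, ∀ x ∈ chartOpen k Δ σ,
      c₀ x = Additive.ofMul (LocalEquation.mk x (character k Δ (m σ))) := by
    intro σ x hx
    refine congrArg Additive.ofMul (mk_character_eq (chartOpen_inf k (hs x) hx) fun P hP => ?_)
    rw [hm _ P (chartOpen_mono k (infIndex_le_left _ _) hP),
      hm _ P (chartOpen_mono k (infIndex_le_right _ _) hP)]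
  let c : CartierDivisor (toricVariety k Δ) :=
    ⟨c₀, fun x => ⟨chartOpen k Δ (s x), hs x, character k Δ (m (s x)), fun y hy => hc _ y hy⟩⟩
  have hfrac : ∀ (σ : Δ.Index) (x) (hx : x ∈ chartOpen k Δ σ) (b : dualMonoid σ.1)
      (hb : b.1 + m σ ∈ dualMonoid σ.1), IsLocalFraction c x
        (germ (chart k Δ σ) x hx (single ⟨b.1 + m σ, hb⟩ 1 : coordRing k σ.1))
        (germ (chart k Δ σ) x hx (single b 1 : coordRing k σ.1)) := by
    intro σ x hx b hb
    refine ⟨character k Δ (m σ), hc σ x hx, fun h0 => ?_, ?_⟩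
    · have h1 := toK_eq x hx (single b 1 : coordRing k σ.1)
      rw [h0, map_zero] at h1
      exact (unitK (chart k Δ σ) (single b 1 : coordRing k σ.1) (by simp)).ne_zero h1
    · have h1 := character_mul_toK (k := k) σ b hb
      rw [toK_eq x hx, toK_eq x hx] at h1
      exact h1
  refine ⟨c, fun σ z => ?_, fun P => ?_, fun P hP => ?_⟩
  · obtain ⟨b, hb, hbm⟩ := (Δ.isCone σ.1 σ.2).exists_add_mem_dualMonoid (m σ)
    have h1 : act k Δ σ z ∈ chartOpen k Δ σ := mem_image (chart k Δ σ) _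
    have h2 : proj k Δ σ z ∈ chartOpen k Δ σ := mem_image (chart k Δ σ) _
    refine ⟨_, _, _, _, hfrac σ _ h1 ⟨b, hb⟩ hbm, hfrac σ _ h2 ⟨b, hb⟩ hbm, ?_⟩
    have e1 : ∀ r : coordRing k σ.1, ((act k Δ σ).stalkMap z).hom (germ (chart k Δ σ) _ h1 r) =
        specGerm (CommRingCat.of (torusRing k N ⊗[k] coordRing k σ.1)) z (coaction k σ.1 r) :=
      fun r => congr($(germ_stalkMap_comp (chart k Δ σ)
        (CommRingCat.ofHom (coaction k σ.1).toRingHom) (act k Δ σ) rfl z h1) r)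
    have e2 : ∀ r : coordRing k σ.1, ((proj k Δ σ).stalkMap z).hom (germ (chart k Δ σ) _ h2 r) =
        specGerm (CommRingCat.of (torusRing k N ⊗[k] coordRing k σ.1)) z (1 ⊗ₜ r) :=
      fun r => congr($(germ_stalkMap_comp (chart k Δ σ)
        (CommRingCat.ofHom (Algebra.TensorProduct.includeRight :
          coordRing k σ.1 →ₐ[k] torusRing k N ⊗[k] coordRing k σ.1).toRingHom)
          (proj k Δ σ) rfl z h2) r)
    -- The pullback of χ^m under the action is its pullback under the projection times χ^m ⊗ 1,
    -- which is invertible on T × U_σ.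
    have hu : IsUnit ((single (-m σ) 1 : torusRing k N) ⊗ₜ[k] (1 : coordRing k σ.1)) := by
      refine IsUnit.of_mul_eq_one ((single (m σ) 1 : torusRing k N) ⊗ₜ 1) ?_
      rw [Algebra.TensorProduct.tmul_mul_tmul, single_mul_single, neg_add_cancel, mul_one, mul_one,
        ← AddMonoidAlgebra.one_def, Algebra.TensorProduct.one_def]
    refine ⟨(hu.map
      (specGerm (CommRingCat.of (torusRing k N ⊗[k] coordRing k σ.1)) z).hom).unit, ?_⟩
    rw [e1, e1, e2, e2, IsUnit.unit_spec, ← map_mul, ← map_mul, ← map_mul]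
    congr 1
    rw [coaction_single, coaction_single, Algebra.TensorProduct.tmul_mul_tmul,
      Algebra.TensorProduct.tmul_mul_tmul, Algebra.TensorProduct.tmul_mul_tmul, single_mul_single,
      mul_one, mul_one, mul_one, mul_one, single_mul_single, mul_one]
    congr 2
    · change b + m σ + -m σ = b
      abel
    · rw [single_mul_single, mul_one, add_comm]
  · obtain ⟨σ, hσ⟩ := exists_mem_chartOpen k P.1.1
    rw [toWeil_eq_ordZ (hc σ _ hσ)]
    exact hm σ P hσ
  · rw [toWeil_eq_ordZ (hc _ _ hP)]
    exact charOrd_eq_zero_of_mem hP _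

end ToricFan

/-! ### Principal divisors -/

namespace SchemeDivisor

/-- The Cartier divisor of a nonzero rational function. -/
noncomputable def principal {X : Scheme.{u}} [IsIntegral X] (f : X.functionFieldˣ) :
    CartierDivisor X :=
  ⟨fun x => Additive.ofMul (LocalEquation.mk x f), fun _ => ⟨⊤, trivial, f, fun _ _ => rfl⟩⟩

lemma toWeil_principal {X : Scheme.{u}} [IsIntegral X] [IsLocallyNoetherian X]
    (f : X.functionFieldˣ) (P : PrimeDivisor X) : toWeil X (principal f) P = ordZ P f :=
  toWeil_eq_ordZ rfl

end SchemeDivisor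

/-! ### Reduction of Weil divisors to the boundary -/

namespace ToricFan

open AffineChart SchemeDivisor AddMonoidAlgebra

variable {k : Type u} [Field k] {N : Type u} [AddCommGroup N] [Module.Finite ℤ N] {Δ : ToricFan N}
  [Module.Free ℤ N]

/-- A prime divisor that meets the torus is principal there. -/
lemma exists_principal_of_mem (P : PrimeDivisor (toricVariety k Δ))
    (hP : P.1 ∈ chartOpen k Δ (botIndex Δ)) :
    ∃ f, ∀ Q : PrimeDivisor (toricVariety k Δ), Q.1 ∈ chartOpen k Δ (botIndex Δ) →
      ordZ Q f = Finsupp.single P (1 : ℤ) Q := by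
  have := torusCoordRing_ufm k Δ
  obtain ⟨y, -, hy⟩ := hP
  have hyp : (PrimeSpectrum.asIdeal y).IsPrime := PrimeSpectrum.isPrime y
  have hh := height_eq_one hy
  obtain ⟨π, hπ⟩ := UniqueFactorizationMonoid.isPrincipal_of_height_eq_one
    (R := torusCoordRing k Δ) (p := PrimeSpectrum.asIdeal y) hh
  have hspan : PrimeSpectrum.asIdeal y = Ideal.span {π} := hπ
  have hπ0 : π ≠ 0 := by
    rintro rfl
    have h0 := height_eq_one hy
    rw [hspan, Ideal.span_singleton_zero, Ideal.height_bot] at h0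
    exact zero_ne_one h0
  refine ⟨unitK (chart k Δ (botIndex Δ)) π hπ0, fun Q ⟨z, _, hz⟩ => ?_⟩
  by_cases hQP : P = Q
  · subst hQP
    rw [ordZ_unitK_eq_one hy hπ0 hspan, Finsupp.single_eq_same]
  · rw [Finsupp.single_eq_of_ne' hQP]
    refine ordZ_unitK_eq_zero hz hπ0 fun h => hQP ?_
    have hzp : (PrimeSpectrum.asIdeal z).IsPrime := PrimeSpectrum.isPrime z
    have heq : PrimeSpectrum.asIdeal y = PrimeSpectrum.asIdeal z := by
      refine MonoidFace.eq_of_le_of_height_eq_one (height_eq_one hz) ?_ ?_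
      · rw [hspan, Ideal.span_singleton_le_iff_mem]
        exact h
      · rw [hspan, Ne, Ideal.span_singleton_eq_bot]
        exact hπ0
    have hyz : y = z := PrimeSpectrum.ext heq
    exact Subtype.ext (hy.symm.trans ((congrArg _ hyz).trans hz))

variable (Δ) in
/-- The multiple `n • P₀` of a boundary divisor is on each `U_σ` the divisor of a character. -/
def IsLocallyCharacter (P₀ : BoundaryDivisor k Δ) (n : ℤ) : Prop :=
  ∀ σ : Δ.Index, ∃ m, ∀ P : BoundaryDivisor k Δ, P.1.1 ∈ chartOpen k Δ σ →
    charOrd k P.1 m = Finsupp.single P₀ n P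

lemma IsLocallyCharacter.mul {P₀ : BoundaryDivisor k Δ} {n : ℤ} (h : IsLocallyCharacter Δ P₀ n)
    (l : ℤ) : IsLocallyCharacter Δ P₀ (l * n) := fun σ => by
  obtain ⟨m, hm⟩ := h σ
  refine ⟨l • m, fun P hP => ?_⟩
  rw [map_zsmul, hm P hP, ← Finsupp.smul_apply, Finsupp.smul_single, smul_eq_mul]

/-- A multiple of a boundary divisor is trivial on the torus, so `exists_charOrd_eq_toWeil` applies
without any invariance of `c`. -/
lemma isLocallyCharacter_of_toWeil {c : CartierDivisor (toricVariety k Δ)}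
    {P₀ : BoundaryDivisor k Δ} {n : ℤ} (hc : toWeil _ c = Finsupp.single P₀.1 n) :
    IsLocallyCharacter Δ P₀ n := fun σ => by
  obtain ⟨m, hm⟩ := exists_charOrd_eq_toWeil c (fun P hP => by
    rw [hc, Finsupp.single_eq_of_ne]
    rintro rfl
    exact P₀.2 hP) σ
  refine ⟨m, fun P hP => ?_⟩
  rw [← hm P hP, hc]
  by_cases h : P₀ = P
  · rw [h, Finsupp.single_eq_same, Finsupp.single_eq_same]
  · rw [Finsupp.single_eq_of_ne' h, Finsupp.single_eq_of_ne' fun h' => h (Subtype.ext h')]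

lemma exists_invariantCartier {n : ℤ} (h : ∀ P₀ : BoundaryDivisor k Δ, IsLocallyCharacter Δ P₀ n)
    (a : BoundaryDivisor k Δ → ℤ) :
    ∃ c ∈ invariantCartier k Δ, (∀ P : BoundaryDivisor k Δ, toWeil _ c P.1 = n * a P) ∧
      ∀ P : PrimeDivisor (toricVariety k Δ), P.1 ∈ chartOpen k Δ (botIndex Δ) →
        toWeil _ c P = 0 := by
  have := finite_boundaryDivisor k Δ
  have := Fintype.ofFinite (BoundaryDivisor k Δ)
  refine exists_cartier_of_characters (fun P => n * a P) fun σ => ?_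
  choose m hm using fun P₀ => h P₀ σ
  refine ⟨∑ Q, a Q • m Q, fun P hP => ?_⟩
  rw [map_sum, Finset.sum_eq_single P]
  · rw [map_zsmul, hm P P hP, Finsupp.single_eq_same, smul_eq_mul, mul_comm]
  · intro Q _ hQ
    rw [map_zsmul, hm Q P hP, Finsupp.single_eq_of_ne' hQ, smul_zero]
  · exact fun h => absurd (Finset.mem_univ P) h

/-- All multiples by `n` of Weil divisors are Cartier if this is the case for the boundary
divisors. -/
theorem exists_toWeil_eq_mul {n : ℤ} (h : ∀ P₀ : BoundaryDivisor k Δ, IsLocallyCharacter Δ P₀ n)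
    (D : WeilDivisor (toricVariety k Δ)) :
    ∃ c : CartierDivisor (toricVariety k Δ), ∀ P, toWeil _ c P = n * D P := by
  classical
  choose f hf using exists_principal_of_mem (k := k) (Δ := Δ)
  -- Only the components that meet the torus are made principal; boundary components get the value 0
  -- and are left to `c₂`.
  let g : PrimeDivisor (toricVariety k Δ) → CartierDivisor (toricVariety k Δ) := fun P =>
    if hP : P.1 ∈ chartOpen k Δ (botIndex Δ) then principal (f P hP) else 0
  let c₁ : CartierDivisor (toricVariety k Δ) := D.sum fun P d => d • g P
  have hc₁ : ∀ P : PrimeDivisor (toricVariety k Δ), P.1 ∈ chartOpen k Δ (botIndex Δ) →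
      toWeil _ c₁ P = D P := by
    intro P hP
    have h1 : toWeil _ c₁ P = D.sum fun Q d => d * toWeil _ (g Q) P := by
      simp only [c₁, Finsupp.sum]
      rw [map_sum, Finset.sum_apply]
      exact Finset.sum_congr rfl fun Q _ => by rw [map_zsmul]; rfl
    rw [h1, Finsupp.sum, Finset.sum_eq_single P]
    · simp only [g, dif_pos hP]
      rw [toWeil_principal, hf P hP P hP, Finsupp.single_eq_same, mul_one]
    · intro Q _ hQ
      simp only [g]
      split_ifs with hQ'
      · rw [toWeil_principal, hf Q hQ' P hP, Finsupp.single_eq_of_ne' hQ, mul_zero]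
      · rw [map_zero, Pi.zero_apply, mul_zero]
    · intro h0
      rw [Finsupp.notMem_support_iff.1 h0, zero_mul]
  -- The divisor `c₁` agrees with `D` on the torus but has uncontrolled multiplicities on the
  -- boundary. Its `n`-th multiple is corrected there by `c₂`, which is trivial on the torus.
  obtain ⟨c₂, -, hb, ht⟩ := exists_invariantCartier h fun P => D P.1 - toWeil _ c₁ P.1
  refine ⟨n • c₁ + c₂, fun P => ?_⟩
  rw [map_add, map_zsmul, Pi.add_apply, Pi.smul_apply, smul_eq_mul]
  by_cases hP : P.1 ∈ chartOpen k Δ (botIndex Δ)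
  · rw [hc₁ P hP, ht P hP, add_zero]
  · rw [hb ⟨P, hP⟩]
    ring

end ToricFan

/-! ### Torus-stable prime divisors are the boundary divisors -/

namespace ToricFan

open AffineChart SchemeDivisor AddMonoidAlgebra

variable {k : Type u} [Field k] {N : Type u} [AddCommGroup N] {Δ : ToricFan N}

/-- The coaction multiplies 1 ⊗ χ^m by the unit χ^m ⊗ 1. Hence closed sets cut out by monomials are
stable. -/
lemma coaction_single_mem_iff (σ : PointedCone ℝ (RealSpace N)) (m : dualMonoid σ)
    (I : Ideal (torusRing k N ⊗[k] coordRing k σ)) :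
    coaction k σ (single m 1) ∈ I ↔ (1 ⊗ₜ single m 1 : torusRing k N ⊗[k] coordRing k σ) ∈ I := by
  have h : coaction k σ (single m 1) =
      ((single m.1 1 : torusRing k N) ⊗ₜ[k] (1 : coordRing k σ)) * (1 ⊗ₜ single m 1) := by
    rw [coaction_single, Algebra.TensorProduct.tmul_mul_tmul, mul_one, one_mul]
  have hu : IsUnit ((single m.1 1 : torusRing k N) ⊗ₜ[k] (1 : coordRing k σ)) := by
    refine IsUnit.of_mul_eq_one ((single (-m.1) 1 : torusRing k N) ⊗ₜ 1) ?_
    rw [Algebra.TensorProduct.tmul_mul_tmul, single_mul_single, add_neg_cancel, mul_one, mul_one,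
      ← AddMonoidAlgebra.one_def, Algebra.TensorProduct.one_def]
  rw [h]
  exact Ideal.unit_mul_mem_iff_mem I hu

variable [Module.Finite ℤ N]

lemma chart_mem_closure_iff {σ : Δ.Index} (x : toricVariety k Δ)
    (z : Spec (CommRingCat.of (coordRing k σ.1))) :
    chart k Δ σ z ∈ closure {x} ↔ ∃ y, chart k Δ σ y = x ∧ y.asIdeal ≤ z.asIdeal := by
  rw [← specializes_iff_mem_closure]
  constructor
  · intro h
    obtain ⟨y, -, rfl⟩ := h.mem_open (chartOpen k Δ σ).isOpen (mem_image _ z)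
    refine ⟨y, rfl, ?_⟩
    have := (chart k Δ σ).isOpenEmbedding.isInducing.specializes_iff.1 h
    exact (PrimeSpectrum.le_iff_specializes (R := coordRing k σ.1) y z).2 this
  · rintro ⟨y, rfl, h⟩
    exact ((PrimeSpectrum.le_iff_specializes (R := coordRing k σ.1) y z).1 h).map
      (chart k Δ σ).continuous

variable (k Δ) in
/-- The restriction of functions from `T × T` to `T × {1}`. -/
noncomputable def restrictOne :
    torusRing k N ⊗[k] torusCoordRing k Δ →ₐ[k] torusCoordRing k Δ :=
  Algebra.TensorProduct.lift
    (AddMonoidAlgebra.lift k (torusCoordRing k Δ) (Module.Dual ℤ N)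
      { toFun := fun m => single ⟨m.toAdd, mem_dualMonoid_bot _⟩ 1
        map_one' := rfl
        map_mul' := fun a b => by
          rw [single_mul_single, mul_one]
          rfl })
    (AddMonoidAlgebra.lift k (torusCoordRing k Δ) (dualMonoid (botIndex Δ).1) 1)
    fun _ _ => Commute.all _ _

/-- Acting on the identity of the torus by `t` gives `t`; the projection, in contrast, is constant
on T × {1}. -/
lemma restrictOne_coaction (f : torusCoordRing k Δ) :
    restrictOne k Δ (coaction k (botIndex Δ).1 f) = f := by
  induction f using AddMonoidAlgebra.induction_linear with
  | zero => rw [map_zero, map_zero]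
  | add f g hf hg => rw [map_add, map_add, hf, hg]
  | single m a =>
    rw [coaction_single, restrictOne, Algebra.TensorProduct.lift_tmul,
      AddMonoidAlgebra.lift_single, AddMonoidAlgebra.lift_single, one_smul]
    change single _ 1 * a • (1 : torusCoordRing k Δ) = _
    rw [mul_smul_comm, mul_one, AddMonoidAlgebra.smul_single, smul_eq_mul, mul_one]
    rfl

/-- The evaluation of functions at the identity of the torus. -/
lemma exists_restrictOne_tmul (f : torusCoordRing k Δ) :
    ∃ a : k, restrictOne k Δ (1 ⊗ₜ f) = algebraMap k _ a := by
  induction f using AddMonoidAlgebra.induction_linear with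
  | zero => exact ⟨0, by simp⟩
  | add f g hf hg =>
    obtain ⟨a, ha⟩ := hf
    obtain ⟨b, hb⟩ := hg
    exact ⟨a + b, by rw [TensorProduct.tmul_add, map_add, map_add, ha, hb]⟩
  | single m a =>
    refine ⟨a, ?_⟩
    rw [restrictOne, Algebra.TensorProduct.lift_tmul, map_one, one_mul,
      AddMonoidAlgebra.lift_single, Algebra.algebraMap_eq_smul_one]
    rfl

variable [Module.Free ℤ N]

lemma BoundaryDivisor.asIdeal_le_iff (P : BoundaryDivisor k Δ) {σ : Δ.Index}
    {y : Spec (CommRingCat.of (coordRing k σ.1))} (hy : chart k Δ σ y = P.1.1)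
    (q : Ideal (coordRing k σ.1)) : y.asIdeal ≤ q ↔
      ∀ m, (single m 1 : coordRing k σ.1) ∈ y.asIdeal → (single m 1 : coordRing k σ.1) ∈ q := by
  refine ⟨fun h m hm => h hm, fun h f hf => ?_⟩
  exact MonoidFace.mem_of_support fun m hm => h m ((mem_asIdeal_iff P hy f).1 hf m hm)

theorem BoundaryDivisor.preimage_closure_eq (P : BoundaryDivisor k Δ) (σ : Δ.Index) :
    act k Δ σ ⁻¹' closure {P.1.1} = proj k Δ σ ⁻¹' closure {P.1.1} := by
  ext z
  refine (chart_mem_closure_iff P.1.1 _).trans (Iff.trans ?_ (chart_mem_closure_iff P.1.1 _).symm)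
  refine exists_congr fun y => and_congr_right fun hy => ?_
  refine (P.asIdeal_le_iff hy _).trans (Iff.trans ?_ (P.asIdeal_le_iff hy _).symm)
  exact forall_congr' fun m => imp_congr_right fun _ => coaction_single_mem_iff σ.1 m z.asIdeal

/-- A prime divisor that meets the torus is not stable under the torus. -/
theorem notMem_of_preimage_closure_eq (P : PrimeDivisor (toricVariety k Δ))
    (h : act k Δ (botIndex Δ) ⁻¹' closure {P.1} = proj k Δ (botIndex Δ) ⁻¹' closure {P.1}) :
    P.1 ∉ chartOpen k Δ (botIndex Δ) := by
  rintro ⟨y, -, hy⟩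
  have hyp : (PrimeSpectrum.asIdeal y).IsPrime := PrimeSpectrum.isPrime y
  -- the points `(w, 1)`
  have key : ∀ w : PrimeSpectrum (torusCoordRing k Δ), PrimeSpectrum.asIdeal y ≤ w.asIdeal ↔
      PrimeSpectrum.asIdeal y ≤ w.asIdeal.comap ((restrictOne k Δ).comp
        (Algebra.TensorProduct.includeRight : torusCoordRing k Δ →ₐ[k] _)) := by
    intro w
    let z : torusProd k Δ (botIndex Δ) := PrimeSpectrum.comap (restrictOne k Δ).toRingHom w
    have h1 := Set.ext_iff.1 h z
    have h2 := (chart_mem_closure_iff P.1 _).symm.trans (h1.trans (chart_mem_closure_iff P.1 _))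
    have hex : ∀ q : Ideal (torusCoordRing k Δ), (∃ y', chart k Δ (botIndex Δ) y' = P.1 ∧
        PrimeSpectrum.asIdeal y' ≤ q) ↔ PrimeSpectrum.asIdeal y ≤ q := fun q =>
      ⟨fun ⟨y', hy', hq⟩ => by
        have : y' = y := (chart k Δ (botIndex Δ)).isOpenEmbedding.injective (hy'.trans hy.symm)
        rwa [← this], fun hq => ⟨y, hy, hq⟩⟩
    have h3 := (hex _).symm.trans (h2.trans (hex _))
    have h4 : (Spec.map (CommRingCat.ofHom (coaction k (botIndex Δ).1).toRingHom) z).asIdeal =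
        w.asIdeal := Ideal.ext fun f => by
      change restrictOne k Δ (coaction k (botIndex Δ).1 f) ∈ w.asIdeal ↔ _
      rw [restrictOne_coaction]
    exact (iff_of_eq (congrArg (PrimeSpectrum.asIdeal y ≤ ·) h4)).symm.trans h3
  -- Taking `w` to be `y` shows that a stable divisor meeting the torus contains the identity: the
  -- value there of each equation `f` is a constant in a proper ideal, hence 0. Then the condition
  -- on the right of `key` holds for the generic point as well, which makes the divisor the whole
  -- torus.
  have h0 : PrimeSpectrum.asIdeal y ≤ ⊥ := by
    refine (key ⊥).2 fun f hf => ?_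
    have h1 : restrictOne k Δ (1 ⊗ₜ f) ∈ PrimeSpectrum.asIdeal y := (key y).1 le_rfl hf
    obtain ⟨a, ha⟩ := exists_restrictOne_tmul f
    change restrictOne k Δ (1 ⊗ₜ f) ∈ (⊥ : Ideal (torusCoordRing k Δ))
    rw [ha] at h1 ⊢
    by_cases ha0 : a = 0
    · rw [ha0, map_zero]
      exact zero_mem _
    · exact absurd (Ideal.eq_top_of_isUnit_mem _ h1 ((IsUnit.mk0 a ha0).map _)) hyp.ne_top
  have h1 := height_eq_one hy
  rw [le_bot_iff.1 h0, Ideal.height_bot] at h1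
  exact zero_ne_one h1

end ToricFan

/-! ### The cokernel G and the Cartier conditions -/

namespace ToricFan

open SchemeDivisor

variable {k : Type u} [Field k] {N : Type u} [AddCommGroup N] [Module.Finite ℤ N] {Δ : ToricFan N}

lemma invariantWeil_apply (D : InvariantPrimeDivisor k Δ →₀ ℤ) (P : InvariantPrimeDivisor k Δ) :
    invariantWeil k Δ D P.1 = D P :=
  Finsupp.mapDomain_apply Subtype.val_injective D P

variable [Module.Free ℤ N]

/-- The invariant prime divisors are those that do not meet the torus. -/
def InvariantPrimeDivisor.toBoundary (P : InvariantPrimeDivisor k Δ) : BoundaryDivisor k Δ :=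
  ⟨P.1, notMem_of_preimage_closure_eq P.1 (P.2 _)⟩

/-- Prime divisors that do not meet the torus are invariant. -/
def BoundaryDivisor.toInvariant (P : BoundaryDivisor k Δ) : InvariantPrimeDivisor k Δ :=
  ⟨P.1, P.preimage_closure_eq⟩

lemma finite_invariantPrimeDivisor : Finite (InvariantPrimeDivisor k Δ) :=
  have := finite_boundaryDivisor k Δ
  Finite.of_injective InvariantPrimeDivisor.toBoundary fun _ _ h =>
    Subtype.ext (congrArg (fun R : BoundaryDivisor k Δ => R.1) h)

lemma invariantWeil_apply_of_mem (D : InvariantPrimeDivisor k Δ →₀ ℤ)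
    (P : PrimeDivisor (toricVariety k Δ)) (hP : P.1 ∈ chartOpen k Δ (botIndex Δ)) :
    invariantWeil k Δ D P = 0 := by
  refine Finsupp.mapDomain_of_notMem_range D P ?_
  rintro ⟨Q, rfl⟩
  exact Q.toBoundary.2 hP

lemma invariantWeil_single (P : BoundaryDivisor k Δ) (n : ℤ) :
    invariantWeil k Δ (Finsupp.single P.toInvariant n) = Finsupp.single P.1 n :=
  congrArg DFunLike.coe (Finsupp.mapDomain_single (f := fun P : InvariantPrimeDivisor k Δ => P.1))

lemma isLocallyCharacter_of_mk_eq_zero {P : BoundaryDivisor k Δ} {n : ℤ}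
    (h : (QuotientAddGroup.mk (Finsupp.single P.toInvariant n) : divisorCokernel k Δ) = 0) :
    IsLocallyCharacter Δ P n := by
  obtain ⟨c, -, hc⟩ := (QuotientAddGroup.eq_zero_iff _).1 h
  exact isLocallyCharacter_of_toWeil (hc.trans (invariantWeil_single P n))

lemma zsmul_divisorCokernel {n : ℤ} (h : ∀ P : BoundaryDivisor k Δ, IsLocallyCharacter Δ P n)
    (x : divisorCokernel k Δ) : n • x = 0 := by
  obtain ⟨D, rfl⟩ := QuotientAddGroup.mk_surjective x
  obtain ⟨c, hc, hb, ht⟩ := exists_invariantCartier h fun P => D P.toInvariant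
  refine (QuotientAddGroup.eq_zero_iff (n • D)).2 ⟨c, hc, funext fun P => ?_⟩
  by_cases hP : P.1 ∈ chartOpen k Δ (botIndex Δ)
  · rw [ht P hP, invariantWeil_apply_of_mem _ P hP]
  · exact (hb ⟨P, hP⟩).trans
      (invariantWeil_apply (n • D) (BoundaryDivisor.toInvariant ⟨P, hP⟩)).symm

/-- If G is finite, its order kills the class of each boundary divisor. Conversely G is finitely
generated, and such an `n` makes it torsion. -/
theorem finite_divisorCokernel_iff : Finite (divisorCokernel k Δ) ↔
    ∃ n : ℕ, 0 < n ∧ ∀ P : BoundaryDivisor k Δ, IsLocallyCharacter Δ P n := by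
  constructor
  · intro hfin
    refine ⟨Nat.card (divisorCokernel k Δ), Nat.card_pos, fun P => ?_⟩
    refine isLocallyCharacter_of_mk_eq_zero ?_
    have h1 := card_nsmul_eq_zero' (x := (QuotientAddGroup.mk (Finsupp.single P.toInvariant 1) :
      divisorCokernel k Δ))
    rw [← QuotientAddGroup.mk_nsmul, Finsupp.smul_single, nsmul_eq_mul, mul_one] at h1
    exact h1
  · rintro ⟨n, hn, h⟩
    have := finite_invariantPrimeDivisor (k := k) (Δ := Δ)
    have : Module.Finite ℤ (divisorCokernel k Δ) := Module.Finite.of_surjective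
      (QuotientAddGroup.mk' _).toIntLinearMap (QuotientAddGroup.mk'_surjective _)
    refine Module.finite_of_fg_torsion _ fun {x} => ?_
    exact ⟨⟨n, mem_nonZeroDivisors_iff_ne_zero.2 (by exact_mod_cast hn.ne')⟩,
      zsmul_divisorCokernel h x⟩

theorem subsingleton_divisorCokernel_iff : Subsingleton (divisorCokernel k Δ) ↔
    ∀ P : BoundaryDivisor k Δ, IsLocallyCharacter Δ P 1 := by
  constructor
  · exact fun _ P => isLocallyCharacter_of_mk_eq_zero (Subsingleton.elim _ _)
  · intro h
    exact subsingleton_of_forall_eq 0 fun x => by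
      have := zsmul_divisorCokernel h x
      rwa [one_smul] at this

theorem forall_isCartier_iff : (∀ D : WeilDivisor (toricVariety k Δ), IsCartier D) ↔
    ∀ P : BoundaryDivisor k Δ, IsLocallyCharacter Δ P 1 := by
  constructor
  · intro h P
    obtain ⟨c, hc⟩ := h (Finsupp.single P.1 1)
    exact isLocallyCharacter_of_toWeil hc
  · intro h D
    obtain ⟨c, hc⟩ := exists_toWeil_eq_mul h D
    exact ⟨c, funext fun P => by rw [hc, one_mul]⟩

/-- There are finitely many boundary divisors, so the product of their individual multiples serves
all of them. -/
theorem forall_isQCartier_iff : (∀ D : WeilDivisor (toricVariety k Δ), IsQCartier D) ↔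
    ∃ n : ℕ, 0 < n ∧ ∀ P : BoundaryDivisor k Δ, IsLocallyCharacter Δ P n := by
  classical
  constructor
  · intro h
    have := finite_boundaryDivisor k Δ
    have := Fintype.ofFinite (BoundaryDivisor k Δ)
    have h1 : ∀ P : BoundaryDivisor k Δ, ∃ n : ℕ, 0 < n ∧ IsLocallyCharacter Δ P n := fun P => by
      obtain ⟨n, hn, c, hc⟩ := h (Finsupp.single P.1 1)
      rw [Finsupp.smul_single, nsmul_eq_mul, mul_one] at hc
      exact ⟨n, hn, isLocallyCharacter_of_toWeil hc⟩
    choose n hn hl using h1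
    refine ⟨∏ P, n P, Finset.prod_pos fun P _ => hn P, fun P => ?_⟩
    rw [← Finset.prod_erase_mul _ _ (Finset.mem_univ P), Nat.cast_mul]
    exact (hl P).mul _
  · rintro ⟨n, hn, h⟩ D
    obtain ⟨c, hc⟩ := exists_toWeil_eq_mul h D
    exact ⟨n, hn, c, funext fun P => by rw [hc, Finsupp.smul_apply, nsmul_eq_mul]⟩

end ToricFan

/-! ### Simplicial cones -/

namespace ToricFan

variable {N : Type u} [AddCommGroup N]

lemma baseChange_tmul (m : Module.Dual ℤ N) (r : ℝ) (v : N) :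
    Module.Dual.baseChange ℝ m (r ⊗ₜ v) = r * m v := by
  simp [Module.Dual.baseChange, mul_comm]

/-- The values of integral forms at a real vector. -/
noncomputable def baseChangeHom (v : RealSpace N) : Module.Dual ℤ N →+ ℝ :=
  AddMonoidHom.mk' (fun m => Module.Dual.baseChange ℝ m v) fun a b => baseChange_add a b v

lemma linearIndependent_of_dual {R : Type*} {v : R → N} {m : R → Module.Dual ℤ N} {n : ℤ}
    (hn : n ≠ 0) (hm : ∀ P Q, m P (v Q) = Finsupp.single P n Q) :
    LinearIndependent ℝ fun P => (1 : ℝ) ⊗ₜ[ℤ] v P := by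
  rw [linearIndependent_iff]
  intro c hc
  ext Q
  have h := congrArg (Module.Dual.baseChange ℝ (m Q)) hc
  rw [Finsupp.linearCombination_apply, Finsupp.sum, map_sum, map_zero,
    Finset.sum_eq_single Q] at h
  · rw [map_smul, baseChange_tmul, hm, Finsupp.single_eq_same, one_mul, smul_eq_mul] at h
    exact (mul_eq_zero.1 h).resolve_right (by exact_mod_cast hn)
  · intro P _ hP
    rw [map_smul, baseChange_tmul, hm, Finsupp.single_eq_of_ne hP]
    simp
  · intro h0
    rw [Finsupp.notMem_support_iff.1 h0, zero_smul, map_zero]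

/-- If the dual monoid of a cone is cut out by lattice vectors `v P` which have a dual system up
to a factor, then the cone is simplicial. -/
theorem isSimplicial_of_dual [Module.Free ℤ N] {σ : PointedCone ℝ (RealSpace N)}
    (hσ : IsStronglyConvexRational σ)
    {R : Type*} [Finite R] {v : R → N} {m : R → Module.Dual ℤ N} {n : ℤ} (hn : 0 < n)
    (hm : ∀ P Q, m P (v Q) = Finsupp.single P n Q)
    (hmem : ∀ l, l ∈ dualMonoid σ ↔ ∀ P, 0 ≤ l (v P)) : PointedCone.IsSimplicial σ := by
  classical
  have := Fintype.ofFinite R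
  obtain ⟨t, ht⟩ := hσ.rational
  have htσ : ∀ x ∈ t, (1 : ℝ) ⊗ₜ[ℤ] x ∈ σ := fun x hx => by
    rw [ht]; exact Submodule.subset_span ⟨x, hx, rfl⟩
  have hpos : ∀ l ∈ dualMonoid σ, ∀ x ∈ t, 0 ≤ l x := fun l hl x hx => by
    have := hl _ (htσ x hx)
    rw [baseChange_tmul, one_mul] at this
    exact_mod_cast this
  have hmS : ∀ P, m P ∈ dualMonoid σ := fun P => (hmem _).2 fun Q => by
    rw [hm]
    by_cases h : P = Q
    · rw [h, Finsupp.single_eq_same]; exact hn.le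
    · rw [Finsupp.single_eq_of_ne' h]
  have hsum : ∀ (c : R → ℤ) (Q : R), (∑ P, c P • m P) (v Q) = c Q * n := fun c Q => by
    rw [LinearMap.sum_apply, Finset.sum_eq_single Q]
    · rw [LinearMap.smul_apply, hm, Finsupp.single_eq_same, smul_eq_mul]
    · intro P _ hP
      rw [LinearMap.smul_apply, hm, Finsupp.single_eq_of_ne' hP, smul_zero]
    · exact fun h => absurd (Finset.mem_univ _) h
  -- the expansion of the generators
  have hexp : ∀ x ∈ t, n • x = ∑ P, m P x • v P := by
    intro x hx
    rw [← sub_eq_zero, ← Module.forall_dual_apply_eq_zero_iff ℤ]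
    intro l
    -- A form vanishing on all `v Q` lies in S_σ together with its negative, so it vanishes on the
    -- generators of σ.
    have h0 : ∀ Q, (n • l - ∑ P, l (v P) • m P) (v Q) = 0 := fun Q => by
      rw [LinearMap.sub_apply, hsum, LinearMap.smul_apply, smul_eq_mul, mul_comm, sub_self]
    have h1 := hpos _ ((hmem _).2 fun Q => (h0 Q).ge) x hx
    have h2 := hpos (-(n • l - ∑ P, l (v P) • m P)) ((hmem _).2 fun Q => by
      rw [LinearMap.neg_apply, h0, neg_zero]) x hx
    rw [LinearMap.neg_apply] at h2
    have h3 : (n • l - ∑ P, l (v P) • m P) x = 0 := by omega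
    rw [LinearMap.sub_apply, LinearMap.sum_apply, LinearMap.smul_apply] at h3
    rw [map_sub, map_sum, map_zsmul]
    convert! h3 using 3 with P
    rw [map_zsmul, LinearMap.smul_apply, smul_eq_mul, smul_eq_mul, mul_comm]
  have hexpR : ∀ x ∈ t, (n : ℝ) • ((1 : ℝ) ⊗ₜ[ℤ] x) = ∑ P, (m P x : ℝ) • ((1 : ℝ) ⊗ₜ[ℤ] v P) := by
    intro x hx
    have h := congrArg (fun y => (1 : ℝ) ⊗ₜ[ℤ] y) (hexp x hx)
    simp only [TensorProduct.tmul_sum, TensorProduct.tmul_smul] at h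
    simpa only [Int.cast_smul_eq_zsmul] using h
  have hnR : (0 : ℝ) < n := by exact_mod_cast hn
  refine ⟨Set.range fun P => (1 : ℝ) ⊗ₜ[ℤ] v P, Set.finite_range _,
    (linearIndependent_of_dual hn.ne' hm).linearIndepOn_id, le_antisymm ?_ ?_⟩
  · refine Submodule.span_le.2 ?_
    rintro _ ⟨Q, rfl⟩
    have hx : ∃ x ∈ t, (∀ P, P ≠ Q → m P x = 0) ∧ 0 < m Q x := by
      by_contra! hno
      -- To see that `v Q` lies in σ, a generator on its ray is produced. If there were none, the
      -- form -m_Q + K·∑_{P ≠ Q} m_P would be nonnegative on all generators, because `K` bounds each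
      -- value of m_Q and some other m_P is at least 1 whenever m_Q is positive. But it takes the
      -- value -n at `v Q`.
      let K : ℤ := ∑ x ∈ t, m Q x
      have hl : (∑ P, (if P = Q then -1 else K) • m P) ∈ dualMonoid σ := by
        rw [ht, mem_dualMonoid_hull]
        intro x hx
        have hKx : m Q x ≤ K := Finset.single_le_sum (fun y hy => hpos _ (hmS Q) y hy) hx
        have hK : 0 ≤ K := Finset.sum_nonneg fun y hy => hpos _ (hmS Q) y hy
        have hterm : ∀ P ∈ Finset.univ.erase Q,
            0 ≤ ((if P = Q then -1 else K) • m P) x := fun P hP => by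
          rw [if_neg (Finset.ne_of_mem_erase hP), LinearMap.smul_apply]
          exact mul_nonneg hK (hpos _ (hmS P) x hx)
        rw [LinearMap.sum_apply, ← Finset.add_sum_erase _ _ (Finset.mem_univ Q), if_pos rfl,
          LinearMap.smul_apply, smul_eq_mul]
        by_cases h0 : m Q x ≤ 0
        · have := Finset.sum_nonneg hterm
          omega
        · obtain ⟨P, hP, hPx⟩ : ∃ P, P ≠ Q ∧ m P x ≠ 0 := by
            by_contra! h
            exact h0 (hno x hx h)
          have h1 := Finset.single_le_sum hterm (Finset.mem_erase.2 ⟨hP, Finset.mem_univ P⟩)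
          rw [if_neg hP, LinearMap.smul_apply, smul_eq_mul] at h1
          have h2 := hpos _ (hmS P) x hx
          have h3 : K * 1 ≤ K * m P x := mul_le_mul_of_nonneg_left (by omega) hK
          omega
      have h1 := (hmem _).1 hl Q
      rw [hsum, if_pos rfl] at h1
      omega
    obtain ⟨x, hx, h0, hpos'⟩ := hx
    have h1 := hexpR x hx
    rw [Finset.sum_eq_single Q (fun P _ hP => by rw [h0 P hP, Int.cast_zero, zero_smul])
      (fun h => absurd (Finset.mem_univ _) h)] at h1
    have hq : (0 : ℝ) < m Q x := by exact_mod_cast hpos'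
    have h2 : (1 : ℝ) ⊗ₜ[ℤ] v Q = ((n : ℝ) / m Q x) • ((1 : ℝ) ⊗ₜ[ℤ] x) := by
      rw [div_eq_inv_mul, mul_smul, h1, inv_smul_smul₀ hq.ne']
    change (1 : ℝ) ⊗ₜ[ℤ] v Q ∈ σ
    rw [h2]
    exact Submodule.smul_mem σ (⟨(n : ℝ) / m Q x, (div_pos hnR hq).le⟩ : {c : ℝ // 0 ≤ c})
      (htσ x hx)
  · rw [ht]
    refine Submodule.span_le.2 ?_
    rintro _ ⟨x, hx, rfl⟩
    have h2 : (1 : ℝ) ⊗ₜ[ℤ] x = ∑ P, ((m P x : ℝ) / n) • ((1 : ℝ) ⊗ₜ[ℤ] v P) := by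
      have h1 := congrArg ((n : ℝ)⁻¹ • ·) (hexpR x hx)
      simp only [inv_smul_smul₀ hnR.ne', Finset.smul_sum, smul_smul] at h1
      rw [h1]
      exact Finset.sum_congr rfl fun P _ => by rw [div_eq_inv_mul]
    change (1 : ℝ) ⊗ₜ[ℤ] x ∈ _
    rw [h2]
    refine Submodule.sum_mem _ fun P _ => ?_
    exact Submodule.smul_mem _ (⟨(m P x : ℝ) / n, div_nonneg
      (by exact_mod_cast hpos _ (hmS P) x hx) hnR.le⟩ : {c : ℝ // 0 ≤ c})
      (Submodule.subset_span ⟨P, rfl⟩)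

/-- The opposite facets of the generators of a simplicial cone are cut out by integral forms. -/
lemma exists_int_of_isSimplicial [Module.Finite ℤ N] {σ : PointedCone ℝ (RealSpace N)}
    (hσ : IsStronglyConvexRational σ) {s : Set (RealSpace N)} (hs : LinearIndepOn ℝ id s)
    (hull : PointedCone.hull ℝ s = σ) {w : RealSpace N} (hw : w ∈ s) :
    ∃ m ∈ dualMonoid σ, 0 < Module.Dual.baseChange ℝ m w ∧
      ∀ w' ∈ s, w' ≠ w → Module.Dual.baseChange ℝ m w' = 0 := by
  classical
  have hsσ : ∀ x ∈ s, x ∈ σ := fun x hx => hull ▸ Submodule.subset_span hx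
  let b := Module.Basis.extend hs
  let i : s → hs.extend (Set.subset_univ s) := Set.inclusion (hs.subset_extend _)
  have hb : ∀ x : s, b (i x) = x := fun x => Module.Basis.extend_apply_self hs _
  let f : Module.Dual ℝ (RealSpace N) := b.coord (i ⟨w, hw⟩)
  have hfw : f w = 1 := by
    refine (congrArg f (hb ⟨w, hw⟩)).symm.trans ?_
    rw [Module.Basis.coord_apply, Module.Basis.repr_self, Finsupp.single_eq_same]
  have hfw' : ∀ x ∈ s, x ≠ w → f x = 0 := fun x hx hne => by
    refine (congrArg f (hb ⟨x, hx⟩)).symm.trans ?_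
    rw [Module.Basis.coord_apply, Module.Basis.repr_self, Finsupp.single_eq_of_ne']
    intro h
    exact hne (congrArg (fun y : hs.extend (Set.subset_univ s) => y.1) h)
  have hfσ : ∀ v ∈ σ, 0 ≤ f v := by
    intro v hv
    rw [← hull] at hv
    induction hv using Submodule.span_induction with
    | mem v hv =>
      by_cases h : v = w
      · rw [h, hfw]; exact zero_le_one
      · rw [hfw' v hv h]
    | zero => rw [map_zero]
    | add x y _ _ hx hy => rw [map_add]; exact add_nonneg hx hy
    | smul c x _ hx =>
      rw [Nonneg.mk_smul c.1 c.2 x, map_smul]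
      exact mul_nonneg c.2 hx
  -- The real coordinate `f` cuts out a facet, and a face of a rational cone is also cut out by an
  -- integral form.
  let τ : PointedCone ℝ (RealSpace N) :=
    { carrier := {v | v ∈ σ ∧ f v = 0}
      zero_mem' := ⟨σ.zero_mem, map_zero _⟩
      add_mem' := fun {a b} ha hb => ⟨σ.add_mem ha.1 hb.1, by rw [map_add, ha.2, hb.2, add_zero]⟩
      smul_mem' := fun c x hx => ⟨Submodule.smul_mem σ c hx.1, by
        rw [Nonneg.mk_smul c.1 c.2 x, map_smul, hx.2, smul_zero]⟩ }
  obtain ⟨m, hmσ, hm⟩ := IsFace.exists_int (τ := τ) ⟨f, hfσ, fun v => Iff.rfl⟩ hσ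
  refine ⟨m, hmσ, lt_of_le_of_ne (hmσ w (hsσ w hw)) fun h => ?_, fun x hx hne => ?_⟩
  · have := ((hm w).2 ⟨hsσ w hw, h.symm⟩).2
    rw [hfw] at this
    exact one_ne_zero this
  · exact ((hm x).1 ⟨hsσ x hx, hfw' x hx hne⟩).2

section

open AffineChart SchemeDivisor AddMonoidAlgebra

variable [Module.Free ℤ N] [Module.Finite ℤ N] {k : Type u} [Field k] {Δ : ToricFan N}

/-- A boundary divisor of a simplicial chart lies over a generator of the cone. -/
lemma BoundaryDivisor.exists_generator {σ : Δ.Index} {s : Set (RealSpace N)} (hfin : s.Finite)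
    (hs : LinearIndepOn ℝ id s) (hull : PointedCone.hull ℝ s = σ.1) (P : BoundaryDivisor k Δ)
    (hP : P.1.1 ∈ chartOpen k Δ σ) :
    ∃ w ∈ s, ∀ m ∈ dualMonoid σ.1, 0 < charOrd k P.1 m ↔ 0 < Module.Dual.baseChange ℝ m w := by
  classical
  have hsσ : ∀ x ∈ s, x ∈ σ.1 := fun x hx => hull ▸ Submodule.subset_span hx
  have hdual : ∀ m : Module.Dual ℤ N, (∀ w ∈ s, 0 ≤ Module.Dual.baseChange ℝ m w) →
      m ∈ dualMonoid σ.1 := by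
    intro m hm v hv
    rw [← hull] at hv
    induction hv using Submodule.span_induction with
    | mem v hv => exact hm v hv
    | zero => rw [map_zero]
    | add x y _ _ hx hy => rw [map_add]; exact add_nonneg hx hy
    | smul c x _ hx =>
      rw [Nonneg.mk_smul c.1 c.2 x, map_smul]
      exact mul_nonneg c.2 hx
  -- Otherwise each generator `w` has a form `g w` in S_σ that is positive at `w` and of order at
  -- most 0. A combination of these dominates any `m` in S_σ on all generators, so no `m` has
  -- positive order, which is impossible for a boundary divisor.
  obtain ⟨w, hw, hle⟩ : ∃ w ∈ s, ∀ m ∈ dualMonoid σ.1, 0 < Module.Dual.baseChange ℝ m w →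
      0 < charOrd k P.1 m := by
    by_contra! hno
    choose! g hg hgw hgP using hno
    obtain ⟨m, hm, hpos⟩ := exists_charOrd_pos P hP
    have hlarge : ∀ w ∈ s, ∃ K : ℕ, Module.Dual.baseChange ℝ m w ≤
        K * Module.Dual.baseChange ℝ (g w) w := fun w hw => by
      obtain ⟨K, hK⟩ := exists_nat_ge (Module.Dual.baseChange ℝ m w /
        Module.Dual.baseChange ℝ (g w) w)
      exact ⟨K, (div_le_iff₀ (hgw w hw)).1 hK⟩
    choose! K hK using hlarge
    have hl : (∑ w ∈ hfin.toFinset, K w • g w) - m ∈ dualMonoid σ.1 := by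
      refine hdual _ fun w hw => ?_
      have h1 : ∀ v ∈ hfin.toFinset, 0 ≤ baseChangeHom w (K v • g v) := fun v hv => by
        rw [map_nsmul]
        exact nsmul_nonneg (hg v (hfin.mem_toFinset.1 hv) w (hsσ w hw)) _
      have h2 := Finset.single_le_sum h1 (hfin.mem_toFinset.2 hw)
      have h3 := hK w hw
      rw [map_nsmul, nsmul_eq_mul] at h2
      change 0 ≤ baseChangeHom w _
      rw [map_sub, map_sum, sub_nonneg]
      exact h3.trans h2
    have h1 := charOrd_nonneg hP hl
    rw [map_sub, map_sum] at h1
    have h2 : ∑ w ∈ hfin.toFinset, charOrd k P.1 (K w • g w) ≤ 0 :=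
      Finset.sum_nonpos fun w hw => by
        rw [map_nsmul]
        exact nsmul_nonpos (hgP w (hfin.mem_toFinset.1 hw)) _
    omega
  refine ⟨w, hw, fun m hm => ⟨fun h => ?_, hle m hm⟩⟩
  obtain ⟨m₀, hm₀, hpos, -⟩ := exists_int_of_isSimplicial (Δ.isCone σ.1 σ.2) hs hull hw
  obtain ⟨y, -, hy⟩ := hP
  have hyp : (PrimeSpectrum.asIdeal y).IsPrime := PrimeSpectrum.isPrime y
  -- The monomials positive at `w` span a nonzero prime, which by `hle` is contained in the height
  -- one prime of `P`; so the two coincide, and the converse implication follows.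
  have hF : MonoidFace.IsFace fun m : dualMonoid σ.1 => Module.Dual.baseChange ℝ m.1 w = 0 :=
    { zero := by simp [Module.Dual.baseChange]
      add_iff := fun a b => by
        rw [AddSubmonoid.coe_add, baseChange_add]
        exact add_eq_zero_iff_of_nonneg (a.2 w (hsσ w hw)) (b.2 w (hsσ w hw)) }
  have heq := MonoidFace.eq_faceIdeal_of_height_eq_one (p := PrimeSpectrum.asIdeal y)
    (height_eq_one hy) hF (fun m hm => (charOrd_pos_iff hy m).1
      (hle m.1 m.2 (lt_of_le_of_ne (m.2 w (hsσ w hw)) (Ne.symm hm))))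
    (m := ⟨m₀, hm₀⟩) hpos.ne'
  have h1 := (charOrd_pos_iff hy ⟨m, hm⟩).1 h
  rw [← heq, MonoidFace.single_mem_faceIdeal] at h1
  exact lt_of_le_of_ne (hm w (hsσ w hw)) (Ne.symm h1)

/-- The integral form that is positive only on the generator belonging to `P₀` has order 0 along the
other boundary divisors, which belong to other generators; `n` is its order along `P₀`. -/
lemma exists_charOrd_of_isSimplicial {σ : Δ.Index} (hσ : PointedCone.IsSimplicial σ.1)
    (P₀ : BoundaryDivisor k Δ) : ∃ n : ℕ, 0 < n ∧ ∃ m, ∀ P : BoundaryDivisor k Δ,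
      P.1.1 ∈ chartOpen k Δ σ → charOrd k P.1 m = Finsupp.single P₀ (n : ℤ) P := by
  obtain ⟨s, hfin, hs, hull⟩ := hσ
  by_cases hP₀ : P₀.1.1 ∈ chartOpen k Δ σ
  swap
  · refine ⟨1, one_pos, 0, fun P hP => ?_⟩
    rw [map_zero, Finsupp.single_eq_of_ne]
    rintro rfl
    exact hP₀ hP
  obtain ⟨w, hw, hPw⟩ := P₀.exists_generator hfin hs hull hP₀
  obtain ⟨m, hm, hmw, hm0⟩ := exists_int_of_isSimplicial (Δ.isCone σ.1 σ.2) hs hull hw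
  have hpos := (hPw m hm).2 hmw
  refine ⟨(charOrd k P₀.1 m).toNat, by omega, m, fun P hP => ?_⟩
  by_cases h : P₀ = P
  · subst h
    rw [Finsupp.single_eq_same]
    omega
  · rw [Finsupp.single_eq_of_ne' h]
    obtain ⟨w', hw', hPw'⟩ := P.exists_generator hfin hs hull hP
    have hne : w' ≠ w := by
      rintro rfl
      exact h (BoundaryDivisor.eq_of_charOrd hP₀ hP fun l hl hl' =>
        (hPw' l hl).2 ((hPw l hl).1 hl'))
    by_contra h0
    have h1 := (hPw' m hm).1 (lt_of_le_of_ne (charOrd_nonneg hP hm) (Ne.symm h0))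
    exact h1.ne' (hm0 w' hw' hne)

variable (Δ) in
/-- The lattice vector of a prime divisor. -/
noncomputable def rayVector (P : PrimeDivisor (toricVariety k Δ)) : N :=
  (Module.evalEquiv ℤ N).symm (charOrd k P).toIntLinearMap

lemma apply_rayVector (P : PrimeDivisor (toricVariety k Δ)) (m : Module.Dual ℤ N) :
    m (rayVector Δ P) = charOrd k P m :=
  Module.apply_evalEquiv_symm_apply (R := ℤ) (M := N) m (charOrd k P).toIntLinearMap

theorem isSimplicial_iff : Δ.IsSimplicial ↔
    ∃ n : ℕ, 0 < n ∧ ∀ P : BoundaryDivisor k Δ, IsLocallyCharacter Δ P n := by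
  classical
  have := finite_boundaryDivisor k Δ
  have := Fintype.ofFinite (BoundaryDivisor k Δ)
  have : Finite Δ.Index := Δ.finite
  have := Fintype.ofFinite Δ.Index
  constructor
  · intro h
    choose n hn m hm using fun (P : BoundaryDivisor k Δ) (σ : Δ.Index) =>
      exists_charOrd_of_isSimplicial (h σ.1 σ.2) P
    refine ⟨∏ x : BoundaryDivisor k Δ × Δ.Index, n x.1 x.2, Finset.prod_pos fun x _ => hn _ _,
      fun P σ => ?_⟩
    rw [← Finset.prod_erase_mul _ _ (Finset.mem_univ (P, σ))]
    -- The common `n` is the product over all pairs; the remaining factors rescale the form for this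
    -- pair.
    refine ⟨(∏ x ∈ Finset.univ.erase (P, σ), n x.1 x.2) • m P σ, fun Q hQ => ?_⟩
    rw [map_nsmul, hm P σ Q hQ, ← Finsupp.smul_apply, Finsupp.smul_single, nsmul_eq_mul]
    push_cast
    rfl
  · rintro ⟨n, hn, h⟩ σ hσ
    choose m hm using fun P => h P ⟨σ, hσ⟩
    refine isSimplicial_of_dual (R := {P : BoundaryDivisor k Δ // P.1.1 ∈ chartOpen k Δ ⟨σ, hσ⟩})
      (v := fun P => rayVector Δ P.1.1) (m := fun P => m P.1) (n := n) (Δ.isCone σ hσ)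
      (by exact_mod_cast hn) (fun P Q => ?_) fun l => ?_
    · rw [apply_rayVector, hm P.1 Q.1 Q.2]
      by_cases hPQ : P = Q
      · rw [hPQ, Finsupp.single_eq_same, Finsupp.single_eq_same]
      · rw [Finsupp.single_eq_of_ne' hPQ, Finsupp.single_eq_of_ne' fun h => hPQ (Subtype.ext h)]
    · refine (mem_dualMonoid_iff (k := k) (σ := ⟨σ, hσ⟩)).trans ?_
      rw [Subtype.forall]
      exact forall₂_congr fun P _ => by rw [apply_rayVector]

end

end ToricFan

/-! ### Kähler differentials of smooth monoid algebras -/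

namespace MonoidFace

open AddMonoidAlgebra

/-- A finite projective module over a domain has constant rank. This allows the differentials to be
measured at two different k-points. -/
lemma finrank_baseChange_eq_finrank {A : Type*} [CommRing A] [IsDomain A] (M : Type*)
    [AddCommGroup M] [Module A M] [Module.Finite A M] [Module.Projective A M]
    (K : Type*) [Field K] [Algebra A K] : Module.finrank K (K ⊗[A] M) = Module.finrank A M := by
  have h := Module.rankAtStalk_baseChange (R := A) (M := M) (S := K) ⊥
  rw [Module.rankAtStalk_eq_finrank_of_free] at h
  have h1 := Module.rankAtStalk_eq_of_le_of_finite_of_flat (R := A) (M := M)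
    (p := ⊥) (q := PrimeSpectrum.comap (algebraMap A K) ⊥) bot_le
  have h2 := Ideal.finrank_fiber_eq_finrank (R := A) (M := M) (⊥ : Ideal A)
  rw [Ideal.finrank_fiber_eq_rankAtStalk] at h2
  exact h.trans (h1.symm.trans h2)

section

variable {k : Type*} [Field k] {S : Type*} [AddCommMonoid S]

/-- A derivation of `k[S]` at a `k`-valued point is given by its values on the monomials. -/
lemma exists_derivation [Algebra (AddMonoidAlgebra k S) k]
    [IsScalarTower k (AddMonoidAlgebra k S) k]
    (φ : S → k) (h : ∀ a b, φ (a + b) = algebraMap (AddMonoidAlgebra k S) k (single a 1) * φ b +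
      algebraMap (AddMonoidAlgebra k S) k (single b 1) * φ a) :
    ∃ D : Derivation k (AddMonoidAlgebra k S) k, ∀ s, D (single s 1) = φ s := by
  let L : AddMonoidAlgebra k S →ₗ[k] k :=
    Finsupp.linearCombination k φ ∘ₗ (coeffLinearEquiv k).toLinearMap
  have hL : ∀ s a, L (single s a) = a * φ s := fun s a =>
    (Finsupp.linearCombination_single k a s)
  have halg : ∀ s a, algebraMap (AddMonoidAlgebra k S) k (single s a) =
      a * algebraMap (AddMonoidAlgebra k S) k (single s 1) := fun s a => by
    have h1 : (single s a : AddMonoidAlgebra k S) = algebraMap k _ a * single s 1 := by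
      rw [← Algebra.smul_def, AddMonoidAlgebra.smul_single, smul_eq_mul, mul_one]
    rw [h1, map_mul, ← IsScalarTower.algebraMap_apply, Algebra.algebraMap_self_apply]
  refine ⟨Derivation.mk' L fun f g => ?_, fun s => ?_⟩
  · induction f using AddMonoidAlgebra.induction_linear with
    | zero => simp
    | add f f' hf hf' =>
      rw [add_mul, map_add, hf, hf', map_add, add_smul, smul_add]
      abel
    | single s a =>
      induction g using AddMonoidAlgebra.induction_linear with
      | zero => simp
      | add g g' hg hg' =>
        rw [mul_add, map_add, hg, hg', map_add, add_smul, smul_add]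
        abel
      | single t b =>
        rw [single_mul_single, hL, hL, hL, h, Algebra.smul_def, Algebra.smul_def, halg s a,
          halg t b]
        ring
  · exact (hL s 1).trans (one_mul _)

/-- The derivations at ε given by the `φ i` are dual to the differentials of the `s i`, which are
therefore independent in the fibre at ε. -/
lemma card_le_finrank_kaehlerDifferential [IsDomain (AddMonoidAlgebra k S)]
    [Algebra.Smooth k (AddMonoidAlgebra k S)] (ε : AddMonoidAlgebra k S →ₐ[k] k)
    {ι : Type*} [Fintype ι] (s : ι → S) (φ : ι → S → k)
    (h : ∀ i a b, φ i (a + b) = ε (single a 1) * φ i b + ε (single b 1) * φ i a)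
    (hφ : ∀ i j, φ i (s j) = Finsupp.single i 1 j) :
    Fintype.card ι ≤ Module.finrank (AddMonoidAlgebra k S) Ω[AddMonoidAlgebra k S⁄k] := by
  let := ε.toRingHom.toAlgebra
  have : IsScalarTower k (AddMonoidAlgebra k S) k :=
    IsScalarTower.of_algebraMap_eq fun r => (ε.commutes r).symm
  choose D hD using fun i => exists_derivation (φ i) (h i)
  rw [← finrank_baseChange_eq_finrank _ k]
  refine LinearIndependent.fintype_card_le_finrank (R := k)
    (b := fun i => (1 : k) ⊗ₜ[AddMonoidAlgebra k S]
      KaehlerDifferential.D k (AddMonoidAlgebra k S) (single (s i) 1)) ?_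
  rw [linearIndependent_iff]
  intro c hc
  ext j
  have h1 := congrArg ((D j).liftKaehlerDifferential.liftBaseChange k) hc
  rw [map_zero, Finsupp.linearCombination_apply, Finsupp.sum, map_sum, Finset.sum_eq_single j] at h1
  · rw [map_smul, LinearMap.liftBaseChange_tmul, Derivation.liftKaehlerDifferential_comp_D, hD, hφ,
      Finsupp.single_eq_same, one_smul, smul_eq_mul, mul_one] at h1
    exact h1
  · intro i _ hi
    rw [map_smul, LinearMap.liftBaseChange_tmul, Derivation.liftKaehlerDifferential_comp_D, hD, hφ,
      Finsupp.single_eq_of_ne hi, smul_zero, smul_zero]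
  · intro h0
    rw [Finsupp.notMem_support_iff.1 h0, zero_smul, map_zero]

end

section

variable {k : Type*} [Field k] {G : Type*} [AddCommGroup G] [Module.Free ℤ G] [Module.Finite ℤ G]

/-- At the identity of the torus all monomials have the value 1, so s ↦ d(χ^s) is additive in the
fibre. It extends to the lattice, and the images of a lattice basis span the fibre. -/
lemma finrank_kaehlerDifferential_le (S : AddSubmonoid G) [IsDomain (AddMonoidAlgebra k S)]
    [Algebra.Smooth k (AddMonoidAlgebra k S)] (hgen : ∀ m, ∃ b ∈ S, b + m ∈ S) :
    Module.finrank (AddMonoidAlgebra k S) Ω[AddMonoidAlgebra k S⁄k] ≤ Module.finrank ℤ G := by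
  let ε : AddMonoidAlgebra k S →ₐ[k] k := AddMonoidAlgebra.lift k k S 1
  let := ε.toRingHom.toAlgebra
  have : IsScalarTower k (AddMonoidAlgebra k S) k :=
    IsScalarTower.of_algebraMap_eq fun r => (ε.commutes r).symm
  have hε : ∀ s : S, algebraMap (AddMonoidAlgebra k S) k (single s 1) = 1 := fun s => by
    change ε (single s 1) = 1
    rw [AddMonoidAlgebra.lift_single, one_smul]
    rfl
  let V := k ⊗[AddMonoidAlgebra k S] Ω[AddMonoidAlgebra k S⁄k]
  have hsm : ∀ (a : AddMonoidAlgebra k S) (x : Ω[AddMonoidAlgebra k S⁄k]),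
      (1 : k) ⊗ₜ[AddMonoidAlgebra k S] (a • x) =
        algebraMap (AddMonoidAlgebra k S) k a • ((1 : k) ⊗ₜ[AddMonoidAlgebra k S] x) :=
    fun a x => by rw [TensorProduct.tmul_smul, algebraMap_smul]
  let g : S → V := fun s => 1 ⊗ₜ KaehlerDifferential.D k (AddMonoidAlgebra k S) (single s 1)
  have hg : ∀ a b, g (a + b) = g a + g b := fun a b => by
    have : (single (a + b) 1 : AddMonoidAlgebra k S) = single a 1 * single b 1 := by
      rw [single_mul_single, mul_one]
    change _ ⊗ₜ _ = _
    rw [this, Derivation.leibniz, TensorProduct.tmul_add, hsm, hsm, hε, hε, one_smul, one_smul,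
      add_comm]
  have hspan : Submodule.span k (Set.range g) = ⊤ := by
    rw [eq_top_iff]
    rintro x -
    induction x using TensorProduct.induction_on with
    | zero => exact zero_mem _
    | add x y hx hy => exact add_mem hx hy
    | tmul c ω =>
      rw [← mul_one c, ← smul_eq_mul, ← TensorProduct.smul_tmul']
      refine Submodule.smul_mem _ _ ?_
      have hω : ω ∈ Submodule.span (AddMonoidAlgebra k S)
        (Set.range (KaehlerDifferential.D k (AddMonoidAlgebra k S))) := by
        rw [KaehlerDifferential.span_range_derivation]
        trivial
      induction hω using Submodule.span_induction with
      | zero => rw [TensorProduct.tmul_zero]; exact zero_mem _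
      | add x y _ _ hx hy => rw [TensorProduct.tmul_add]; exact add_mem hx hy
      | smul a x _ hx => rw [hsm]; exact Submodule.smul_mem _ _ hx
      | mem x hx =>
        obtain ⟨f, rfl⟩ := hx
        induction f using AddMonoidAlgebra.induction_linear with
        | zero => rw [map_zero, TensorProduct.tmul_zero]; exact zero_mem _
        | add f f' hf hf' => rw [map_add, TensorProduct.tmul_add]; exact add_mem hf hf'
        | single s a =>
          have h1 : (single s a : AddMonoidAlgebra k S) = a • single s 1 := by
            rw [AddMonoidAlgebra.smul_single, smul_eq_mul, mul_one]
          rw [h1, Derivation.map_smul, ← algebraMap_smul (AddMonoidAlgebra k S) a, hsm]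
          exact Submodule.smul_mem _ _ (Submodule.subset_span ⟨s, rfl⟩)
  -- extension of `g` to `G`
  let b := Module.finBasis ℤ G
  choose a ha hab using fun i => hgen (b i)
  let v : Fin (Module.finrank ℤ G) → V := fun i => g ⟨a i + b i, hab i⟩ - g ⟨a i, ha i⟩
  let g' : G →ₗ[ℤ] V := b.constr ℤ v
  -- The lattice points where the extension is given by differences of values of `g` form a subgroup
  -- containing the basis, so it is everything; additivity of `g` then shows that `g'` extends it.
  let T : AddSubgroup G :=
    { carrier := {m | ∃ x y : S, m = x - y ∧ g' m = g x - g y}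
      zero_mem' := ⟨0, 0, by simp, by simp⟩
      add_mem' := by
        rintro _ _ ⟨x, y, rfl, h⟩ ⟨x', y', rfl, h'⟩
        refine ⟨x + x', y + y', ?_, ?_⟩
        · rw [AddSubmonoid.coe_add, AddSubmonoid.coe_add]
          abel
        · rw [map_add, h, h', hg, hg]
          abel
      neg_mem' := by
        rintro _ ⟨x, y, rfl, h⟩
        exact ⟨y, x, neg_sub _ _, by rw [map_neg, h, neg_sub]⟩ }
  have hT : ∀ m, m ∈ T := by
    intro m
    rw [← b.sum_repr m]
    refine AddSubgroup.sum_mem _ fun i _ => AddSubgroup.zsmul_mem _ ?_ _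
    exact ⟨⟨a i + b i, hab i⟩, ⟨a i, ha i⟩, by simp, b.constr_basis ℤ v i⟩
  have hg' : ∀ s : S, g' s = g s := fun s => by
    obtain ⟨x, y, hs, h⟩ := hT s
    have : s + y = x := Subtype.ext (by rw [AddSubmonoid.coe_add, hs, sub_add_cancel])
    rw [h, ← this, hg, add_sub_cancel_right]
  have hv : Submodule.span k (Set.range v) = ⊤ := by
    rw [eq_top_iff, ← hspan, Submodule.span_le]
    rintro _ ⟨s, rfl⟩
    rw [← hg', ← b.sum_repr s.1, map_sum]
    refine Submodule.sum_mem _ fun i _ => ?_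
    rw [map_zsmul, ← Int.cast_smul_eq_zsmul k]
    refine Submodule.smul_mem _ _ (Submodule.subset_span ⟨i, ?_⟩)
    exact (b.constr_basis ℤ v i).symm
  rw [← finrank_baseChange_eq_finrank _ k]
  have h1 := finrank_range_le_card (R := k) v
  rw [Set.finrank, hv, finrank_top, Fintype.card_fin] at h1
  exact h1

end

end MonoidFace

/-! ### Smoothness forces a monoid to be unimodular -/

namespace MonoidFace

open AddMonoidAlgebra

variable {k : Type u} [Field k] {G : Type u} [AddCommGroup G]

/-- A submonoid of a lattice given by the nonnegativity of some coordinates for a basis. -/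
def IsUnimodular (S : AddSubmonoid G) : Prop :=
  ∃ (n : ℕ) (b : Module.Basis (Fin n) ℤ G) (J : Set (Fin n)),
    ∀ m, m ∈ S ↔ ∀ i ∈ J, 0 ≤ b.repr m i

lemma IsUnimodular.of_basis {ι : Type*} [Finite ι] (b : Module.Basis ι ℤ G) (J : Set ι)
    {S : AddSubmonoid G} (h : ∀ m, m ∈ S ↔ ∀ i ∈ J, 0 ≤ b.repr m i) : IsUnimodular S := by
  have := Fintype.ofFinite ι
  let e := Fintype.equivFin ι
  refine ⟨_, b.reindex e, e '' J, fun m => (h m).trans ?_⟩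
  rw [Set.forall_mem_image]
  simp

lemma IsUnimodular.smooth {S : AddSubmonoid G} (h : IsUnimodular S) :
    Algebra.Smooth k (AddMonoidAlgebra k S) := by
  obtain ⟨n, b, J, h⟩ := h
  exact smooth_of_basis k b J S h

/-- A finite set of monomials which generates a monoid up to units, and is minimal with this
property. -/
structure IsMinimalGenerating (S : AddSubmonoid G) (T : Finset S) : Prop where
  closure_eq : AddSubmonoid.closure (T ∪ {s : S | -s.1 ∈ S}) = ⊤
  closure_ne : ∀ h ∈ T, AddSubmonoid.closure ((T : Set S) \ {h} ∪ {s : S | -s.1 ∈ S}) ≠ ⊤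

lemma exists_isMinimalGenerating (S : AddSubmonoid G) [hfg : AddMonoid.FG S] :
    ∃ T, IsMinimalGenerating S T := by
  classical
  obtain ⟨T₀, hT₀⟩ := hfg.fg_top
  obtain ⟨T, hT, hmin⟩ := (wellFounded_lt (α := Finset S)).has_min
    {T | AddSubmonoid.closure ((T : Set S) ∪ {s : S | -s.1 ∈ S}) = ⊤}
    ⟨T₀, top_le_iff.1 (hT₀.ge.trans (AddSubmonoid.closure_mono Set.subset_union_left))⟩
  refine ⟨T, hT, fun h hh hcl => hmin (T.erase h) ?_ (Finset.erase_ssubset hh)⟩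
  rw [Set.mem_ofPred_eq, Finset.coe_erase]
  exact hcl

namespace IsMinimalGenerating

variable {S : AddSubmonoid G} {T : Finset S}

/-- Either `h` is not needed to write `s`, or one copy of it splits off. -/
lemma mem_or {h : S} (s : S) (hT : IsMinimalGenerating S T) :
    s ∈ AddSubmonoid.closure ((T : Set S) \ {h} ∪ {s : S | -s.1 ∈ S}) ∨ ∃ s', s = h + s' := by
  have hs : s ∈ AddSubmonoid.closure (T ∪ {s : S | -s.1 ∈ S}) := hT.closure_eq ▸ trivial
  induction hs using AddSubmonoid.closure_induction with
  | mem x hx =>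
    by_cases hxh : x = h
    · exact .inr ⟨0, by rw [hxh, add_zero]⟩
    · exact .inl (AddSubmonoid.subset_closure (hx.imp (fun hx => ⟨hx, hxh⟩) id))
  | zero => exact .inl (zero_mem _)
  | add x y _ _ hx hy =>
    rcases hx with hx | ⟨x', rfl⟩
    · rcases hy with hy | ⟨y', rfl⟩
      · exact .inl (add_mem hx hy)
      · exact .inr ⟨x + y', by abel⟩
    · exact .inr ⟨x' + y, by abel⟩

lemma notMem_closure {h : S} (hh : h ∈ T) (hT : IsMinimalGenerating S T) :
    h ∉ AddSubmonoid.closure ((T : Set S) \ {h} ∪ {s : S | -s.1 ∈ S}) := by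
  intro hc
  refine hT.closure_ne h hh (top_le_iff.1 (hT.closure_eq.ge.trans (AddSubmonoid.closure_le.2 ?_)))
  rintro x (hx | hx)
  · by_cases hxh : x = h
    · rw [hxh]; exact hc
    · exact AddSubmonoid.subset_closure (.inl ⟨hx, hxh⟩)
  · exact AddSubmonoid.subset_closure (.inr hx)

lemma not_unit {h : S} (hh : h ∈ T) (hT : IsMinimalGenerating S T) : -h.1 ∉ S :=
  fun h' => hT.notMem_closure hh (AddSubmonoid.subset_closure (.inr h'))

lemma eq_of_add_unit {h h' u : S} (hh : h ∈ T) (hh' : h' ∈ T) (hu : -u.1 ∈ S) (he : h' = h + u)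
    (hT : IsMinimalGenerating S T) : h = h' := by
  by_contra hne
  refine hT.notMem_closure hh' ?_
  have h1 : h + u ∈ AddSubmonoid.closure ((T : Set S) \ {h'} ∪ {s : S | -s.1 ∈ S}) :=
    add_mem (AddSubmonoid.subset_closure (Or.inl ⟨hh, hne⟩))
    (AddSubmonoid.subset_closure (Or.inr hu))
  rwa [← he] at h1

lemma unit_of_eq_add {h x y : S} (he : h = (h + x) + y) : -y.1 ∈ S := by
  have h1 : -y.1 = x := by
    have := congrArg Subtype.val he
    rw [AddSubmonoid.coe_add, AddSubmonoid.coe_add, add_assoc, left_eq_add] at this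
    exact (eq_neg_of_add_eq_zero_left this).symm
  rw [h1]
  exact x.2

/-- Minimal generators are irreducible up to units: if neither summand needs `h`, then `h` is
superfluous, and if `h` splits off from one summand, the other is a unit. -/
lemma unit_or_unit {h x y : S} (hh : h ∈ T) (he : h = x + y) (hT : IsMinimalGenerating S T) :
    -x.1 ∈ S ∨ -y.1 ∈ S := by
  rcases hT.mem_or (h := h) x with hx | ⟨x', hx⟩
  · rcases hT.mem_or (h := h) y with hy | ⟨y', hy⟩
    · exact absurd (add_mem hx hy) (he ▸ hT.notMem_closure hh)
    · exact .inl (unit_of_eq_add (he.trans ((add_comm _ _).trans (congrArg (· + x) hy))))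
  · exact .inr (unit_of_eq_add (he.trans (congrArg (· + y) hx)))

end IsMinimalGenerating

/-- The group of units of a submonoid of a lattice. -/
def unitSubgroup (S : AddSubmonoid G) : AddSubgroup G where
  carrier := {m | m ∈ S ∧ -m ∈ S}
  zero_mem' := ⟨zero_mem _, by rw [neg_zero]; exact zero_mem _⟩
  add_mem' ha hb := ⟨add_mem ha.1 hb.1, by rw [neg_add]; exact add_mem ha.2 hb.2⟩
  neg_mem' ha := ⟨ha.2, by rw [neg_neg]; exact ha.1⟩

/-- A basis of the unit group together with the minimal generators spans the lattice. The
differentials at a point of the closed orbit show that there are at most rank G such vectors, so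
they form a basis; its generator coordinates cut out `S`. -/
theorem isUnimodular_of_smooth [Module.Free ℤ G] [Module.Finite ℤ G] (S : AddSubmonoid G)
    [AddMonoid.FG S] [IsDomain (AddMonoidAlgebra k S)] [Algebra.Smooth k (AddMonoidAlgebra k S)]
    (hgen : ∀ m, ∃ b ∈ S, b + m ∈ S) : IsUnimodular S := by
  classical
  obtain ⟨T, hT⟩ := exists_isMinimalGenerating S
  have hF := isFace_units S
  let U : Submodule ℤ G := AddSubgroup.toIntSubmodule (unitSubgroup S)
  let r := Module.finrank ℤ U
  let bU := Module.finBasis ℤ U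
  -- The k-point of the closed orbit where units take the value 1 and all other monomials vanish.
  let ε : AddMonoidAlgebra k S →ₐ[k] k := AddMonoidAlgebra.lift k k S
    { toFun := fun s => if -s.toAdd.1 ∈ S then 1 else 0
      map_one' := if_pos hF.zero
      map_mul' := fun a b => by
        have := hF.add_iff a.toAdd b.toAdd
        by_cases ha : -a.toAdd.1 ∈ S <;> by_cases hb : -b.toAdd.1 ∈ S <;> simp_all }
  have hε : ∀ s : S, ε (single s 1) = if -s.1 ∈ S then 1 else 0 := fun s => by
    rw [AddMonoidAlgebra.lift_single, one_smul]
    rfl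
  let ι := Fin r ⊕ T
  let s : ι → S := Sum.elim (fun i => ⟨bU i, (bU i).2.1⟩) (fun h => h.1)
  -- Two kinds of tangent vectors: along the orbit, reading a coordinate of a unit, and transverse
  -- to it, detecting the monomials that equal `h` up to a unit.
  let φ : ι → S → k := Sum.elim
    (fun i s => if h : -s.1 ∈ S then (bU.repr ⟨s.1, s.2, h⟩ i : k) else 0)
    (fun h s => if ∃ u : S, -u.1 ∈ S ∧ s = h.1 + u then 1 else 0)
  have hcard : Fintype.card ι ≤ Module.finrank ℤ G := by
    refine (card_le_finrank_kaehlerDifferential ε s φ ?_ ?_).trans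
      (finrank_kaehlerDifferential_le S hgen)
    · rintro (i | h) a b
      · change (if h : -(a + b).1 ∈ S then (bU.repr ⟨(a + b).1, (a + b).2, h⟩ i : k) else 0) =
          ε (single a 1) * (if h : -b.1 ∈ S then (bU.repr ⟨b.1, b.2, h⟩ i : k) else 0) +
          ε (single b 1) * (if h : -a.1 ∈ S then (bU.repr ⟨a.1, a.2, h⟩ i : k) else 0)
        rw [hε, hε]
        by_cases hab : -(a + b).1 ∈ S
        · obtain ⟨ha, hb⟩ := (hF.add_iff a b).1 hab
          rw [dif_pos hab, if_pos ha, if_pos hb, dif_pos ha, dif_pos hb, one_mul, one_mul,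
            ← Int.cast_add, add_comm (bU.repr _ i), ← Finsupp.add_apply, ← map_add]
          rfl
        · rw [dif_neg hab]
          by_cases ha : -a.1 ∈ S
          · have hb : -b.1 ∉ S := fun hb => hab ((hF.add_iff a b).2 ⟨ha, hb⟩)
            rw [dif_neg hb, if_neg hb, mul_zero, zero_mul, add_zero]
          · rw [dif_neg ha, if_neg ha, mul_zero, zero_mul, add_zero]
      · change (if ∃ u : S, -u.1 ∈ S ∧ a + b = h.1 + u then 1 else 0) =
          ε (single a 1) * (if ∃ u : S, -u.1 ∈ S ∧ b = h.1 + u then 1 else 0) +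
          ε (single b 1) * (if ∃ u : S, -u.1 ∈ S ∧ a = h.1 + u then 1 else 0)
        rw [hε, hε]
        have hnot : ∀ x : S, -x.1 ∈ S → ¬ ∃ u : S, -u.1 ∈ S ∧ x = h.1 + u := by
          rintro x hx ⟨u, -, rfl⟩
          exact hT.not_unit h.2 ((hF.add_iff _ _).1 hx).1
        have hadd : ∀ x y : S, -x.1 ∈ S → ((∃ u : S, -u.1 ∈ S ∧ x + y = h.1 + u) ↔
            ∃ u : S, -u.1 ∈ S ∧ y = h.1 + u) := by
          intro x y hx
          let x' : S := ⟨-x.1, hx⟩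
          have hx' : x' + x = 0 := Subtype.ext (neg_add_cancel x.1)
          have hxu : -x'.1 ∈ S := by
            change - -x.1 ∈ S
            rw [neg_neg]
            exact x.2
          constructor
          · rintro ⟨u, hu, he⟩
            refine ⟨x' + u, (hF.add_iff _ _).2 ⟨hxu, hu⟩, ?_⟩
            rw [add_left_comm, ← he, ← add_assoc, hx', zero_add]
          · rintro ⟨u, hu, rfl⟩
            exact ⟨x + u, (hF.add_iff _ _).2 ⟨hx, hu⟩, add_left_comm _ _ _⟩
        by_cases ha : -a.1 ∈ S
        · rw [if_pos ha, one_mul, if_neg (hnot a ha), mul_zero, add_zero]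
          exact if_congr (hadd a b ha) rfl rfl
        · rw [if_neg ha, zero_mul, zero_add]
          by_cases hb : -b.1 ∈ S
          · rw [if_pos hb, one_mul, add_comm a b]
            exact if_congr (hadd b a hb) rfl rfl
          · rw [if_neg hb, zero_mul, if_neg]
            rintro ⟨u, hu, he⟩
            -- For nonunits `a` and `b` the Leibniz rule requires that `a + b` is not `h` up to a
            -- unit, which is the irreducibility of `h`.
            have he' : h.1 = a + (b + ⟨-u.1, hu⟩) := by
              rw [← add_assoc, he, add_assoc, left_eq_add]
              exact Subtype.ext (add_neg_cancel u.1)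
            rcases hT.unit_or_unit h.2 he' with h1 | h1
            · exact ha h1
            · exact hb ((hF.add_iff _ _).1 h1).1
    · rintro (i | h) (j | h')
      · refine (dif_pos (bU j).2.2).trans ?_
        change ((bU.repr (bU j) i : ℤ) : k) = _
        rw [Module.Basis.repr_self]
        by_cases hij : i = j
        · rw [hij, Finsupp.single_eq_same, Finsupp.single_eq_same, Int.cast_one]
        · rw [Finsupp.single_eq_of_ne hij, Int.cast_zero, Finsupp.single_eq_of_ne']
          exact fun h => hij (Sum.inl_injective h)
      · refine (dif_neg (hT.not_unit h'.2)).trans ?_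
        rw [Finsupp.single_eq_of_ne Sum.inr_ne_inl]
      · rw [Finsupp.single_eq_of_ne Sum.inl_ne_inr]
        refine if_neg ?_
        rintro ⟨u, -, he⟩
        refine hT.not_unit h.2 ((hF.add_iff h.1 u).1 ?_).1
        rw [← he]
        exact (bU j).2.2
      · by_cases hh : h = h'
        · rw [hh, Finsupp.single_eq_same]
          exact if_pos ⟨0, hF.zero, (add_zero _).symm⟩
        · rw [Finsupp.single_eq_of_ne' fun h1 => hh (Sum.inr_injective h1)]
          refine if_neg ?_
          rintro ⟨u, hu, he⟩
          exact hh (Subtype.ext (hT.eq_of_add_unit h.2 h'.2 hu he))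
  have hUsum : ∀ u (hu : u ∈ U), u = ∑ i, bU.repr ⟨u, hu⟩ i • (bU i).1 := fun u hu => by
    have h1 := congrArg U.subtype (bU.sum_repr ⟨u, hu⟩)
    rw [map_sum] at h1
    exact h1.symm
  let c : ι → G := fun i => (s i).1
  have hspan : ⊤ ≤ Submodule.span ℤ (Set.range c) := by
    have hU : U ≤ Submodule.span ℤ (Set.range c) := by
      intro u hu
      rw [hUsum u hu]
      exact sum_mem fun i _ => Submodule.smul_mem _ _ (Submodule.subset_span ⟨.inl i, rfl⟩)
    have hS : ∀ x : S, x.1 ∈ Submodule.span ℤ (Set.range c) := by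
      intro x
      have hx : x ∈ AddSubmonoid.closure (T ∪ {s : S | -s.1 ∈ S}) := hT.closure_eq ▸ trivial
      induction hx using AddSubmonoid.closure_induction with
      | mem x hx =>
        rcases hx with hx | hx
        · exact Submodule.subset_span ⟨.inr ⟨x, hx⟩, rfl⟩
        · exact hU ⟨x.2, hx⟩
      | zero => exact zero_mem _
      | add x y _ _ hx hy => exact add_mem hx hy
    intro m _
    obtain ⟨a, ha, ham⟩ := hgen m
    have := sub_mem (hS ⟨_, ham⟩) (hS ⟨a, ha⟩)
    rwa [add_sub_cancel_left] at this
  let b : Module.Basis ι ℤ G :=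
    .mk (linearIndependent_of_top_le_span_of_card_le_finrank hspan hcard) hspan
  have hb : ∀ i, b i = s i := fun i => Module.Basis.mk_apply _ _ i
  refine .of_basis b (Set.range Sum.inr) fun m => ?_
  rw [Set.forall_mem_range]
  constructor
  · intro hm h
    have hx : (⟨m, hm⟩ : S) ∈ AddSubmonoid.closure (T ∪ {s : S | -s.1 ∈ S}) :=
      hT.closure_eq ▸ trivial
    suffices H : ∀ x ∈ AddSubmonoid.closure (T ∪ {s : S | -s.1 ∈ S}),
        0 ≤ b.repr x.1 (Sum.inr h) from H _ hx
    intro x hx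
    induction hx using AddSubmonoid.closure_induction with
    | mem x hx =>
      rcases hx with hx | hx
      · have h1 := b.repr_self (Sum.inr ⟨x, hx⟩)
        rw [hb] at h1
        change 0 ≤ b.repr (s (Sum.inr ⟨x, hx⟩)).1 _
        rw [h1]
        exact Finsupp.single_nonneg.2 zero_le_one _
      · rw [hUsum x.1 ⟨x.2, hx⟩, map_sum, Finsupp.finsetSum_apply]
        refine Finset.sum_nonneg fun i _ => ?_
        have h1 := b.repr_self (Sum.inl i)
        rw [hb] at h1
        rw [map_smul, Finsupp.smul_apply, show (bU i).1 = (s (Sum.inl i)).1 from rfl, h1,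
          Finsupp.single_eq_of_ne Sum.inr_ne_inl, smul_zero]
    | zero => rw [AddSubmonoid.coe_zero, map_zero]; rfl
    | add x y _ _ hx hy =>
      rw [AddSubmonoid.coe_add, map_add]
      exact add_nonneg hx hy
  · intro hm
    rw [← b.sum_repr m, Fintype.sum_sum_type]
    refine add_mem (sum_mem fun i _ => ?_) (sum_mem fun h _ => ?_)
    · rw [hb]
      exact ((unitSubgroup S).zsmul_mem (bU i).2 _).1
    · rw [hb]
      lift b.repr m (Sum.inr h) to ℕ using hm h with l
      rw [natCast_zsmul]
      exact nsmul_mem h.1.2 l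

end MonoidFace

/-! ### Smoothness of the toric variety -/

namespace ToricFan

open AffineChart SchemeDivisor AddMonoidAlgebra MonoidFace

variable {k : Type u} [Field k] {N : Type u} [AddCommGroup N] [Module.Finite ℤ N] {Δ : ToricFan N}

variable (k) in
lemma chart_structureMap (σ : Δ.Index) : chart k Δ σ ≫ structureMap k Δ =
    Spec.map (CommRingCat.ofHom (algebraMap k (coordRing k σ.1))) :=
  colimit.ι_desc _ _

lemma smooth_Spec_iff {A : Type u} [CommRing A] [Algebra k A] :
    Smooth (Spec.map (CommRingCat.ofHom (algebraMap k A))) ↔ Algebra.Smooth k A := by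
  rw [HasRingHomProperty.Spec_iff (P := @Smooth), CommRingCat.hom_ofHom, RingHom.smooth_algebraMap]

theorem smooth_structureMap_iff : Smooth (structureMap k Δ) ↔
    ∀ σ : Δ.Index, Algebra.Smooth k (coordRing k σ.1) := by
  have : IsZariskiLocalAtSource (@Smooth.{u}) :=
    HasRingHomProperty.instIsZariskiLocalAtSource (P := @Smooth.{u})
  refine (IsZariskiLocalAtSource.iff_of_openCover (P := @Smooth.{u}) (f := structureMap k Δ)
    (Scheme.IsLocallyDirected.openCover (diagram k Δ))).trans ?_
  refine forall_congr' fun σ => ?_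
  refine Iff.trans ?_ (smooth_Spec_iff (k := k))
  exact iff_of_eq (congrArg (fun f => Smooth f) (chart_structureMap k σ))

variable [Module.Free ℤ N]

/-- The orders along the boundary divisors of `U_σ` are coordinates if the monoid of `σ` is
unimodular. -/
lemma exists_charOrd_of_isUnimodular {σ : Δ.Index} (h : IsUnimodular (dualMonoid σ.1))
    (P₀ : BoundaryDivisor k Δ) : ∃ m, ∀ P : BoundaryDivisor k Δ, P.1.1 ∈ chartOpen k Δ σ →
      charOrd k P.1 m = Finsupp.single P₀ 1 P := by
  obtain ⟨n, b, J, hJ⟩ := h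
  by_cases hP₀ : P₀.1.1 ∈ chartOpen k Δ σ
  swap
  · refine ⟨0, fun P hP => ?_⟩
    rw [map_zero, Finsupp.single_eq_of_ne]
    rintro rfl
    exact hP₀ hP
  have key : ∀ P : BoundaryDivisor k Δ, P.1.1 ∈ chartOpen k Δ σ → ∃ i ∈ J, ∀ m,
      charOrd k P.1 m = b.repr m i := by
    intro P hP
    have hbS : ∀ i, b i ∈ dualMonoid σ.1 := fun i => (hJ _).2 fun j _ => by
      rw [b.repr_self]
      exact Finsupp.single_nonneg.2 zero_le_one _
    -- If no basis vector in `J` had positive order, nothing in S_σ would: the vectors outside of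
    -- `J` are units, of order 0.
    obtain ⟨i, hiJ, hi⟩ : ∃ i ∈ J, 0 < charOrd k P.1 (b i) := by
      by_contra! hno
      obtain ⟨m, hm, hpos⟩ := exists_charOrd_pos P hP
      rw [← b.sum_repr m, map_sum] at hpos
      refine hpos.not_ge (Finset.sum_nonpos fun i _ => ?_)
      rw [map_zsmul, smul_eq_mul]
      by_cases hi : i ∈ J
      · exact mul_nonpos_of_nonneg_of_nonpos ((hJ m).1 hm i hi) (hno i hi)
      · have h1 : -b i ∈ dualMonoid σ.1 := (hJ _).2 fun j hj => by
          rw [map_neg, b.repr_self, Finsupp.neg_apply, Finsupp.single_eq_of_ne, neg_zero]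
          rintro rfl
          exact hi hj
        have h2 := charOrd_nonneg hP h1
        have h3 := charOrd_nonneg hP (hbS i)
        rw [map_neg] at h2
        rw [show charOrd k P.1 (b i) = 0 by omega, mul_zero]
    refine ⟨i, hiJ, ?_⟩
    obtain ⟨y, -, hy⟩ := hP
    have hyp : (PrimeSpectrum.asIdeal y).IsPrime := PrimeSpectrum.isPrime y
    let e : dualMonoid σ.1 := ⟨b i, hbS i⟩
    have he := (charOrd_pos_iff hy e).1 hi
    -- monomials with a positive coordinate are divisible by the basis element
    have hdvd : ∀ m : dualMonoid σ.1, b.repr m.1 i ≠ 0 → ∃ m', m = e + m' := by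
      intro m hm
      have hm' : m.1 - b i ∈ dualMonoid σ.1 := (hJ _).2 fun j hj => by
        have h1 := (hJ m.1).1 m.2 j hj
        rw [map_sub, b.repr_self, Finsupp.sub_apply]
        by_cases hji : j = i
        · subst hji
          rw [Finsupp.single_eq_same]
          omega
        · rw [Finsupp.single_eq_of_ne hji, sub_zero]
          exact h1
      exact ⟨⟨_, hm'⟩, Subtype.ext (add_sub_cancel _ _).symm⟩
    have hF : MonoidFace.IsFace fun m : dualMonoid σ.1 => b.repr m.1 i = 0 :=
      { zero := by rw [AddSubmonoid.coe_zero, map_zero]; rfl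
        add_iff := fun m m' => by
          rw [AddSubmonoid.coe_add, map_add, Finsupp.add_apply]
          exact add_eq_zero_iff_of_nonneg ((hJ _).1 m.2 i hiJ) ((hJ _).1 m'.2 i hiJ) }
    have hmul : ∀ m', (single (e + m') 1 : coordRing k σ.1) = single e 1 * single m' 1 :=
      fun m' => by rw [single_mul_single, mul_one]
    have heF : ¬ b.repr e.1 i = 0 := by
      change ¬ b.repr (b i) i = 0
      rw [b.repr_self, Finsupp.single_eq_same]
      exact one_ne_zero
    have heq := eq_faceIdeal_of_height_eq_one (p := PrimeSpectrum.asIdeal y) (height_eq_one hy) hF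
      (fun m hm => by
        obtain ⟨m', rfl⟩ := hdvd m hm
        rw [hmul]
        exact Ideal.mul_mem_right _ _ he) (m := e) heF
    -- The prime of `P` is generated by one monomial, which therefore has order exactly 1; the other
    -- basis vectors lie outside of the prime and have order 0.
    have hspan : PrimeSpectrum.asIdeal y = Ideal.span {(single e 1 : coordRing k σ.1)} := by
      refine le_antisymm (fun f hf => ?_) ((Ideal.span_singleton_le_iff_mem _).2 he)
      refine mem_of_support fun m hm => ?_
      have h1 := (mem_asIdeal_iff P hy f).1 hf m hm
      rw [← heq, single_mem_faceIdeal] at h1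
      obtain ⟨m', rfl⟩ := hdvd m h1
      rw [hmul]
      exact Ideal.mul_mem_right _ _ (Ideal.mem_span_singleton_self _)
    have hi1 : charOrd k P.1 (b i) = 1 := by
      change ordZ P.1 (character k Δ e.1) = 1
      rw [character_eq_unitK]
      exact ordZ_unitK_eq_one hy _ hspan
    have hj0 : ∀ j, j ≠ i → charOrd k P.1 (b j) = 0 := fun j hj => by
      refine (charOrd_eq_zero_iff hy ⟨b j, hbS j⟩).2 ?_
      rw [← heq, single_mem_faceIdeal, not_not, b.repr_self, Finsupp.single_eq_of_ne' hj]
    intro m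
    conv_lhs => rw [← b.sum_repr m]
    rw [map_sum, Finset.sum_eq_single i]
    · rw [map_zsmul, hi1, smul_eq_mul, mul_one]
    · intro j _ hj
      rw [map_zsmul, hj0 j hj, smul_zero]
    · exact fun h => absurd (Finset.mem_univ _) h
  obtain ⟨i, -, hi⟩ := key P₀ hP₀
  refine ⟨b i, fun P hP => ?_⟩
  by_cases h : P₀ = P
  · subst h
    rw [hi, b.repr_self, Finsupp.single_eq_same, Finsupp.single_eq_same]
  · rw [Finsupp.single_eq_of_ne' h]
    obtain ⟨j, -, hj⟩ := key P hP
    rw [hj, b.repr_self, Finsupp.single_eq_of_ne]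
    rintro rfl
    exact h (BoundaryDivisor.eq_of_charOrd hP₀ hP fun m _ hpos => by rwa [hj, ← hi])

/-- A family of forms with a dual family of lattice vectors is part of a basis. -/
lemma isUnimodular_of_dual {G : Type u} [AddCommGroup G] [Module.Free ℤ G] [Module.Finite ℤ G]
    {R : Type*} [Finite R] {S : AddSubmonoid G} {v : R → Module.Dual ℤ G} {m : R → G}
    (hm : ∀ P Q, v Q (m P) = Finsupp.single P 1 Q)
    (hmem : ∀ l, l ∈ S ↔ ∀ P, 0 ≤ v P l) : IsUnimodular S := by
  classical
  have := Fintype.ofFinite R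
  let f : G →ₗ[ℤ] (R → ℤ) := LinearMap.pi v
  have hf : ∀ (c : R → ℤ) (Q : R), v Q (∑ P, c P • m P) = c Q := fun c Q => by
    rw [map_sum, Finset.sum_eq_single Q]
    · rw [map_smul, hm, Finsupp.single_eq_same, smul_eq_mul, mul_one]
    · intro P _ hP
      rw [map_smul, hm, Finsupp.single_eq_of_ne' hP, smul_zero]
    · exact fun h => absurd (Finset.mem_univ _) h
  let g : (R → ℤ) →ₗ[ℤ] G := Fintype.linearCombination ℤ m
  have hg : ∀ c, f (g c) = c := fun c => funext fun Q => hf c Q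
  -- The dual vectors `m` give a section `g` of `f`, so the lattice splits, and a basis of the
  -- kernel completes them to a basis.
  let e : ((R → ℤ) × LinearMap.ker f) ≃ₗ[ℤ] G :=
    { toFun := fun x => g x.1 + x.2.1
      map_add' := fun x y => by
        rw [Prod.fst_add, Prod.snd_add, map_add, Submodule.coe_add]
        abel
      map_smul' := fun c x => by
        rw [Prod.smul_fst, Prod.smul_snd, map_smul, Submodule.coe_smul, smul_add]
        rfl
      invFun := fun l => (f l, ⟨l - g (f l), by rw [LinearMap.mem_ker, map_sub, hg, sub_self]⟩)
      left_inv := fun x => by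
        have h1 : f (g x.1 + x.2.1) = x.1 := by
          rw [map_add, hg, LinearMap.mem_ker.1 x.2.2, add_zero]
        refine Prod.ext h1 (Subtype.ext ?_)
        change g x.1 + x.2.1 - g (f (g x.1 + x.2.1)) = _
        rw [h1, add_sub_cancel_left]
      right_inv := fun l => add_sub_cancel _ _ }
  let b := ((Pi.basisFun ℤ R).prod (Module.finBasis ℤ (LinearMap.ker f))).map e
  refine .of_basis b (Set.range Sum.inl) fun l => (hmem l).trans ?_
  rw [Set.forall_mem_range]
  refine forall_congr' fun P => ?_
  rfl

/-- Characters dual to the boundary orders on U_σ are the part of a basis whose coordinates cut out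
S_σ. -/
theorem forall_isUnimodular_iff : (∀ σ : Δ.Index, IsUnimodular (dualMonoid σ.1)) ↔
    ∀ P : BoundaryDivisor k Δ, IsLocallyCharacter Δ P 1 := by
  refine ⟨fun h P σ => exists_charOrd_of_isUnimodular (h σ) P, fun h σ => ?_⟩
  have := finite_boundaryDivisor k Δ
  choose m hm using fun P => h P σ
  refine isUnimodular_of_dual (R := {P : BoundaryDivisor k Δ // P.1.1 ∈ chartOpen k Δ σ})
    (v := fun P => (charOrd k P.1.1).toIntLinearMap) (m := fun P => m P.1) (fun P Q => ?_)
    fun l => ?_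
  · refine (hm P.1 Q.1 Q.2).trans ?_
    by_cases hPQ : P = Q
    · rw [hPQ, Finsupp.single_eq_same, Finsupp.single_eq_same]
    · rw [Finsupp.single_eq_of_ne' hPQ, Finsupp.single_eq_of_ne' fun h => hPQ (Subtype.ext h)]
  · refine (mem_dualMonoid_iff (k := k)).trans ?_
    rw [Subtype.forall]
    rfl

theorem smooth_iff_isLocallyCharacter : Smooth (structureMap k Δ) ↔
    ∀ P : BoundaryDivisor k Δ, IsLocallyCharacter Δ P 1 := by
  rw [smooth_structureMap_iff, ← forall_isUnimodular_iff]
  refine forall_congr' fun σ => ⟨fun _ => ?_, fun h => h.smooth⟩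
  exact isUnimodular_of_smooth (k := k) (dualMonoid σ.1)
    (Δ.isCone σ.1 σ.2).exists_add_mem_dualMonoid

end ToricFan

/-! ### The theorem -/

theorem mainTheorem4 (k : Type u) [Field k] (N : Type u) [AddCommGroup N] [Module.Free ℤ N]
    [Module.Finite ℤ N] (Δ : ToricFan N) :
    (Finite (ToricFan.divisorCokernel k Δ) ↔ Δ.IsSimplicial) ∧
    (Δ.IsSimplicial ↔ ∀ D : SchemeDivisor.WeilDivisor (ToricFan.toricVariety k Δ),
      SchemeDivisor.IsQCartier D) ∧
    (Subsingleton (ToricFan.divisorCokernel k Δ) ↔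
      AlgebraicGeometry.Smooth (ToricFan.structureMap k Δ)) ∧
    (AlgebraicGeometry.Smooth (ToricFan.structureMap k Δ) ↔
      ∀ D : SchemeDivisor.WeilDivisor (ToricFan.toricVariety k Δ), SchemeDivisor.IsCartier D) :=
  ⟨ToricFan.finite_divisorCokernel_iff.trans ToricFan.isSimplicial_iff.symm,
    ToricFan.isSimplicial_iff.trans ToricFan.forall_isQCartier_iff.symm,
    ToricFan.subsingleton_divisorCokernel_iff.trans ToricFan.smooth_iff_isLocallyCharacter.symm,
    ToricFan.smooth_iff_isLocallyCharacter.trans ToricFan.forall_isCartier_iff.symm⟩
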